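/- **Setting.** Let $(\epsilon_i)_{i\in\mathbb Z}$ and $(\xi_i)_{i\in\mathbb Z}$ be two independent sequences of i.i.d. random elements, $\mathcal F_i=(\ldots,\epsilon_{i-1},\epsilon_i)$, $\mathcal G_i=(\ldots,\xi_{i-1},\xi_i)$, $\chi_i=(\epsilon_i,\xi_i)$, $\mathcal R_i=(\ldots,\chi_{i-1},\chi_i)$. For $i=1,\ldots,n$ and $t_i=i/n$ we observe $$y_i=\mathbf x_i^\top\beta(t_i)+\varepsilon_i,\qquad \mathbf x_i=\mathbf G(t_i,\mathcal F_i)\in\mathbb R^p,\qquad \varepsilon_i=H(t_i,\mathcal G_i)V(t_i,\mathcal F_i),$$ where $\mathbf G,V,H$ are measurable filters, $\mathbb E H(t,\mathcal G_i)=0$, $\operatorname{var}H(t,\mathcal G_i)=1$ and $\mathbb E V(t,\mathcal F_i)^2<\infty$ for $t\in[0,1]$. Write $\|Z\|_r=(\mathbb E|Z|^r)^{1/r}$ and, for a filter $L$, $\delta_r(L,k)=\sup_{0\le t\le1}\|L(t,\mathcal R_k)-L(t,\mathcal R_k^*)\|_r$, where $\mathcal R_k^*$ is $\mathcal R_k$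 with $\chi_0$ replaced by an independent copy. $L\in\mathcal U^r$ means $\|L(t,\mathcal R_0)\|_r<\infty$ for all $t\in[0,1]$; $L\in\mathrm{Lip}_r$ means $\sup_{0\le s<t\le1}\|L(t,\mathcal R_0)-L(s,\mathcal R_0)\|_r/(t-s)<\infty$. Put $\mathbf U(t,\mathcal R_i)=\mathbf G(t,\mathcal F_i)V(t,\mathcal F_i)H(t,\mathcal G_i)$, $M(t)=\mathbb E[\mathbf G(t,\mathcal F_0)\mathbf G(t,\mathcal F_0)^\top]$ and $\Lambda(t)=\sum_{i\in\mathbb Z}\operatorname{cov}(\mathbf U(t,\mathcal R_0),\mathbf U(t,\mathcal R_i))$. **Condition (A).** The smallest eigenvalues of $M(t)$ and of $\Lambda(t)$ are bounded away from $0$ on $[0,1]$; $M\in\mathcal C^2[0,1]$; $\mathbf G\in\mathcal U^{32}\cap\mathrm{Lip}_2$; $\mathbf U\in\mathcal U^4\cap\mathrm{Lip}_2$; $\sum_k\delta_{32}(\mathbf G,k)<\infty$; $\delta_4(V,k)+\delta_4(H,k)=O((k+1)^{-2})$; $\delta_4(\mathbf U,k)=O(\rho^k)$ for some $\rho\in(0,1)$;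 and $\beta_j\in\mathcal C^2[0,1]$ for all $j$. **Kernel and bandwidth.** $K$ is a symmetric probability density that vanishes outside $[-1,1]$ and is $\mathcal C^1$ on $[-1,1]$; $b_n>0$, $nb_n^{9/2}=O(1)$ and $nb_n^4/(\log n)^6\to\infty$. The local linear estimate at $t$ for data $(\mathbf x_i,y_i)$ is the $\eta_0$-component of a minimiser $(\eta_0,\eta_1)$ of $\sum_{i=1}^n\bigl(y_i-\mathbf x_i^\top\eta_0-\mathbf x_i^\top\eta_1(t_i-t)\bigr)^2K((t_i-t)/b_n)$, and the residual sum of squares (RSS) of the local linear regression is $\sum_{i=1}^n(y_i-\mathbf x_i^\top\hat\beta(t_i))^2$. **Composite null hypothesis.** Split $\mathbf x_i=(\mathbf x_i^{(1)},\mathbf x_i^{(2)})$ and $\beta=(\beta^{(1)},\beta^{(2)})$ into blocks of dimensions $p_1\ge1$ and $p_2=p-p_1\ge0$, and suppose that $\beta^{(1)}(t)=\beta_0^{(1)}(t,\theta_0)$ for all $t\in[0,1]$, for a parametric family $\beta_0^{(1)}(\cdot,\theta)$ and an unknown $\theta_0\in\mathbb R^q$. **Condition (B).** On some open neighbourhood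 $\Theta$ of $\theta_0$, $\beta_0^{(1)}(t,\cdot)$ is $\mathcal C^2$ for each $t\in[0,1]$, with first and second $\theta$-derivatives bounded uniformly over $t\in[0,1]$, $\theta\in\Theta$; and the estimators $\hat\theta=\hat\theta_n$ satisfy $\|\hat\theta-\theta_0\|_4=O(1/\sqrt n)$. Let $\mathrm{RSS}_1$ and $\widetilde{\mathrm{RSS}}_1$ be the RSS of the local linear regression (bandwidth $b_n$) on $\mathbf x_i^{(2)}$ of $y_i-\beta_0^{(1)}(t_i,\theta_0)^\top\mathbf x_i^{(1)}$ and of $y_i-\beta_0^{(1)}(t_i,\hat\theta)^\top\mathbf x_i^{(1)}$, respectively (for $p_2=0$ nothing is regressed, and these are the sums of squares of the displayed variables). Let $\mathrm{RSS}_a$ be the RSS of the local linear regression (bandwidth $b_n$) of $y_i$ on $\mathbf x_i$, and put $$\lambda_{1n}=\frac n2\log\frac{\mathrm{RSS}_1}{\mathrm{RSS}_a},\qquad \tilde\lambda_{1n}=\frac n2\log\frac{\widetilde{\mathrm{RSS}}_1}{\mathrm{RSS}_a}.$$ **Proposition.** Under these assumptions: 1. $\widetilde{\mathrm{RSS}}_1-\mathrm{RSS}_1=O_{\mathbb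 P}(\sqrt n\,b_n^2)+O_{\mathbb P}(1)$. 2. Consequently, limit theorems for the generalized likelihood ratio statistic remain valid with $\theta_0$ estimated: $\sqrt{b_n}\,(2\tilde\lambda_{1n}-2\lambda_{1n})\to0$ in probability, and for all real constants $c_n$ and every probability law $\nu$ on $\mathbb R$, $\sqrt{b_n}\,(2\tilde\lambda_{1n}+c_n)\Rightarrow\nu$ if and only if $\sqrt{b_n}\,(2\lambda_{1n}+c_n)\Rightarrow\nu$. The case $p_2=0$ covers the null hypothesis in which the whole of $\beta$ is parametric; the case $p_2\ge1$ covers the semiparametric one. -/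

import Mathlib

open MeasureTheory ProbabilityTheory Filter Topology Set
open scoped ENNReal BigOperators

noncomputable section

/-! ### Locally stationary processes -/

/-- The innovation history `(…, χ_{i-1}, χ_i)`, listed backwards in time:
the `j`-th entry is `χ_{i-j}`. -/
def past {Ω S : Type*} (χ : ℤ → Ω → S) (i : ℤ) (ω : Ω) : ℕ → S :=
  fun j => χ (i - j) ω

/-- The history at time `k` in which `χ_0` has been replaced by `χ*_0`. On `Ω × Ω` the process
`χ*_i (ω, ω') = χ_i ω'` is an i.i.d. copy of `χ_i (ω, ω') = χ_i ω`, independent of it. -/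
def coupledPast {Ω S : Type*} (χ : ℤ → Ω → S) (k : ℕ) (z : Ω × Ω) : ℕ → S :=
  fun j => if j = k then χ 0 z.2 else χ ((k : ℤ) - j) z.1

/-- The dependence measure
`δ_r(L,k) = sup_{0 ≤ t ≤ 1} ‖L(t, R_k) - L(t, R*_k)‖_r`. -/
def depMeasure {Ω S B : Type*} [MeasurableSpace Ω] [NormedAddCommGroup B] (μ : Measure Ω)
    (χ : ℤ → Ω → S) (L : ℝ → (ℕ → S) → B) (r : ℝ≥0∞) (k : ℕ) : ℝ≥0∞ :=
  ⨆ t ∈ Icc (0 : ℝ) 1,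
    eLpNorm (fun z : Ω × Ω => L t (past χ k z.1) - L t (coupledPast χ k z)) r (μ.prod μ)

/-- `L ∈ U^r`: finite `r`-th moment at every `t ∈ [0,1]`. -/
def FiniteMoment {Ω S B : Type*} [MeasurableSpace Ω] [NormedAddCommGroup B] (μ : Measure Ω)
    (χ : ℤ → Ω → S) (L : ℝ → (ℕ → S) → B) (r : ℝ≥0∞) : Prop :=
  ∀ t ∈ Icc (0 : ℝ) 1, MemLp (fun ω => L t (past χ 0 ω)) r μ

/-- `L ∈ Lip_r`: stochastic Lipschitz continuity on `[0,1]` in `L^r`. -/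
def StochLip {Ω S B : Type*} [MeasurableSpace Ω] [NormedAddCommGroup B] (μ : Measure Ω)
    (χ : ℤ → Ω → S) (L : ℝ → (ℕ → S) → B) (r : ℝ≥0∞) : Prop :=
  ∃ C : ℝ, ∀ s t : ℝ, 0 ≤ s → s < t → t ≤ 1 →
    eLpNorm (fun ω => L t (past χ 0 ω) - L s (past χ 0 ω)) r μ ≤ ENNReal.ofReal (C * (t - s))

/-- A sequence of i.i.d. random elements. -/
def IsIID {Ω S : Type*} [MeasurableSpace Ω] [MeasurableSpace S] (μ : Measure Ω)
    (χ : ℤ → Ω → S) : Prop :=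
  (∀ i, Measurable (χ i)) ∧ iIndepFun χ μ ∧ ∀ i, IdentDistrib (χ i) (χ 0) μ μ

/-- The joint innovations `χ_i = (ϵ_i, ξ_i)`. -/
def jointInnov {Ω E F : Type*} (eps : ℤ → Ω → E) (xi : ℤ → Ω → F) : ℤ → Ω → E × F :=
  fun i ω => (eps i ω, xi i ω)

/-- `U(t, R) = G(t, F) V(t, F) H(t, G)`. -/
def Uproc {E F ι : Type*} (G : ℝ → (ℕ → E) → EuclideanSpace ℝ ι) (V : ℝ → (ℕ → E) → ℝ)
    (H : ℝ → (ℕ → F) → ℝ) : ℝ → (ℕ → E × F) → EuclideanSpace ℝ ι :=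
  fun t r => (V t (fun j => (r j).1) * H t (fun j => (r j).2)) • G t (fun j => (r j).1)

/-- The matrix `M(t)` with entries `E[G_i(t, F_0) G_j(t, F_0)]`. -/
def Mmat {Ω E ι : Type*} [MeasurableSpace Ω] (μ : Measure Ω) (eps : ℤ → Ω → E)
    (G : ℝ → (ℕ → E) → EuclideanSpace ℝ ι) (t : ℝ) : Matrix ι ι ℝ :=
  fun i j => ∫ ω, G t (past eps 0 ω) i * G t (past eps 0 ω) j ∂μ

/-- The long-run covariance matrix `Λ(t) = ∑_{i ∈ ℤ} cov(U(t, R_0), U(t, R_i))`. -/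
def Lmat {Ω S ι : Type*} [MeasurableSpace Ω] (μ : Measure Ω) (χ : ℤ → Ω → S)
    (U : ℝ → (ℕ → S) → EuclideanSpace ℝ ι) (t : ℝ) : Matrix ι ι ℝ :=
  fun j k => ∑' i : ℤ, cov[fun ω => U t (past χ 0 ω) j, fun ω => U t (past χ i ω) k; μ]

/-- The smallest eigenvalue of the symmetric matrix `A(t)` is bounded away from `0` on `[0,1]`. -/
def MinEigBoundedBelow {ι : Type*} [Fintype ι] (A : ℝ → Matrix ι ι ℝ) : Prop :=
  ∃ c : ℝ, 0 < c ∧ ∀ t ∈ Icc (0 : ℝ) 1, ∀ v : ι → ℝ, c * ∑ i, v i ^ 2 ≤ v ⬝ᵥ (A t).mulVec v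

/-- The standing structure of the data generating mechanism: i.i.d. innovations `(ϵ_i)` and
`(ξ_i)`, independent of each other, measurable filters, `E H(t, G_i) = 0`, `Var H(t, G_i) = 1`,
and a finite second moment of `V(t, F_i)`, whose square is the conditional variance of the
errors. -/
structure StandingAssumptions {Ω E F ι : Type*} [Fintype ι] [MeasurableSpace Ω]
    [MeasurableSpace E] [MeasurableSpace F]
    (μ : Measure Ω) (eps : ℤ → Ω → E) (xi : ℤ → Ω → F)
    (G : ℝ → (ℕ → E) → EuclideanSpace ℝ ι) (V : ℝ → (ℕ → E) → ℝ)
    (H : ℝ → (ℕ → F) → ℝ) : Prop where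
  eps_iid : IsIID μ eps
  xi_iid : IsIID μ xi
  indep : IndepFun (fun ω i => eps i ω) (fun ω i => xi i ω) μ
  meas_G : ∀ t ∈ Icc (0 : ℝ) 1, Measurable (G t)
  meas_V : ∀ t ∈ Icc (0 : ℝ) 1, Measurable (V t)
  meas_H : ∀ t ∈ Icc (0 : ℝ) 1, Measurable (H t)
  V_sq : FiniteMoment μ eps V 2
  H_sq : FiniteMoment μ xi H 2
  H_mean : ∀ t ∈ Icc (0 : ℝ) 1, ∫ ω, H t (past xi 0 ω) ∂μ = 0
  H_var : ∀ t ∈ Icc (0 : ℝ) 1, variance (fun ω => H t (past xi 0 ω)) μ = 1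

/-- Condition (A). -/
structure ConditionA {Ω E F ι : Type*} [Fintype ι] [MeasurableSpace Ω]
    (μ : Measure Ω) (eps : ℤ → Ω → E) (xi : ℤ → Ω → F)
    (G : ℝ → (ℕ → E) → EuclideanSpace ℝ ι) (V : ℝ → (ℕ → E) → ℝ)
    (H : ℝ → (ℕ → F) → ℝ) (β : ℝ → ι → ℝ) : Prop where
  A1_eig : MinEigBoundedBelow (Mmat μ eps G)
  A1_smooth : ∀ i j, ContDiffOn ℝ 2 (fun t => Mmat μ eps G t i j) (Icc 0 1)
  A2_moment : FiniteMoment μ eps G 32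
  A2_lip : StochLip μ eps G 2
  A3_moment : FiniteMoment μ (jointInnov eps xi) (Uproc G V H) 4
  A3_lip : StochLip μ (jointInnov eps xi) (Uproc G V H) 2
  A4 : ∑' k, depMeasure μ eps G 32 k < ⊤
  A5 : ∃ C : ℝ, ∀ k : ℕ, depMeasure μ eps V 4 k + depMeasure μ xi H 4 k
    ≤ ENNReal.ofReal (C * (((k : ℝ) + 1) ^ 2)⁻¹)
  A6 : ∃ ρ ∈ Ioo (0 : ℝ) 1, ∃ C : ℝ, ∀ k : ℕ,
    depMeasure μ (jointInnov eps xi) (Uproc G V H) 4 k ≤ ENNReal.ofReal (C * ρ ^ k)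
  A7 : MinEigBoundedBelow (Lmat μ (jointInnov eps xi) (Uproc G V H))
  A8 : ∀ j, ContDiffOn ℝ 2 (fun t => β t j) (Icc 0 1)

/-- Condition (B) on the parametric family `β₀(t, θ)` and on the estimators `θ̂_n`. -/
structure ConditionB {Ω : Type*} [MeasurableSpace Ω] {p₁ q : ℕ} (μ : Measure Ω)
    (β₀ : ℝ → EuclideanSpace ℝ (Fin q) → EuclideanSpace ℝ (Fin p₁))
    (θ₀ : EuclideanSpace ℝ (Fin q)) (θhat : ℕ → Ω → EuclideanSpace ℝ (Fin q)) : Prop where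
  B1 : ∃ Θ : Set (EuclideanSpace ℝ (Fin q)), IsOpen Θ ∧ θ₀ ∈ Θ ∧
    (∀ t ∈ Icc (0 : ℝ) 1, ContDiffOn ℝ 2 (β₀ t) Θ) ∧
    ∃ C : ℝ, ∀ t ∈ Icc (0 : ℝ) 1, ∀ θ ∈ Θ,
      ‖iteratedFDeriv ℝ 1 (β₀ t) θ‖ + ‖iteratedFDeriv ℝ 2 (β₀ t) θ‖ ≤ C
  B2_meas : ∀ n, Measurable (θhat n)
  B2 : ∃ C : ℝ, ∀ᶠ n : ℕ in atTop,
    eLpNorm (fun ω => θhat n ω - θ₀) 4 μ ≤ ENNReal.ofReal (C / √(n : ℝ))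

/-! ### Kernel, bandwidth and local linear regression -/

/-- The class of symmetric densities supported in `[-1,1]` that are `C¹` on `[-1,1]`. -/
structure IsKernel (K : ℝ → ℝ) : Prop where
  nonneg : ∀ u, 0 ≤ K u
  integral_one : ∫ u, K u = 1
  symm : ∀ u, K (-u) = K u
  supp : ∀ u, u ∉ Icc (-1 : ℝ) 1 → K u = 0
  smooth : ContDiffOn ℝ 1 K (Icc (-1) 1)

/-- `b_n > 0`, `n b_n^{9/2} = O(1)` and `n b_n^4 / (log n)^6 → ∞`. -/
structure BandwidthCondition (b : ℕ → ℝ) : Prop where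
  pos : ∀ n, 0 < b n
  upper : ∃ C : ℝ, ∀ᶠ n : ℕ in atTop, (n : ℝ) * b n ^ (9 / 2 : ℝ) ≤ C
  lower : Tendsto (fun n : ℕ => (n : ℝ) * b n ^ 4 / Real.log n ^ 6) atTop atTop

/-- `t_i = i / n`. -/
def design (n i : ℕ) : ℝ := (i : ℝ) / n

/-- The weighted least squares criterion of local linear regression at `t`, for the data
`(x_i, y_i)`, `i = 1, …, n`. -/
def localLoss {ι : Type*} [Fintype ι] (K : ℝ → ℝ) (b : ℝ) (n : ℕ) (x : ℕ → ι → ℝ) (y : ℕ → ℝ)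
    (t : ℝ) (η : (ι → ℝ) × (ι → ℝ)) : ℝ :=
  ∑ i ∈ Finset.Icc 1 n,
    (y i - x i ⬝ᵥ η.1 - (x i ⬝ᵥ η.2) * (design n i - t)) ^ 2 * K ((design n i - t) / b)

/-- `βh` is a local linear kernel estimate of the coefficient vector at `t`: together with some
slope vector it minimises the criterion. -/
def IsLocalLinearEstimate {ι : Type*} [Fintype ι] (K : ℝ → ℝ) (b : ℝ) (n : ℕ) (x : ℕ → ι → ℝ)
    (y : ℕ → ℝ) (t : ℝ) (βh : ι → ℝ) : Prop :=
  ∃ slope : ι → ℝ, IsMinOn (localLoss K b n x y t) univ (βh, slope)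

/-- Residual sum of squares, `βh i` being the coefficient vector used at `t_i`. -/
def RSS {ι : Type*} [Fintype ι] (n : ℕ) (x : ℕ → ι → ℝ) (y : ℕ → ℝ) (βh : ℕ → ι → ℝ) : ℝ :=
  ∑ i ∈ Finset.Icc 1 n, (y i - x i ⬝ᵥ βh i) ^ 2

/-- `λ = (n/2) log(RSS_null / RSS_a)`. -/
def glrt (n : ℕ) (rssNull rssAlt : ℝ) : ℝ := (n : ℝ) / 2 * Real.log (rssNull / rssAlt)

/-! ### The model -/

/-- The regressors `x_i = G(t_i, F_i)`. -/
def regressor {Ω E ι : Type*} (eps : ℤ → Ω → E) (G : ℝ → (ℕ → E) → EuclideanSpace ℝ ι)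
    (n : ℕ) (ω : Ω) (i : ℕ) : ι → ℝ :=
  fun j => G (design n i) (past eps i ω) j

/-- The errors `ε_i = H(t_i, G_i) V(t_i, F_i)`. -/
def modelError {Ω E F : Type*} (eps : ℤ → Ω → E) (xi : ℤ → Ω → F) (V : ℝ → (ℕ → E) → ℝ)
    (H : ℝ → (ℕ → F) → ℝ) (n : ℕ) (ω : Ω) (i : ℕ) : ℝ :=
  H (design n i) (past xi i ω) * V (design n i) (past eps i ω)

/-- The responses `y_i = x_iᵀ β(t_i) + ε_i`. -/
def response {Ω E F ι : Type*} [Fintype ι] (eps : ℤ → Ω → E) (xi : ℤ → Ω → F)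
    (G : ℝ → (ℕ → E) → EuclideanSpace ℝ ι) (V : ℝ → (ℕ → E) → ℝ) (H : ℝ → (ℕ → F) → ℝ)
    (β : ℝ → ι → ℝ) (n : ℕ) (ω : Ω) (i : ℕ) : ℝ :=
  regressor eps G n ω i ⬝ᵥ β (design n i) + modelError eps xi V H n ω i

/-- The first block `x^{(1)}` of a regressor sequence. -/
def block1 {ι₁ ι₂ : Type*} (x : ℕ → ι₁ ⊕ ι₂ → ℝ) : ℕ → ι₁ → ℝ := fun i j => x i (Sum.inl j)

/-- The second block `x^{(2)}` of a regressor sequence. -/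
def block2 {ι₁ ι₂ : Type*} (x : ℕ → ι₁ ⊕ ι₂ → ℝ) : ℕ → ι₂ → ℝ := fun i j => x i (Sum.inr j)

/-- `y_i - β^{(1)}_0(t_i, θ)ᵀ x_i^{(1)}`. -/
def adjusted {ι₁ ι₂ : Type*} [Fintype ι₁] {q : ℕ}
    (β₀ : ℝ → EuclideanSpace ℝ (Fin q) → EuclideanSpace ℝ ι₁) (θ : EuclideanSpace ℝ (Fin q))
    (n : ℕ) (x : ℕ → ι₁ ⊕ ι₂ → ℝ) (y : ℕ → ℝ) : ℕ → ℝ :=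
  fun i => y i - ∑ j, β₀ (design n i) θ j * block1 x i j

/-! ### Stochastic orders and limits -/

/-- `X_n = O_P(a_n)`. -/
def IsBigOP {Ω : Type*} [MeasurableSpace Ω] (μ : Measure Ω) (X : ℕ → Ω → ℝ) (a : ℕ → ℝ) : Prop :=
  ∀ η : ℝ, 0 < η → ∃ C : ℝ, 0 < C ∧ ∀ᶠ n in atTop,
    μ {ω | C * a n < |X n ω|} ≤ ENNReal.ofReal η

/-- Convergence in distribution `X_n ⇒ ν` of real random variables: convergence of the
distribution functions at every continuity point of the limit. -/
def ConvergesInLaw {Ω : Type*} [MeasurableSpace Ω] (μ : Measure Ω) (X : ℕ → Ω → ℝ)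
    (ν : Measure ℝ) : Prop :=
  ∀ x : ℝ, ν {x} = 0 → Tendsto (fun n => μ {ω | X n ω ≤ x}) atTop (𝓝 (ν (Iic x)))

end

set_option linter.unusedSectionVars false

/-! Where all local Gram matrices are invertible, every minimiser gives the same fit, so the two
null residual sums of squares are squared norms `‖(I - S) y‖²` with one smoother matrix `S`, built
from `x^{(2)}` alone. Under the null hypothesis the response adjusted with `θ₀` is `ℓ + ε`, where
`ℓ_j = x_j^{(2)} ⬝ β^{(2)}(t_j)`. Replacing `θ₀` by `θ̂` subtracts `d = ∑ h_l z_l + d'`: here `h =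
θ̂ - θ₀ = O_P(n^{-1/2})`, the scores `z_l` are functions of the regressors, and `d'` is a quadratic
Taylor remainder.

Expanding the square (`SmootherBounds.abs_sum_resid_sq_sub_le`) leaves three kinds of terms. The
local linear fit reproduces linear functions, so `(I - S) ℓ = O(b²)` (`exists_bias_bound`), and its
product with `(I - S) d` contributes `n · b² · n^{-1/2} = √n b²`. The terms quadratic in `h`
contribute `O_P(1)`. For the product of the errors with a score, the weights `(I - S)ᵀ(I - S) z_l`
depend only on the innovations of the regressors. With these frozen, the errors are multiples of the
centred, weakly dependent `H`, so the sum has second moment `O(n)`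
(`exists_lintegral_smoothed_errors_le`), and multiplication by `h_l` gives `O_P(1)`. Since `n b⁴ →
∞`, the order `√n b²` absorbs all of this.

The bounds on `S` are pathwise. The sample is cut into blocks of length proportional to `n b`;
Chebyshev and a union bound show that all block averages of `x xᵀ` are close to those of `M`
(`tendsto_measure_not_regularPaths`), and two blocks at different distances from `t_i` make the Gram
matrix at `t_i` coercive, uniformly in `i` (`gramCoercive_of_blocks`). All variance bounds come from
the Efron–Stein inequality combined with the dependence measures (`variance_sum_past_le`).

For the statistics, the residual sum of squares under the null must also be at least of order `n`.
Positive definiteness of `Λ(0)` prevents `x ε` from degenerating, so `∑ |x_i| |ε_i|` grows linearly,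
and Cauchy–Schwarz passes this on to `∑ ε_i²`; smoothing removes only `O_P(1/b)` from the errors.
Hence the logarithms differ by `O_P(b² / √n)`, and the normalised statistics by `O_P(√(n b⁵))`,
which vanishes because `n b^{9/2}` is bounded and `b → 0`. The alternative residual sum of squares
cancels, and Slutsky's argument transfers limit laws. -/

theorem integral_sq_eq_eLpNorm {Ω : Type*} [MeasurableSpace Ω] {μ : Measure Ω} {f : Ω → ℝ} (hf : AEStronglyMeasurable f μ) :
    ∫ ω, f ω ^ 2 ∂μ = (eLpNorm f 2 μ).toReal ^ 2 := by
  rw [integral_eq_lintegral_of_nonneg_ae (ae_of_all _ fun _ => sq_nonneg _)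
    (by fun_prop), eLpNorm_eq_lintegral_rpow_enorm_toReal (by norm_num) (by norm_num),
    ← ENNReal.toReal_pow, ← ENNReal.rpow_natCast, ← ENNReal.rpow_mul]
  norm_num
  congr 1
  refine lintegral_congr fun ω => ?_
  rw [← enorm_pow, Real.enorm_of_nonneg (sq_nonneg _)]

/-! ### Independent copies of an i.i.d. sequence -/

/-- Both laws are the infinite product of the same common marginal. -/
theorem identDistrib_comp_of_injective {Ω S κ ι : Type*} [MeasurableSpace Ω] [MeasurableSpace S]
    {μ : Measure Ω} {W : κ → Ω → S} (hm : ∀ i, Measurable (W i)) (hi : iIndepFun W μ)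
    (hd : ∀ i j, μ.map (W i) = μ.map (W j)) {e e' : ι → κ} (he : Function.Injective e)
    (he' : Function.Injective e') :
    IdentDistrib (fun ω i => W (e i) ω) (fun ω i => W (e' i) ω) μ μ where
  aemeasurable_fst := (measurable_pi_lambda _ fun i => hm (e i)).aemeasurable
  aemeasurable_snd := (measurable_pi_lambda _ fun i => hm (e' i)).aemeasurable
  map_eq := by
    have h1 := (hi.precomp he).map_fun_eq_infinitePi_map fun i => hm (e i)
    have h2 := (hi.precomp he').map_fun_eq_infinitePi_map fun i => hm (e' i)
    have h3 : (fun i => μ.map (W (e i))) = fun i => μ.map (W (e' i)) := funext fun i => hd _ _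
    exact (h1.trans (congrArg _ h3)).trans h2.symm

/-- The sequence `χ` together with an independent copy of it, on `Ω × Ω`. -/
def doubled {Ω S : Type*} (χ : ℤ → Ω → S) : ℤ ⊕ ℤ → Ω × Ω → S :=
  Sum.elim (fun i z => χ i z.1) (fun i z => χ i z.2)

section Doubled

variable {Ω S : Type*} [MeasurableSpace Ω] [MeasurableSpace S] {μ : Measure Ω} {χ : ℤ → Ω → S}

theorem measurable_doubled (h : IsIID μ χ) (i : ℤ ⊕ ℤ) : Measurable (doubled χ i) := by
  rcases i with i | i
  · exact (h.1 i).comp measurable_fst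
  · exact (h.1 i).comp measurable_snd

theorem measurable_past (h : IsIID μ χ) (n : ℤ) : Measurable (past χ n) :=
  measurable_pi_lambda _ fun _ => h.1 _

theorem identDistrib_past (h : IsIID μ χ) (n m : ℤ) :
    IdentDistrib (past χ n) (past χ m) μ μ :=
  identDistrib_comp_of_injective (e := fun j : ℕ => n - j) (e' := fun j : ℕ => m - j)
    h.1 h.2.1 (fun i j => by rw [(h.2.2 i).map_eq, (h.2.2 j).map_eq])
    (fun i j hij => by simpa using hij) (fun i j hij => by simpa using hij)

variable [IsProbabilityMeasure μ]

theorem map_doubled (h : IsIID μ χ) (i : ℤ ⊕ ℤ) :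
    (μ.prod μ).map (doubled χ i) = μ.map (χ 0) := by
  rcases i with i | i
  · have : doubled χ (Sum.inl i) = χ i ∘ Prod.fst := rfl
    rw [this, ← Measure.map_map (h.1 i) measurable_fst, Measure.map_fst_prod]
    simpa using (h.2.2 i).map_eq
  · have : doubled χ (Sum.inr i) = χ i ∘ Prod.snd := rfl
    rw [this, ← Measure.map_map (h.1 i) measurable_snd, Measure.map_snd_prod]
    simpa using (h.2.2 i).map_eq

/-- A finite cylinder event for the doubled sequence is a rectangle in `Ω × Ω`, so independence
within each factor suffices. -/
theorem iIndepFun_doubled (h : IsIID μ χ) : iIndepFun (doubled χ) (μ.prod μ) := by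
  rw [iIndepFun_iff_measure_inter_preimage_eq_mul]
  intro s t ht
  have hset : (⋂ i ∈ s, doubled χ i ⁻¹' t i) =
      (⋂ i ∈ s.toLeft, χ i ⁻¹' t (Sum.inl i)) ×ˢ (⋂ i ∈ s.toRight, χ i ⁻¹' t (Sum.inr i)) := by
    ext z
    simp [doubled]
  have hl := (iIndepFun_iff_measure_inter_preimage_eq_mul.1 h.2.1) s.toLeft
    (sets := fun i => t (Sum.inl i)) (fun i hi => ht _ (by simpa using hi))
  have hr := (iIndepFun_iff_measure_inter_preimage_eq_mul.1 h.2.1) s.toRight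
    (sets := fun i => t (Sum.inr i)) (fun i hi => ht _ (by simpa using hi))
  rw [hset, Measure.prod_prod, hl, hr, Finset.prod_sum_eq_prod_toLeft_mul_prod_toRight]
  congr 1
  · refine Finset.prod_congr rfl fun i hi => ?_
    have hi' : MeasurableSet (t (Sum.inl i)) := ht _ (by simpa using hi)
    rw [← Measure.map_apply (h.1 i) hi', ← Measure.map_apply (measurable_doubled h _) hi',
      map_doubled h, (h.2.2 i).map_eq]
  · refine Finset.prod_congr rfl fun i hi => ?_
    have hi' : MeasurableSet (t (Sum.inr i)) := ht _ (by simpa using hi)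
    rw [← Measure.map_apply (h.1 i) hi', ← Measure.map_apply (measurable_doubled h _) hi',
      map_doubled h, (h.2.2 i).map_eq]

/-- The source of the exchangeability arguments below: coordinates of the sequence and its copy may
be permuted or exchanged at will, as long as none is used twice. -/
theorem identDistrib_doubled (h : IsIID μ χ) {ι : Type*} {e e' : ι → ℤ ⊕ ℤ}
    (he : Function.Injective e) (he' : Function.Injective e') :
    IdentDistrib (fun z i => doubled χ (e i) z) (fun z i => doubled χ (e' i) z)
      (μ.prod μ) (μ.prod μ) :=
  identDistrib_comp_of_injective (measurable_doubled h) (iIndepFun_doubled h)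
    (fun i j => by rw [map_doubled h, map_doubled h]) he he'

/-! ### The Efron–Stein inequality -/

/-- The first `N` coordinates of the past are replaced by those of the independent copy. -/
def hybridPast (χ : ℤ → Ω → S) (n : ℤ) (N : ℕ) (z : Ω × Ω) : ℕ → S :=
  fun j => if j < N then χ (n - j) z.2 else χ (n - j) z.1

/-- The past up to time `n` with the `k`-th coordinate resampled. -/
def resampledPast (χ : ℤ → Ω → S) (n : ℤ) (k : ℕ) (z : Ω × Ω) : ℕ → S :=
  Function.update (past χ n z.1) k (χ (n - k) z.2)

/-- Square integrable functions of the past are approximated by functions of finitely many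
coordinates. -/
theorem exists_finite_dependence_approx {P : Measure (ℕ → S)} [IsProbabilityMeasure P]
    {f : (ℕ → S) → ℝ} (hf : MemLp f 2 P) {ε : ℝ≥0∞} (hε : ε ≠ 0) :
    ∃ g : (ℕ → S) → ℝ, eLpNorm (f - g) 2 P ≤ ε ∧
      (Measurable g ∧ ∃ M : ℕ, ∀ x y : ℕ → S, (∀ j < M, x j = y j) → g x = g y) := by
  refine MemLp.induction_dense (by norm_num) _ ?_ ?_ ?_ hf hε
  · intro c s hs _ ε hε
    obtain ⟨η, hη, hη'⟩ := exists_eLpNorm_indicator_le (μ := P) (p := 2) (by norm_num) c hε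
    -- Measurable cylinders form an algebra that generates the product σ-algebra, so some cylinder
    -- is close to `s` in measure, and its indicator reads finitely many coordinates.
    obtain ⟨t, ht, hts⟩ := exists_measure_symmDiff_lt_of_generateFrom_isSetRing (μ := P)
      (isSetAlgebra_measurableCylinders (ι := ℕ) (α := fun _ => S)).isSetRing
      ⟨{univ}, by simp, by simpa using univ_mem_measurableCylinders (fun _ : ℕ => S), by simp⟩
      generateFrom_measurableCylinders.symm hs (ε := η) (by exact_mod_cast hη)
    refine ⟨t.indicator fun _ => c, ?_,
      measurable_const.indicator (MeasurableSet.of_mem_measurableCylinders ht), ?_⟩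
    · rw [eLpNorm_indicator_sub_indicator]
      exact hη' _ hts.le
    · obtain ⟨J, T, -, rfl⟩ := (mem_measurableCylinders t).1 ht
      refine ⟨J.sup id + 1, fun x y hxy => ?_⟩
      have : x ∈ cylinder J T ↔ y ∈ cylinder J T := by
        have hxy' : J.restrict x = J.restrict y := funext fun j =>
          hxy _ (Nat.lt_succ_of_le (Finset.le_sup (f := id) j.2))
        rw [mem_cylinder, mem_cylinder, hxy']
      by_cases hx : x ∈ cylinder J T
      · rw [indicator_of_mem hx, indicator_of_mem (this.1 hx)]
      · rw [indicator_of_notMem hx, indicator_of_notMem (fun h => hx (this.2 h))]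
  · rintro f g ⟨hf, M, hM⟩ ⟨hg, M', hM'⟩
    refine ⟨hf.add hg, max M M', fun x y hxy => ?_⟩
    rw [Pi.add_apply, Pi.add_apply, hM x y fun j hj => hxy j (lt_max_of_lt_left hj),
      hM' x y fun j hj => hxy j (lt_max_of_lt_right hj)]
  · rintro f ⟨hf, -⟩
    exact hf.aestronglyMeasurable

theorem identDistrib_hybridPast (h : IsIID μ χ) (n : ℤ) (N : ℕ) :
    IdentDistrib (fun z : Ω × Ω => past χ n z.1) (hybridPast χ n N) (μ.prod μ) (μ.prod μ) := by
  have := identDistrib_doubled h (e := fun j : ℕ => Sum.inl (n - j))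
    (e' := fun j : ℕ => if j < N then Sum.inr (n - (j : ℤ)) else Sum.inl (n - (j : ℤ)))
    (fun i j hij => by simpa using hij)
    (fun i j hij => by
      simp only at hij
      split_ifs at hij <;> simpa using hij)
  convert! this using 2 with z
  ext j
  unfold hybridPast
  split_ifs <;> rfl

theorem identDistrib_snd_past (h : IsIID μ χ) (n : ℤ) :
    IdentDistrib (fun z : Ω × Ω => past χ n z.1) (fun z : Ω × Ω => past χ n z.2)
      (μ.prod μ) (μ.prod μ) :=
  identDistrib_doubled h (e := fun j : ℕ => Sum.inl (n - j))
    (e' := fun j : ℕ => Sum.inr (n - j)) (fun i j hij => by simpa using hij)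
    (fun i j hij => by simpa using hij)

theorem identDistrib_fst_past (h : IsIID μ χ) (n : ℤ) :
    IdentDistrib (past χ n) (fun z : Ω × Ω => past χ n z.1) μ (μ.prod μ) where
  aemeasurable_fst := (measurable_past h n).aemeasurable
  aemeasurable_snd := ((measurable_past h n).comp measurable_fst).aemeasurable
  map_eq := by
    have : (fun z : Ω × Ω => past χ n z.1) = past χ n ∘ Prod.fst := rfl
    rw [this, ← Measure.map_map (measurable_past h n) measurable_fst, Measure.map_fst_prod]
    simp

/-- Swapping the `k`-th coordinates of the past and of its independent copy. -/
theorem identDistrib_swap (h : IsIID μ χ) (n : ℤ) (k : ℕ) :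
    IdentDistrib
      (fun z : Ω × Ω => ((past χ n z.1, resampledPast χ n k z),
        (hybridPast χ n k z, hybridPast χ n (k + 1) z)))
      (fun z : Ω × Ω => ((resampledPast χ n k z, past χ n z.1),
        (hybridPast χ n (k + 1) z, hybridPast χ n k z))) (μ.prod μ) (μ.prod μ) := by
  have h1 := identDistrib_doubled h (e := (id : ℤ ⊕ ℤ → ℤ ⊕ ℤ))
    (e' := Equiv.swap (Sum.inl (n - (k : ℤ))) (Sum.inr (n - (k : ℤ))))
    Function.injective_id (Equiv.injective _)
  have hu : Measurable (fun w : ℤ ⊕ ℤ → S =>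
      (((fun j : ℕ => w (Sum.inl (n - j))),
        (fun j : ℕ => if j = k then w (Sum.inr (n - j)) else w (Sum.inl (n - j)))),
       ((fun j : ℕ => if j < k then w (Sum.inr (n - j)) else w (Sum.inl (n - j))),
        (fun j : ℕ => if j < k + 1 then w (Sum.inr (n - j)) else w (Sum.inl (n - j)))))) := by
    refine ((measurable_pi_lambda _ fun j => ?_).prodMk (measurable_pi_lambda _ fun j => ?_)).prodMk
      ((measurable_pi_lambda _ fun j => ?_).prodMk (measurable_pi_lambda _ fun j => ?_))
    · fun_prop
    · split_ifs <;> fun_prop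
    · split_ifs <;> fun_prop
    · split_ifs <;> fun_prop
  have h2 := h1.comp hu
  have key : ∀ (z : Ω × Ω) (j : ℕ), j ≠ k → Equiv.swap (Sum.inl (n - (k : ℤ)))
      (Sum.inr (n - (k : ℤ))) (Sum.inl (n - (j : ℤ)) : ℤ ⊕ ℤ) = Sum.inl (n - (j : ℤ)) ∧
      Equiv.swap (Sum.inl (n - (k : ℤ)))
      (Sum.inr (n - (k : ℤ))) (Sum.inr (n - (j : ℤ)) : ℤ ⊕ ℤ) = Sum.inr (n - (j : ℤ)) := by
    intro z j hj
    constructor <;> apply Equiv.swap_apply_of_ne_of_ne <;> simp [hj]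
  convert! h2 using 2 with z z
  · refine Prod.ext (Prod.ext ?_ ?_) (Prod.ext ?_ ?_) <;> ext j <;>
      simp only [past, resampledPast, hybridPast, doubled, Function.comp_apply, id,
        Function.update_apply, Sum.elim_inl, Sum.elim_inr]
    all_goals grind
  · refine Prod.ext (Prod.ext ?_ ?_) (Prod.ext ?_ ?_) <;> ext j <;>
      simp only [past, resampledPast, hybridPast, Function.comp_apply,
        Function.update_apply] <;> rcases eq_or_ne j k with rfl | hj
    all_goals first
      | (rw [(key z j hj).1, (key z j hj).2]; simp only [doubled, Sum.elim_inl, Sum.elim_inr]; grind)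
      | (rw [(key z j hj).1]; simp only [doubled, Sum.elim_inl, Sum.elim_inr]; grind)
      | (simp [doubled])

/-- Consecutive hybrids differ at lag `k` only, so a hybrid step is a resampling of that coordinate;
which copy supplies the other coordinates does not affect the joint law. -/
theorem identDistrib_hybrid_step (h : IsIID μ χ) (n : ℤ) (k : ℕ) :
    IdentDistrib (fun z : Ω × Ω => (past χ n z.1, resampledPast χ n k z))
      (fun z : Ω × Ω => (hybridPast χ n k z, hybridPast χ n (k + 1) z))
      (μ.prod μ) (μ.prod μ) := by
  -- `none` carries the fresh value at lag `k`, and `some j` the value at lag `j` before the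
  -- resampling.
  have h1 := identDistrib_doubled h
    (e := (fun o : Option ℕ => o.elim (Sum.inr (n - (k : ℤ))) fun j => Sum.inl (n - (j : ℤ))))
    (e' := (fun o : Option ℕ => o.elim (Sum.inr (n - (k : ℤ))) fun j =>
      if j < k then Sum.inr (n - (j : ℤ)) else Sum.inl (n - (j : ℤ))))
    (by
      rintro (_ | i) (_ | j) hij <;> simp at hij ⊢
      exact hij)
    (by
      rintro (_ | i) (_ | j) hij <;> simp at hij ⊢
      · split_ifs at hij <;> simp at hij; omega
      · split_ifs at hij <;> simp at hij; omega
      · split_ifs at hij <;> simpa using hij)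
  have hu : Measurable (fun w : Option ℕ → S => ((fun j : ℕ => w (some j)),
      (fun j : ℕ => if j = k then w none else w (some j)))) := by
    refine (measurable_pi_lambda _ fun j => ?_).prodMk (measurable_pi_lambda _ fun j => ?_)
    · fun_prop
    · split_ifs <;> fun_prop
  have h2 := h1.comp hu
  convert! h2 using 2 with z z
  · refine Prod.ext ?_ ?_ <;> ext j <;>
      simp only [past, resampledPast, doubled, Function.comp_apply, Option.elim_some,
        Option.elim_none, Function.update_apply, Sum.elim_inl, Sum.elim_inr]
  · refine Prod.ext ?_ ?_ <;> ext j <;>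
      simp only [hybridPast, Function.comp_apply, Option.elim_some,
        Option.elim_none] <;> rcases lt_trichotomy j k with hj | rfl | hj
    · simp [doubled, hj]
    · simp [doubled]
    · simp [doubled, hj.not_gt]
    · simp [doubled, hj, hj.ne, hj.trans (Nat.lt_succ_self k)]
    · simp [doubled]
    · simp [doubled, hj.ne', hj.not_gt, Nat.lt_succ_iff, hj.not_ge]

/-- Swapping the two copies of the innovation at lag `k` shows that twice the left side is the mean
of the product of the two increments: that of `Φ` under resampling and that between the hybrids.
Both increments have the same law, so `x y ≤ x² + y²` suffices; the sharp factor `1/2` is not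
needed. -/
theorem integral_mul_hybrid_sub_le (h : IsIID μ χ) (n : ℤ) {Φ : (ℕ → S) → ℝ} (hΦ : Measurable Φ)
    (hL : MemLp (fun ω => Φ (past χ n ω)) 2 μ) (k : ℕ) :
    ∫ z, Φ (past χ n z.1) * (Φ (hybridPast χ n k z) - Φ (hybridPast χ n (k + 1) z)) ∂(μ.prod μ) ≤
      ∫ z, (Φ (past χ n z.1) - Φ (resampledPast χ n k z)) ^ 2 ∂(μ.prod μ) := by
  have hF : MemLp (fun z : Ω × Ω => Φ (past χ n z.1)) 2 (μ.prod μ) :=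
    ((identDistrib_fst_past h n).comp hΦ).memLp_iff.1 hL
  have hH : ∀ N, MemLp (fun z : Ω × Ω => Φ (hybridPast χ n N z)) 2 (μ.prod μ) := fun N =>
    ((identDistrib_hybridPast h n N).comp hΦ).memLp_iff.1 hF
  have hR : MemLp (fun z : Ω × Ω => Φ (resampledPast χ n k z)) 2 (μ.prod μ) :=
    ((identDistrib_swap h n k).comp (hΦ.comp (measurable_fst.comp measurable_fst))).memLp_iff.1 hF
  have hD := (hH k).sub (hH (k + 1))
  have e1 := ((identDistrib_swap h n k).comp
    (u := fun p : ((ℕ → S) × (ℕ → S)) × ((ℕ → S) × (ℕ → S)) =>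
      Φ p.1.1 * (Φ p.2.1 - Φ p.2.2)) (by fun_prop)).integral_eq
  have e2 := ((identDistrib_hybrid_step h n k).comp
    (u := fun p : (ℕ → S) × (ℕ → S) => (Φ p.1 - Φ p.2) ^ 2) (by fun_prop)).integral_eq
  simp only [Function.comp_apply] at e1 e2
  have i1 : Integrable (fun z : Ω × Ω => Φ (past χ n z.1) *
      (Φ (hybridPast χ n k z) - Φ (hybridPast χ n (k + 1) z))) (μ.prod μ) := hF.integrable_mul hD
  have i2 : Integrable (fun z : Ω × Ω => Φ (resampledPast χ n k z) *
      (Φ (hybridPast χ n (k + 1) z) - Φ (hybridPast χ n k z))) (μ.prod μ) :=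
    hR.integrable_mul ((hH (k + 1)).sub (hH k))
  have i3 : Integrable (fun z : Ω × Ω => (Φ (past χ n z.1) - Φ (resampledPast χ n k z)) ^ 2)
      (μ.prod μ) := (hF.sub hR).integrable_sq
  have i4 : Integrable (fun z : Ω × Ω =>
      (Φ (hybridPast χ n k z) - Φ (hybridPast χ n (k + 1) z)) ^ 2) (μ.prod μ) := hD.integrable_sq
  have hle : ∫ z, (Φ (past χ n z.1) * (Φ (hybridPast χ n k z) - Φ (hybridPast χ n (k + 1) z)) +
      Φ (resampledPast χ n k z) * (Φ (hybridPast χ n (k + 1) z) - Φ (hybridPast χ n k z)))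
        ∂(μ.prod μ) ≤
      ∫ z, ((Φ (past χ n z.1) - Φ (resampledPast χ n k z)) ^ 2 +
        (Φ (hybridPast χ n k z) - Φ (hybridPast χ n (k + 1) z)) ^ 2) ∂(μ.prod μ) := by
    refine integral_mono (i1.add i2) (i3.add i4) fun z => ?_
    simp only
    nlinarith [sq_nonneg (Φ (past χ n z.1) - Φ (resampledPast χ n k z) -
      (Φ (hybridPast χ n k z) - Φ (hybridPast χ n (k + 1) z))),
      sq_nonneg (Φ (past χ n z.1) - Φ (resampledPast χ n k z)),
      sq_nonneg (Φ (hybridPast χ n k z) - Φ (hybridPast χ n (k + 1) z))]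
  rw [integral_add i1 i2, integral_add i3 i4] at hle
  linarith

/-- The `N`-th hybrid shares its first `N` coordinates with the independent copy, and `Φ` is close
in `L²` to a function `g` of those coordinates. The two values of `g` cancel, and each remainder has
norm at most `ε`. -/
theorem exists_hybrid_approx (h : IsIID μ χ) (n : ℤ) {Φ : (ℕ → S) → ℝ} (hΦ : Measurable Φ)
    (hL : MemLp (fun ω => Φ (past χ n ω)) 2 μ) {ε : ℝ} (hε : 0 < ε) :
    ∃ N, ∫ z, (Φ (hybridPast χ n N z) - Φ (past χ n z.2)) ^ 2 ∂(μ.prod μ) ≤ (2 * ε) ^ 2 := by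
  have : IsProbabilityMeasure (μ.map (past χ n)) :=
    Measure.isProbabilityMeasure_map (measurable_past h n).aemeasurable
  have hP : MemLp Φ 2 (μ.map (past χ n)) :=
    (memLp_map_measure_iff hΦ.aestronglyMeasurable (measurable_past h n).aemeasurable).2 hL
  obtain ⟨g, hg, hgm, N, hN⟩ := exists_finite_dependence_approx hP
    (ε := ENNReal.ofReal ε) (by simpa using hε)
  refine ⟨N, ?_⟩
  have hm : Measurable (Φ - g) := hΦ.sub hgm
  rw [eLpNorm_map_measure hm.aestronglyMeasurable (measurable_past h n).aemeasurable] at hg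
  have e1 := ((identDistrib_fst_past h n).comp hm).eLpNorm_eq (p := 2)
  have e2 := ((identDistrib_hybridPast h n N).comp hm).eLpNorm_eq (p := 2)
  have e3 := ((identDistrib_snd_past h n).comp hm).eLpNorm_eq (p := 2)
  have m1 : AEStronglyMeasurable ((Φ - g) ∘ hybridPast χ n N) (μ.prod μ) :=
    ((identDistrib_hybridPast h n N).comp hm).aemeasurable_snd.aestronglyMeasurable
  have m2 : AEStronglyMeasurable ((Φ - g) ∘ fun z : Ω × Ω => past χ n z.2) (μ.prod μ) :=
    ((identDistrib_snd_past h n).comp hm).aemeasurable_snd.aestronglyMeasurable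
  have heq : (fun z : Ω × Ω => Φ (hybridPast χ n N z) - Φ (past χ n z.2)) =
      ((Φ - g) ∘ hybridPast χ n N) - ((Φ - g) ∘ fun z : Ω × Ω => past χ n z.2) := by
    ext z
    have : g (hybridPast χ n N z) = g (past χ n z.2) :=
      hN _ _ fun j hj => by simp [hybridPast, past, hj]
    simp [this]
  have hle : eLpNorm (fun z : Ω × Ω => Φ (hybridPast χ n N z) - Φ (past χ n z.2)) 2 (μ.prod μ) ≤
      ENNReal.ofReal (2 * ε) := by
    rw [heq]
    refine (eLpNorm_sub_le m1 m2 (by norm_num)).trans ?_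
    rw [← e2, ← e3, ← e1, two_mul, ENNReal.ofReal_add hε.le hε.le]
    exact add_le_add hg hg
  rw [integral_sq_eq_eLpNorm (by rw [heq]; exact m1.sub m2)]
  have := ENNReal.toReal_mono ENNReal.ofReal_ne_top hle
  rw [ENNReal.toReal_ofReal (by positivity)] at this
  gcongr

/-- The Efron–Stein inequality for functions of an i.i.d. sequence. -/
theorem efron_stein (h : IsIID μ χ) (n : ℤ) {Φ : (ℕ → S) → ℝ} (hΦ : Measurable Φ)
    (hL : MemLp (fun ω => Φ (past χ n ω)) 2 μ) {B : ℝ}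
    (hB : ∀ N, ∑ k ∈ Finset.range N,
      ∫ z, (Φ (past χ n z.1) - Φ (resampledPast χ n k z)) ^ 2 ∂(μ.prod μ) ≤ B) :
    Var[fun ω => Φ (past χ n ω); μ] ≤ B := by
  have hF : MemLp (fun z : Ω × Ω => Φ (past χ n z.1)) 2 (μ.prod μ) :=
    ((identDistrib_fst_past h n).comp hΦ).memLp_iff.1 hL
  have hY : MemLp (fun z : Ω × Ω => Φ (past χ n z.2)) 2 (μ.prod μ) :=
    ((identDistrib_snd_past h n).comp hΦ).memLp_iff.1 hF
  have hH : ∀ N, MemLp (fun z : Ω × Ω => Φ (hybridPast χ n N z)) 2 (μ.prod μ) := fun N =>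
    ((identDistrib_hybridPast h n N).comp hΦ).memLp_iff.1 hF
  -- The variance is `E[X (X - X')]` with `X'` an independent copy of `X`.
  have hvar : Var[fun ω => Φ (past χ n ω); μ] =
      ∫ z, Φ (past χ n z.1) * (Φ (past χ n z.1) - Φ (past χ n z.2)) ∂(μ.prod μ) := by
    have e1 := ((identDistrib_fst_past h n).comp
      (u := fun p : ℕ → S => Φ p ^ 2) (by fun_prop)).integral_eq
    simp only [Function.comp_apply] at e1
    have e2 : ∫ z, Φ (past χ n z.1) * Φ (past χ n z.2) ∂(μ.prod μ) =
        (∫ ω, Φ (past χ n ω) ∂μ) * ∫ ω, Φ (past χ n ω) ∂μ :=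
      integral_prod_mul (fun ω => Φ (past χ n ω)) (fun ω => Φ (past χ n ω))
    have i1 : Integrable (fun z : Ω × Ω => Φ (past χ n z.1) * Φ (past χ n z.1)) (μ.prod μ) :=
      hF.integrable_mul hF
    have i2 : Integrable (fun z : Ω × Ω => Φ (past χ n z.1) * Φ (past χ n z.2)) (μ.prod μ) :=
      hF.integrable_mul hY
    rw [variance_eq_sub hL]
    simp only [mul_sub, Pi.pow_apply]
    rw [integral_sub i1 i2, e2, e1]
    simp only [sq]
  -- The path from `X` to the `N`-th hybrid telescopes, the hybrid with `N = 0` being the past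
  -- itself.
  have htel : ∀ N, ∫ z, Φ (past χ n z.1) *
      (Φ (past χ n z.1) - Φ (hybridPast χ n N z)) ∂(μ.prod μ) ≤ B := by
    intro N
    refine le_trans ?_ (hB N)
    have : ∀ z : Ω × Ω, Φ (past χ n z.1) * (Φ (past χ n z.1) - Φ (hybridPast χ n N z)) =
        ∑ k ∈ Finset.range N, Φ (past χ n z.1) *
          (Φ (hybridPast χ n k z) - Φ (hybridPast χ n (k + 1) z)) := by
      intro z
      rw [← Finset.mul_sum, Finset.sum_range_sub']
      congr 2
    simp only [this]
    have hi : ∀ k ∈ Finset.range N, Integrable (fun z : Ω × Ω => Φ (past χ n z.1) *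
        (Φ (hybridPast χ n k z) - Φ (hybridPast χ n (k + 1) z))) (μ.prod μ) :=
      fun k _ => hF.integrable_mul ((hH k).sub (hH (k + 1)))
    rw [integral_finsetSum _ hi]
    exact Finset.sum_le_sum fun k _ => integral_mul_hybrid_sub_le h n hΦ hL k
  set A := ∫ z, Φ (past χ n z.1) ^ 2 ∂(μ.prod μ) with hA
  refine le_of_forall_pos_le_add fun δ hδ => ?_
  have hA0 : 0 ≤ A := integral_nonneg fun _ => sq_nonneg _
  -- The gap between the `N`-th hybrid and the full copy is split by `a c ≤ η a² + c² / η`.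
  -- Approximation within `η / 2` makes the second part at most `η`, so the total error is at most
  -- `η (A + 1) ≤ δ`.
  obtain ⟨η, hη, hη'⟩ : ∃ η : ℝ, 0 < η ∧ η * (A + 1) ≤ δ :=
    ⟨δ / (A + 1), by positivity, by rw [div_mul_cancel₀ _ (by positivity)]⟩
  obtain ⟨N, hN⟩ := exists_hybrid_approx h n hΦ hL (ε := η / 2) (by positivity)
  have i1 : Integrable (fun z : Ω × Ω => Φ (past χ n z.1) *
      (Φ (past χ n z.1) - Φ (hybridPast χ n N z))) (μ.prod μ) := hF.integrable_mul (hF.sub (hH N))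
  have i3 : Integrable (fun z : Ω × Ω => η⁻¹ *
      (Φ (hybridPast χ n N z) - Φ (past χ n z.2)) ^ 2) (μ.prod μ) :=
    ((hH N).sub hY).integrable_sq.const_mul _
  have i2 : Integrable (fun z : Ω × Ω => η * Φ (past χ n z.1) ^ 2 +
      η⁻¹ * (Φ (hybridPast χ n N z) - Φ (past χ n z.2)) ^ 2) (μ.prod μ) :=
    (hF.integrable_sq.const_mul _).add i3
  rw [hvar]
  have hle : ∫ z, Φ (past χ n z.1) * (Φ (past χ n z.1) - Φ (past χ n z.2)) ∂(μ.prod μ) ≤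
      ∫ z, (Φ (past χ n z.1) * (Φ (past χ n z.1) - Φ (hybridPast χ n N z)) +
        (η * Φ (past χ n z.1) ^ 2 +
          η⁻¹ * (Φ (hybridPast χ n N z) - Φ (past χ n z.2)) ^ 2)) ∂(μ.prod μ) := by
    refine integral_mono (hF.integrable_mul (hF.sub hY)) (i1.add i2) fun z => ?_
    have : ∀ a c : ℝ, a * c ≤ η * a ^ 2 + η⁻¹ * c ^ 2 := by
      intro a c
      have h1 : a * c = (η * a) * (η⁻¹ * c) := by field_simp
      have h2 : η * a ^ 2 = η⁻¹ * (η * a) ^ 2 := by field_simp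
      have h3 : η⁻¹ * c ^ 2 = η * (η⁻¹ * c) ^ 2 := by field_simp
      have h4 : a * c = η⁻¹ * ((η * a) * c) := by field_simp
      have h5 : η * a ^ 2 + η⁻¹ * c ^ 2 = η⁻¹ * ((η * a) ^ 2 + c ^ 2) := by rw [h2]; ring
      rw [h4, h5]
      gcongr
      nlinarith [sq_nonneg (η * a - c), sq_nonneg (η * a), sq_nonneg c]
    have := this (Φ (past χ n z.1)) (Φ (hybridPast χ n N z) - Φ (past χ n z.2))
    linarith
  refine hle.trans ?_
  rw [integral_add i1 i2, integral_add (hF.integrable_sq.const_mul _) i3, integral_const_mul, integral_const_mul]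
  refine add_le_add (htel N) (le_trans ?_ hη')
  have : η⁻¹ * ∫ z, (Φ (hybridPast χ n N z) - Φ (past χ n z.2)) ^ 2 ∂(μ.prod μ) ≤ η := by
    rw [inv_mul_le_iff₀ hη]
    nlinarith
  have h1 := mul_add η A 1
  linarith

end Doubled

/-! ### Variance of sums through dependence measures -/

section VarianceOfSums

variable {Ω S : Type*} [MeasurableSpace Ω] [MeasurableSpace S] {μ : Measure Ω}
  [IsProbabilityMeasure μ] {χ : ℤ → Ω → S}

/-- Stationarity: moving time `n - k` to time `0` turns the resampled innovation into `χ_0`, and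
time `i` into time `k - (n - i)`. -/
theorem identDistrib_resampled_shift (h : IsIID μ χ) {i n k : ℕ} (hi : i ≤ n) (hk : n - i ≤ k) :
    IdentDistrib
      (fun z : Ω × Ω => (past χ i z.1, fun j : ℕ => resampledPast χ n k z (j + (n - i))))
      (fun z : Ω × Ω => (past χ ((k - (n - i) : ℕ) : ℤ) z.1, coupledPast χ (k - (n - i)) z))
      (μ.prod μ) (μ.prod μ) := by
  set m := k - (n - i) with hm
  have h1 := identDistrib_doubled h
    (e := (fun o : Option ℕ => o.elim (Sum.inr ((n : ℤ) - (k : ℤ))) fun j =>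
      Sum.inl ((i : ℤ) - (j : ℤ))))
    (e' := (fun o : Option ℕ => o.elim (Sum.inr 0) fun j => Sum.inl ((m : ℤ) - (j : ℤ))))
    (by
      rintro (_ | i) (_ | j) hij <;> simp at hij ⊢
      exact hij)
    (by
      rintro (_ | i) (_ | j) hij <;> simp at hij ⊢
      exact hij)
  have hu : Measurable (fun w : Option ℕ → S => ((fun j : ℕ => w (some j)),
      (fun j : ℕ => if j = m then w none else w (some j)))) := by
    refine (measurable_pi_lambda _ fun j => ?_).prodMk (measurable_pi_lambda _ fun j => ?_)
    · fun_prop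
    · split_ifs <;> fun_prop
  have h2 := h1.comp hu
  convert! h2 using 2 with z z
  · refine Prod.ext rfl ?_
    ext j
    simp only [resampledPast, doubled, Function.comp_apply, Option.elim_some, Option.elim_none,
      Function.update_apply, Sum.elim_inl, Sum.elim_inr, past]
    have e1 : j + (n - i) = k ↔ j = m := by omega
    have e2 : (n : ℤ) - ((j + (n - i) : ℕ) : ℤ) = i - j := by omega
    simp only [e1, e2]

/-- Schur's test: the matrix with entries `δ (k - (n - i))` has row and column sums at most `∑ δ`,
because `i ↦ k - (n - i)` and `k ↦ k - (n - i)` are injective where they matter. -/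
theorem sum_sq_convolution_le {I : Finset ℕ} {n : ℕ} (hI : ∀ i ∈ I, i ≤ n) {c δ : ℕ → ℝ}
    (hδ0 : ∀ k, 0 ≤ δ k) (hδ : Summable δ) (N : ℕ) :
    ∑ k ∈ Finset.range N, (∑ i ∈ I, c i * (if n - i ≤ k then δ (k - (n - i)) else 0)) ^ 2 ≤
      (∑' k, δ k) ^ 2 * ∑ i ∈ I, c i ^ 2 := by
  set D : ℕ → ℕ → ℝ := fun i k => if n - i ≤ k then δ (k - (n - i)) else 0 with hD
  have hD0 : ∀ i k, 0 ≤ D i k := fun i k => by simp only [hD]; split_ifs <;> simp [hδ0]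
  have hΔ : 0 ≤ ∑' k, δ k := tsum_nonneg hδ0
  have h1 : ∀ k, ∑ i ∈ I, D i k ≤ ∑' k, δ k := by
    intro k
    simp only [hD]
    rw [← Finset.sum_filter]
    rw [← Finset.sum_image (s := I.filter fun i => n - i ≤ k) (g := fun i => k - (n - i))
      (f := δ)]
    · exact hδ.sum_le_tsum _ fun i _ => hδ0 i
    · intro i hi j hj hij
      simp only [Finset.coe_filter, mem_ofPred_eq] at hi hj
      have := hI i hi.1
      have := hI j hj.1
      simp only at hij
      omega
  have h2 : ∀ i, ∑ k ∈ Finset.range N, D i k ≤ ∑' k, δ k := by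
    intro i
    simp only [hD]
    rw [← Finset.sum_filter]
    rw [← Finset.sum_image (s := (Finset.range N).filter fun k => n - i ≤ k)
      (g := fun k => k - (n - i)) (f := δ)]
    · exact hδ.sum_le_tsum _ fun i _ => hδ0 i
    · intro k hk l hl hkl
      simp only [Finset.coe_filter, mem_ofPred_eq] at hk hl
      simp only at hkl
      omega
  calc ∑ k ∈ Finset.range N, (∑ i ∈ I, c i * D i k) ^ 2
      ≤ ∑ k ∈ Finset.range N, (∑' k, δ k) * ∑ i ∈ I, c i ^ 2 * D i k := by
        refine Finset.sum_le_sum fun k _ => ?_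
        refine (Finset.sum_sq_le_sum_mul_sum_of_sq_le_mul I (f := fun i => D i k)
          (g := fun i => c i ^ 2 * D i k) (fun i _ => hD0 i k)
          (fun i _ => mul_nonneg (sq_nonneg _) (hD0 i k)) fun i _ => by nlinarith).trans ?_
        exact mul_le_mul_of_nonneg_right (h1 k)
          (Finset.sum_nonneg fun i _ => mul_nonneg (sq_nonneg _) (hD0 i k))
    _ = (∑' k, δ k) * ∑ i ∈ I, c i ^ 2 * ∑ k ∈ Finset.range N, D i k := by
        rw [← Finset.mul_sum, Finset.sum_comm]
        simp only [Finset.mul_sum]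
    _ ≤ (∑' k, δ k) * ∑ i ∈ I, c i ^ 2 * ∑' k, δ k := by
        gcongr with i
        exact h2 i
    _ = (∑' k, δ k) ^ 2 * ∑ i ∈ I, c i ^ 2 := by
        rw [← Finset.sum_mul]; ring

/-- Variance bound for sums of a weakly dependent nonstationary sequence. -/
theorem variance_sum_past_le (h : IsIID μ χ) {I : Finset ℕ} {L : ℕ → (ℕ → S) → ℝ}
    (hLm : ∀ i ∈ I, Measurable (L i))
    (hL2 : ∀ i ∈ I, MemLp (fun ω => L i (past χ 0 ω)) 2 μ)
    {c δ : ℕ → ℝ} (hc : ∀ i ∈ I, 0 ≤ c i) (hδ0 : ∀ k, 0 ≤ δ k) (hδ : Summable δ)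
    (hdep : ∀ i ∈ I, ∀ k : ℕ, eLpNorm (fun z : Ω × Ω => L i (past χ k z.1) - L i (coupledPast χ k z))
      2 (μ.prod μ) ≤ ENNReal.ofReal (c i * δ k)) :
    Var[fun ω => ∑ i ∈ I, L i (past χ i ω); μ] ≤ (∑' k, δ k) ^ 2 * ∑ i ∈ I, c i ^ 2 := by
  classical
  -- The whole sum is read as one functional `Φ` of the past of the last time `n`; the term of index
  -- `i` sees that past shifted by `n - i`.
  set n := I.sup id with hn
  have hI : ∀ i ∈ I, i ≤ n := fun i hi => Finset.le_sup (f := id) hi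
  set Φ : (ℕ → S) → ℝ := fun x => ∑ i ∈ I, L i (fun j => x (j + (n - i))) with hΦdef
  have hshift : ∀ i ∈ I, ∀ ω, (fun j => past χ n ω (j + (n - i))) = past χ i ω := by
    intro i hi ω
    have := hI i hi
    ext j
    simp only [past]
    congr 1
    omega
  have hLm' : ∀ i ∈ I, Measurable fun x : ℕ → S => L i (fun j => x (j + (n - i))) := fun i hi =>
    (hLm i hi).comp (measurable_pi_lambda _ fun j => measurable_pi_apply _)
  have hΦ : Measurable Φ := Finset.measurable_sum _ hLm'
  have hΦeq : ∀ ω, Φ (past χ n ω) = ∑ i ∈ I, L i (past χ i ω) := fun ω =>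
    Finset.sum_congr rfl fun i hi => by rw [hshift i hi]
  have hmem : ∀ i ∈ I, MemLp (fun ω => L i (past χ i ω)) 2 μ := fun i hi =>
    ((identDistrib_past h 0 i).comp (hLm i hi)).memLp_iff.1 (hL2 i hi)
  have hL : MemLp (fun ω => Φ (past χ n ω)) 2 μ := by
    simp only [hΦeq]
    exact memLp_finsetSum _ hmem
  have hES := efron_stein h n hΦ hL (B := (∑' k, δ k) ^ 2 * ∑ i ∈ I, c i ^ 2) ?_
  · simpa only [hΦeq] using hES
  intro N
  refine le_trans (Finset.sum_le_sum fun k _ => ?_) (sum_sq_convolution_le hI (c := c) hδ0 hδ N)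
  have hpm : Measurable fun z : Ω × Ω => past χ n z.1 := (measurable_past h n).comp measurable_fst
  have hrm : Measurable (resampledPast χ n k) := measurable_pi_lambda _ fun j => by
    by_cases hj : j = k
    · subst hj
      simpa [resampledPast, Function.comp_def] using (h.1 (n - j)).comp (measurable_snd (α := Ω))
    · simpa [resampledPast, hj, past, Function.comp_def] using
        (h.1 (n - j)).comp (measurable_fst (β := Ω))
  have hterm : ∀ i ∈ I, eLpNorm (fun z : Ω × Ω => L i (fun j => past χ n z.1 (j + (n - i))) -
      L i (fun j => resampledPast χ n k z (j + (n - i)))) 2 (μ.prod μ) ≤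
      ENNReal.ofReal (c i * (if n - i ≤ k then δ (k - (n - i)) else 0)) := by
    intro i hi
    -- The resampled innovation `χ_{n-k}` lies in the past of time `i` only if `n - i ≤ k`; a later
    -- one leaves term `i` unchanged.
    by_cases hk : n - i ≤ k
    · rw [if_pos hk]
      refine le_trans (le_of_eq ?_) (hdep i hi (k - (n - i)))
      have := ((identDistrib_resampled_shift h (hI i hi) hk).comp
        (u := fun p : (ℕ → S) × (ℕ → S) => L i p.1 - L i p.2)
        (((hLm i hi).comp measurable_fst).sub ((hLm i hi).comp measurable_snd))).eLpNorm_eq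
        (p := 2)
      simp only [hshift i hi]
      exact this
    · rw [if_neg hk]
      have : ∀ z : Ω × Ω, (fun j => resampledPast χ n k z (j + (n - i))) =
          fun j => past χ n z.1 (j + (n - i)) := by
        intro z
        ext j
        have : j + (n - i) ≠ k := by omega
        simp [resampledPast, this]
      simp [this]
  have hsum : eLpNorm (fun z : Ω × Ω => Φ (past χ n z.1) - Φ (resampledPast χ n k z)) 2
      (μ.prod μ) ≤ ENNReal.ofReal
        (∑ i ∈ I, c i * (if n - i ≤ k then δ (k - (n - i)) else 0)) := by
    have heq : (fun z : Ω × Ω => Φ (past χ n z.1) - Φ (resampledPast χ n k z)) =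
        ∑ i ∈ I, fun z : Ω × Ω => L i (fun j => past χ n z.1 (j + (n - i))) -
          L i (fun j => resampledPast χ n k z (j + (n - i))) := by
      ext z
      simp [hΦdef]
    rw [heq, ENNReal.ofReal_sum_of_nonneg]
    · refine (eLpNorm_sum_le (fun i hi => ?_) (by norm_num)).trans (Finset.sum_le_sum hterm)
      exact (((hLm' i hi).comp hpm).sub ((hLm' i hi).comp hrm)).aestronglyMeasurable
    · intro i hi
      refine mul_nonneg (hc i hi) ?_
      split_ifs <;> simp [hδ0]
  have hm : Measurable fun z : Ω × Ω => Φ (past χ n z.1) - Φ (resampledPast χ n k z) :=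
    (hΦ.comp hpm).sub (hΦ.comp hrm)
  rw [integral_sq_eq_eLpNorm hm.aestronglyMeasurable]
  have h0 : 0 ≤ ∑ i ∈ I, c i * (if n - i ≤ k then δ (k - (n - i)) else 0) :=
    Finset.sum_nonneg fun i hi => mul_nonneg (hc i hi) (by split_ifs <;> simp [hδ0])
  have := ENNReal.toReal_mono ENNReal.ofReal_ne_top hsum
  rw [ENNReal.toReal_ofReal h0] at this
  gcongr

end VarianceOfSums

/-! ### Moment bounds for locally stationary processes -/

theorem design_mem_Icc {n i : ℕ} (hi : i ∈ Finset.Icc 1 n) : design n i ∈ Icc (0 : ℝ) 1 := by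
  rw [Finset.mem_Icc] at hi
  have hn : (0 : ℝ) < n := by exact_mod_cast (by omega : 0 < n)
  exact ⟨by unfold design; positivity, (div_le_one hn).2 (by exact_mod_cast hi.2)⟩

instance holderTriple_four_four_two : ENNReal.HolderTriple 4 4 2 where
  inv_add_inv_eq_inv := by
    rw [← two_mul, show (4 : ℝ≥0∞) = 2 * 2 by norm_num, ENNReal.mul_inv (by simp) (by simp),
      ← mul_assoc, ENNReal.mul_inv_cancel (by simp) (by simp), one_mul]

section Moments

variable {Ω S B : Type*} [MeasurableSpace Ω] [NormedAddCommGroup B]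
  {μ : Measure Ω} {χ : ℤ → Ω → S}

theorem eLpNorm_le_depMeasure {L : ℝ → (ℕ → S) → B} {r : ℝ≥0∞} {k : ℕ} {t : ℝ}
    (ht : t ∈ Icc (0 : ℝ) 1) :
    eLpNorm (fun z : Ω × Ω => L t (past χ k z.1) - L t (coupledPast χ k z)) r (μ.prod μ) ≤
      depMeasure μ χ L r k :=
  le_iSup₂ (f := fun t (_ : t ∈ Icc (0 : ℝ) 1) => eLpNorm (fun z : Ω × Ω =>
    L t (past χ k z.1) - L t (coupledPast χ k z)) r (μ.prod μ)) t ht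

variable [IsProbabilityMeasure μ]

/-- The moment condition holds at each `t` separately and gives no uniform bound. Uniformity comes
from the value at `t = 0` and Lipschitz continuity on an interval of length one. -/
theorem exists_eLpNorm_two_le {L : ℝ → (ℕ → S) → B} {r : ℝ≥0∞} (hr : 2 ≤ r)
    (hL : FiniteMoment μ χ L r) (hlip : StochLip μ χ L 2) :
    ∃ C : ℝ, 0 ≤ C ∧ ∀ t ∈ Icc (0 : ℝ) 1,
      eLpNorm (fun ω => L t (past χ 0 ω)) 2 μ ≤ ENNReal.ofReal C := by
  obtain ⟨C, hC⟩ := hlip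
  have h0 : (0 : ℝ) ∈ Icc (0 : ℝ) 1 := by simp
  have hm0 := (hL 0 h0).mono_exponent hr
  set A := (eLpNorm (fun ω => L 0 (past χ 0 ω)) 2 μ).toReal with hA
  have hA' : eLpNorm (fun ω => L 0 (past χ 0 ω)) 2 μ = ENNReal.ofReal A :=
    (ENNReal.ofReal_toReal hm0.2.ne).symm
  refine ⟨A + |C|, by positivity, fun t ht => ?_⟩
  rcases ht.1.eq_or_lt with rfl | ht0
  · rw [hA']
    exact ENNReal.ofReal_le_ofReal (by linarith [abs_nonneg C])
  · have h1 := hC 0 t le_rfl ht0 ht.2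
    have h2 : (fun ω => L t (past χ 0 ω)) =
        (fun ω => L t (past χ 0 ω) - L 0 (past χ 0 ω)) + fun ω => L 0 (past χ 0 ω) := by
      ext ω; simp
    rw [h2, add_comm A, ENNReal.ofReal_add (abs_nonneg _) (by positivity), ← hA']
    refine (eLpNorm_add_le ((hL t ht).1.sub hm0.1) hm0.1 (by norm_num)).trans ?_
    gcongr
    refine h1.trans (ENNReal.ofReal_le_ofReal ?_)
    calc C * (t - 0) ≤ |C| * t := by
          rw [sub_zero]; exact mul_le_mul_of_nonneg_right (le_abs_self C) ht.1
      _ ≤ |C| * 1 := by gcongr; exact ht.2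
      _ = |C| := mul_one _

variable [MeasurableSpace S]

theorem identDistrib_coupledPast (h : IsIID μ χ) (k : ℕ) :
    IdentDistrib (past χ 0) (coupledPast χ k) μ (μ.prod μ) := by
  have h1 := (identDistrib_resampled_shift h (le_refl k) (i := k) (k := k) (by simp)).comp
    measurable_snd
  have h2 := (identDistrib_swap h k k).comp (measurable_fst.comp measurable_fst)
  have h3 := ((identDistrib_past h 0 k).trans (identDistrib_fst_past h k)).trans h2
  simp only [Function.comp_def, Nat.sub_self, Nat.add_zero, Nat.sub_zero] at h1 h3
  exact h3.trans h1

/-- Dependence measure of a product. -/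
theorem eLpNorm_mul_sub_coupled_le (h : IsIID μ χ) {f g : (ℕ → S) → ℝ} (hf : Measurable f)
    (hg : Measurable g) {s d : ℝ} (hs : 0 ≤ s) (hd : 0 ≤ d) (k : ℕ)
    (hfs : eLpNorm (fun ω => f (past χ 0 ω)) 4 μ ≤ ENNReal.ofReal s)
    (hgs : eLpNorm (fun ω => g (past χ 0 ω)) 4 μ ≤ ENNReal.ofReal s)
    (hfd : eLpNorm (fun z : Ω × Ω => f (past χ k z.1) - f (coupledPast χ k z)) 4 (μ.prod μ) ≤
      ENNReal.ofReal d)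
    (hgd : eLpNorm (fun z : Ω × Ω => g (past χ k z.1) - g (coupledPast χ k z)) 4 (μ.prod μ) ≤
      ENNReal.ofReal d) :
    eLpNorm (fun z : Ω × Ω => f (past χ k z.1) * g (past χ k z.1) -
      f (coupledPast χ k z) * g (coupledPast χ k z)) 2 (μ.prod μ) ≤
      ENNReal.ofReal (2 * s * d) := by
  have hpm : Measurable fun z : Ω × Ω => past χ k z.1 := (measurable_past h k).comp measurable_fst
  have hcm : AEMeasurable (coupledPast χ k) (μ.prod μ) :=
    (identDistrib_coupledPast h k).aemeasurable_snd
  have e1 := (((identDistrib_past h 0 k).trans (identDistrib_fst_past h k)).comp hf).eLpNorm_eq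
    (p := 4)
  have e2 := ((identDistrib_coupledPast h k).comp hg).eLpNorm_eq (p := 4)
  simp only [Function.comp_def] at e1 e2
  have m1 : AEStronglyMeasurable (fun z : Ω × Ω => f (past χ k z.1)) (μ.prod μ) :=
    (hf.comp hpm).aestronglyMeasurable
  have m2 : AEStronglyMeasurable (fun z : Ω × Ω => g (past χ k z.1)) (μ.prod μ) :=
    (hg.comp hpm).aestronglyMeasurable
  have m3 : AEStronglyMeasurable (fun z : Ω × Ω => f (coupledPast χ k z)) (μ.prod μ) :=
    (hf.comp_aemeasurable hcm).aestronglyMeasurable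
  have m4 : AEStronglyMeasurable (fun z : Ω × Ω => g (coupledPast χ k z)) (μ.prod μ) :=
    (hg.comp_aemeasurable hcm).aestronglyMeasurable
  have heq : (fun z : Ω × Ω => f (past χ k z.1) * g (past χ k z.1) -
      f (coupledPast χ k z) * g (coupledPast χ k z)) =
      ((fun z : Ω × Ω => f (past χ k z.1)) • fun z : Ω × Ω =>
        g (past χ k z.1) - g (coupledPast χ k z)) +
      ((fun z : Ω × Ω => f (past χ k z.1) - f (coupledPast χ k z)) • fun z : Ω × Ω =>
        g (coupledPast χ k z)) := by
    ext z
    simp only [Pi.add_apply, Pi.mul_apply, smul_eq_mul]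
    ring
  rw [heq]
  refine (eLpNorm_add_le (m1.smul (m2.sub m4)) ((m1.sub m3).smul m4) (by norm_num)).trans ?_
  have b1 := eLpNorm_smul_le_mul_eLpNorm (p := 4) (q := 4) (r := 2) (m2.sub m4) m1
  have b2 := eLpNorm_smul_le_mul_eLpNorm (p := 4) (q := 4) (r := 2) m4 (m1.sub m3)
  calc _ ≤ ENNReal.ofReal s * ENNReal.ofReal d + ENNReal.ofReal d * ENNReal.ofReal s := by
        refine add_le_add (b1.trans ?_) (b2.trans ?_)
        · exact mul_le_mul' (e1 ▸ hfs) hgd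
        · exact mul_le_mul' hfd (e2 ▸ hgs)
    _ = ENNReal.ofReal (2 * s * d) := by
        rw [mul_comm (ENNReal.ofReal d), ← ENNReal.ofReal_mul hs,
          ← ENNReal.ofReal_add (by positivity) (by positivity)]
        congr 1; ring

/-- Second moments and dependence measures bound fourth moments. -/
theorem eLpNorm_four_sq_le (h : IsIID μ χ) {f : (ℕ → S) → ℝ} (hf : Measurable f)
    (hf4 : MemLp (fun ω => f (past χ 0 ω)) 4 μ) {A : ℝ} (hA : 0 ≤ A)
    (hf2 : eLpNorm (fun ω => f (past χ 0 ω)) 2 μ ≤ ENNReal.ofReal A)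
    {δ : ℕ → ℝ} (hδ0 : ∀ k, 0 ≤ δ k) (hδ : Summable δ)
    (hdep : ∀ k : ℕ, eLpNorm (fun z : Ω × Ω => f (past χ k z.1) - f (coupledPast χ k z))
      4 (μ.prod μ) ≤ ENNReal.ofReal (δ k)) :
    eLpNorm (fun ω => f (past χ 0 ω)) 4 μ ≤ ENNReal.ofReal (A + 2 * ∑' k, δ k) := by
  set s := (eLpNorm (fun ω => f (past χ 0 ω)) 4 μ).toReal with hs
  have hs0 : 0 ≤ s := ENNReal.toReal_nonneg
  have hs' : eLpNorm (fun ω => f (past χ 0 ω)) 4 μ = ENNReal.ofReal s :=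
    (ENNReal.ofReal_toReal hf4.2.ne).symm
  have hΔ : 0 ≤ ∑' k, δ k := tsum_nonneg hδ0
  have hmeas := (hf.comp (measurable_past h 0)).aestronglyMeasurable (μ := μ)
  have hsq : MemLp (fun ω => f (past χ 0 ω) * f (past χ 0 ω)) 2 μ := hf4.mul hf4
  -- With `s` the fourth-moment norm, the square `f²` has dependence coefficients `2 s δ`. The
  -- variance bound, used for a single summand, gives the self-bounding inequality `s⁴ ≤ A⁴ + 4 (∑
  -- δ)² s²`, which forces `s ≤ A + 2 ∑ δ`.
  have hvar := variance_sum_past_le h (I := {0}) (L := fun _ x => f x * f x)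
    (fun _ _ => hf.mul hf) (fun _ _ => hsq) (c := fun _ => 2 * s) (δ := δ)
    (fun _ _ => by positivity) hδ0 hδ (fun _ _ k =>
      eLpNorm_mul_sub_coupled_le h hf hf hs0 (hδ0 k) k hs'.le hs'.le (hdep k) (hdep k))
  simp only [Finset.sum_singleton, Nat.cast_zero] at hvar
  rw [variance_eq_sub hsq] at hvar
  have e4 : ∫ ω, (f (past χ 0 ω) * f (past χ 0 ω)) ^ 2 ∂μ = s ^ 4 := by
    rw [integral_sq_eq_eLpNorm hsq.1]
    have : eLpNorm (fun ω => f (past χ 0 ω) * f (past χ 0 ω)) 2 μ =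
        eLpNorm (fun ω => f (past χ 0 ω)) 4 μ ^ (2 : ℝ) := by
      have h1 := eLpNorm_norm_rpow (μ := μ) (p := 2) (fun ω => f (past χ 0 ω))
        (q := 2) (by norm_num)
      rw [show (2 : ℝ≥0∞) * ENNReal.ofReal 2 = 4 by norm_num] at h1
      rw [← h1]
      congr 1
      ext ω
      simp [sq]
    rw [this, ← ENNReal.toReal_rpow, ← hs]
    norm_num
    ring
  have e2 : ∫ ω, f (past χ 0 ω) * f (past χ 0 ω) ∂μ ≤ A ^ 2 := by
    have h1 := integral_sq_eq_eLpNorm hmeas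
    simp only [Function.comp_def, sq (f _)] at h1
    rw [h1]
    have := ENNReal.toReal_mono ENNReal.ofReal_ne_top hf2
    rw [ENNReal.toReal_ofReal hA] at this
    gcongr
  have e2' : 0 ≤ ∫ ω, f (past χ 0 ω) * f (past χ 0 ω) ∂μ :=
    integral_nonneg fun _ => mul_self_nonneg _
  have e2'' : (∫ ω, f (past χ 0 ω) * f (past χ 0 ω) ∂μ) ^ 2 ≤ (A ^ 2) ^ 2 := by gcongr
  simp only [Pi.pow_apply] at hvar
  rw [e4] at hvar
  rw [hs']
  refine ENNReal.ofReal_le_ofReal ?_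
  have hfin : s ^ 4 ≤ A ^ 4 + 4 * (∑' k, δ k) ^ 2 * s ^ 2 := by nlinarith
  by_contra! hcon
  have h1 : (A + 2 * ∑' k, δ k) ^ 2 < s ^ 2 := by gcongr
  have h2 : A ^ 2 + 4 * (∑' k, δ k) ^ 2 < s ^ 2 := by nlinarith [mul_nonneg hA hΔ]
  have h3 : A ^ 2 ≤ s ^ 2 := by nlinarith [sq_nonneg (∑' k, δ k)]
  have h4 : 0 < s ^ 2 := lt_of_le_of_lt (by positivity) h2
  nlinarith [mul_pos h4 (sub_pos.2 h2), mul_nonneg (sub_nonneg.2 h3) (sq_nonneg A)]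

end Moments

/-! ### The joint innovations -/

/-- Independence need only be checked on measurable rectangles. There an event for the pairs is the
intersection of an event for `eps` with one for `xi`, and the products regroup. -/
theorem isIID_jointInnov {Ω E F : Type*} [MeasurableSpace Ω] [MeasurableSpace E]
    [MeasurableSpace F] {μ : Measure Ω} [IsProbabilityMeasure μ] {eps : ℤ → Ω → E}
    {xi : ℤ → Ω → F} (he : IsIID μ eps) (hx : IsIID μ xi)
    (hind : IndepFun (fun ω i => eps i ω) (fun ω i => xi i ω) μ) :
    IsIID μ (jointInnov eps xi) := by
  have hm : ∀ i, Measurable (jointInnov eps xi i) := fun i => (he.1 i).prodMk (hx.1 i)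
  refine ⟨hm, ?_, fun i => ⟨(hm i).aemeasurable, (hm 0).aemeasurable, ?_⟩⟩
  · set R : Set (Set (E × F)) := image2 (· ×ˢ ·) {s | MeasurableSet s} {t | MeasurableSet t}
      with hR
    rw [iIndepFun_iff_iIndep]
    refine iIndepSets.iIndep (π := fun i => {s | ∃ t ∈ R, jointInnov eps xi i ⁻¹' t = s})
      (fun i => (hm i).comap_le) (fun i => isPiSystem_prod.comap _) (fun i => ?_) ?_
    · rw [← generateFrom_prod, MeasurableSpace.comap_generateFrom]
      rfl
    · rw [iIndepSets_iff]
      intro s f hf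
      have hf' : ∀ i, ∃ A : Set E, ∃ B : Set F, MeasurableSet A ∧ MeasurableSet B ∧
          (i ∈ s → f i = eps i ⁻¹' A ∩ xi i ⁻¹' B) := by
        intro i
        by_cases hi : i ∈ s
        · obtain ⟨t, ⟨A, hA, B, hB, rfl⟩, ht⟩ := hf i hi
          exact ⟨A, B, hA, hB, fun _ => ht.symm⟩
        · exact ⟨∅, ∅, .empty, .empty, fun h => absurd h hi⟩
      choose A B hA hB hAB using hf'
      have e1 : (⋂ i ∈ s, f i) = (fun ω i => eps i ω) ⁻¹' (⋂ i ∈ s, {e | e i ∈ A i}) ∩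
          (fun ω i => xi i ω) ⁻¹' (⋂ i ∈ s, {e | e i ∈ B i}) := by
        ext ω
        simp only [mem_iInter, mem_inter_iff, mem_preimage, mem_ofPred_eq]
        constructor
        · intro h
          exact ⟨fun i hi => ((hAB i hi) ▸ h i hi).1, fun i hi => ((hAB i hi) ▸ h i hi).2⟩
        · rintro ⟨h1, h2⟩ i hi
          rw [hAB i hi]
          exact ⟨h1 i hi, h2 i hi⟩
      have hAm : MeasurableSet (⋂ i ∈ s, {e : ℤ → E | e i ∈ A i}) :=
        s.measurableSet_biInter fun i _ => measurable_pi_apply i (hA i)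
      have hBm : MeasurableSet (⋂ i ∈ s, {e : ℤ → F | e i ∈ B i}) :=
        s.measurableSet_biInter fun i _ => measurable_pi_apply i (hB i)
      have p1 := (iIndepFun_iff_measure_inter_preimage_eq_mul.1 he.2.1) s (sets := A)
        fun i _ => hA i
      have p2 := (iIndepFun_iff_measure_inter_preimage_eq_mul.1 hx.2.1) s (sets := B)
        fun i _ => hB i
      rw [e1, hind.measure_inter_preimage_eq_mul _ _ hAm hBm]
      have q1 : (fun ω i => eps i ω) ⁻¹' (⋂ i ∈ s, {e : ℤ → E | e i ∈ A i}) =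
          ⋂ i ∈ s, eps i ⁻¹' A i := by ext; simp
      have q2 : (fun ω i => xi i ω) ⁻¹' (⋂ i ∈ s, {e : ℤ → F | e i ∈ B i}) =
          ⋂ i ∈ s, xi i ⁻¹' B i := by ext; simp
      rw [q1, q2, p1, p2, ← Finset.prod_mul_distrib]
      refine Finset.prod_congr rfl fun i hi => ?_
      have hi2 : IndepFun (eps i) (xi i) μ := hind.comp (measurable_pi_apply i)
        (measurable_pi_apply i)
      rw [hAB i hi, hi2.measure_inter_preimage_eq_mul _ _ (hA i) (hB i)]
  · have hi2 : ∀ i, IndepFun (eps i) (xi i) μ := fun i =>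
      hind.comp (measurable_pi_apply i) (measurable_pi_apply i)
    have h1 := (indepFun_iff_map_prod_eq_prod_map_map (he.1 i).aemeasurable
      (hx.1 i).aemeasurable).1 (hi2 i)
    have h2 := (indepFun_iff_map_prod_eq_prod_map_map (he.1 0).aemeasurable
      (hx.1 0).aemeasurable).1 (hi2 0)
    rw [(he.2.2 i).map_eq, (hx.2.2 i).map_eq] at h1
    exact h1.trans h2.symm

/-! ### Consequences of the assumptions on the model -/

section Model

variable {Ω E F ι : Type*} [Fintype ι] [MeasurableSpace Ω] [MeasurableSpace E] [MeasurableSpace F]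
  {μ : Measure Ω} [IsProbabilityMeasure μ] {eps : ℤ → Ω → E} {xi : ℤ → Ω → F}
  {G : ℝ → (ℕ → E) → EuclideanSpace ℝ ι} {V : ℝ → (ℕ → E) → ℝ} {H : ℝ → (ℕ → F) → ℝ}
  {β : ℝ → ι → ℝ}

/-- The constant must be uniform in the block and in `n`. Lipschitz continuity in `L²` only gives
uniform second moments; `eLpNorm_four_sq_le` lifts them to fourth moments, after which products of
coordinates have summable dependence coefficients in `L²`. -/
theorem exists_variance_sum_regressor_le (hS : StandingAssumptions μ eps xi G V H)
    (hA : ConditionA μ eps xi G V H β) :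
    ∃ C : ℝ, 0 < C ∧ ∀ (a b : ι) (n : ℕ) (I : Finset ℕ), I ⊆ Finset.Icc 1 n →
      (∀ i ∈ I, MemLp (fun ω => regressor eps G n ω i a * regressor eps G n ω i b) 2 μ) ∧
      Var[fun ω => ∑ i ∈ I, regressor eps G n ω i a * regressor eps G n ω i b; μ] ≤
        C * I.card := by
  obtain ⟨A, hA0, hA2⟩ := exists_eLpNorm_two_le (by norm_num) hA.A2_moment hA.A2_lip
  set δ : ℕ → ℝ := fun k => (depMeasure μ eps G 32 k).toReal with hδ
  have hδ0 : ∀ k, 0 ≤ δ k := fun k => ENNReal.toReal_nonneg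
  have hδs : Summable δ := ENNReal.summable_toReal hA.A4.ne
  have hcoord : ∀ (v : EuclideanSpace ℝ ι) a, ‖v a‖ ≤ ‖v‖ := fun v a => PiLp.norm_apply_le v a
  have hGm : ∀ t ∈ Icc (0 : ℝ) 1, ∀ a, Measurable fun x => G t x a := fun t ht a =>
    (EuclideanSpace.proj a : EuclideanSpace ℝ ι →L[ℝ] ℝ).continuous.measurable.comp (hS.meas_G t ht)
  have hdep : ∀ t ∈ Icc (0 : ℝ) 1, ∀ a, ∀ k : ℕ, eLpNorm (fun z : Ω × Ω =>
      G t (past eps k z.1) a - G t (coupledPast eps k z) a) 4 (μ.prod μ) ≤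
      ENNReal.ofReal (δ k) := by
    intro t ht a k
    have m1 : AEMeasurable (fun z : Ω × Ω => past eps k z.1) (μ.prod μ) :=
      ((measurable_past hS.eps_iid k).comp measurable_fst).aemeasurable
    have m2 := (identDistrib_coupledPast hS.eps_iid k).aemeasurable_snd
    calc _ ≤ eLpNorm (fun z : Ω × Ω => G t (past eps k z.1) a - G t (coupledPast eps k z) a) 32
          (μ.prod μ) := eLpNorm_le_eLpNorm_of_exponent_le (by norm_num)
            (((hGm t ht a).comp_aemeasurable m1).sub
              ((hGm t ht a).comp_aemeasurable m2)).aestronglyMeasurable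
      _ ≤ eLpNorm (fun z : Ω × Ω => G t (past eps k z.1) - G t (coupledPast eps k z)) 32
          (μ.prod μ) := eLpNorm_mono fun z =>
            hcoord (G t (past eps k z.1) - G t (coupledPast eps k z)) a
      _ ≤ depMeasure μ eps G 32 k := eLpNorm_le_depMeasure ht
      _ = ENNReal.ofReal (δ k) := (ENNReal.ofReal_toReal
          (ENNReal.ne_top_of_tsum_ne_top hA.A4.ne k)).symm
  have hmem : ∀ t ∈ Icc (0 : ℝ) 1, ∀ a, MemLp (fun ω => G t (past eps 0 ω) a) 4 μ := by
    intro t ht a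
    exact (MemLp.of_le (hA.A2_moment t ht) ((hGm t ht a).comp
      (measurable_past hS.eps_iid 0)).aestronglyMeasurable
      (ae_of_all _ fun ω => hcoord _ a)).mono_exponent (by norm_num)
  set s := A + 2 * ∑' k, δ k with hs
  have hs0 : 0 ≤ s := by
    have := tsum_nonneg hδ0 (L := .unconditional ℕ)
    positivity
  have h4 : ∀ t ∈ Icc (0 : ℝ) 1, ∀ a,
      eLpNorm (fun ω => G t (past eps 0 ω) a) 4 μ ≤ ENNReal.ofReal s := by
    intro t ht a
    exact eLpNorm_four_sq_le hS.eps_iid (hGm t ht a) (hmem t ht a) hA0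
      ((eLpNorm_mono fun ω => hcoord _ a).trans (hA2 t ht)) hδ0 hδs (hdep t ht a)
  refine ⟨(∑' k, δ k) ^ 2 * (2 * s) ^ 2 + 1, by positivity, fun a b n I hI => ?_⟩
  have hL2 : ∀ i ∈ I, MemLp (fun ω => G (design n i) (past eps 0 ω) a *
      G (design n i) (past eps 0 ω) b) 2 μ := fun i hi =>
    (hmem _ (design_mem_Icc (hI hi)) b).mul (hmem _ (design_mem_Icc (hI hi)) a)
  constructor
  · intro i hi
    exact ((identDistrib_past hS.eps_iid 0 i).comp ((hGm _ (design_mem_Icc (hI hi)) a).mul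
      (hGm _ (design_mem_Icc (hI hi)) b))).memLp_iff.1 (hL2 i hi)
  have := variance_sum_past_le hS.eps_iid (I := I)
    (L := fun i x => G (design n i) x a * G (design n i) x b)
    (fun i hi => (hGm _ (design_mem_Icc (hI hi)) a).mul (hGm _ (design_mem_Icc (hI hi)) b))
    hL2 (c := fun _ => 2 * s) (δ := δ) (fun _ _ => by positivity) hδ0 hδs
    (fun i hi k => eLpNorm_mul_sub_coupled_le hS.eps_iid (hGm _ (design_mem_Icc (hI hi)) a)
      (hGm _ (design_mem_Icc (hI hi)) b) hs0 (hδ0 k) k (h4 _ (design_mem_Icc (hI hi)) a)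
      (h4 _ (design_mem_Icc (hI hi)) b) (hdep _ (design_mem_Icc (hI hi)) a k)
      (hdep _ (design_mem_Icc (hI hi)) b k))
  refine this.trans ?_
  rw [Finset.sum_const, nsmul_eq_mul]
  nlinarith [(Nat.cast_nonneg I.card : (0 : ℝ) ≤ I.card)]

/-- The sum is centred, so its second moment is its variance. Arbitrary deterministic weights are
allowed, so that weights depending on the regressors can be frozen later. -/
theorem exists_lintegral_sq_sum_H_le (hS : StandingAssumptions μ eps xi G V H)
    (hA : ConditionA μ eps xi G V H β) :
    ∃ C : ℝ, 0 < C ∧ ∀ (n : ℕ) (c : ℕ → ℝ),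
      ∫⁻ ω, ENNReal.ofReal ((∑ i ∈ Finset.Icc 1 n, c i * H (design n i) (past xi i ω)) ^ 2) ∂μ ≤
        ENNReal.ofReal (C * ∑ i ∈ Finset.Icc 1 n, c i ^ 2) := by
  obtain ⟨C, hC⟩ := hA.A5
  set δ : ℕ → ℝ := fun k => |C| * (((k : ℝ) + 1) ^ 2)⁻¹ with hδ
  have hδ0 : ∀ k, 0 ≤ δ k := fun k => by positivity
  have hδs : Summable δ := by
    have := (summable_nat_add_iff 1).2 (Real.summable_nat_pow_inv.2 (one_lt_two))
    refine Summable.mul_left _ ?_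
    simpa using this
  have hHm : ∀ i, Measurable (past xi i) := measurable_past hS.xi_iid
  have hdep : ∀ t ∈ Icc (0 : ℝ) 1, ∀ k : ℕ, eLpNorm (fun z : Ω × Ω =>
      H t (past xi k z.1) - H t (coupledPast xi k z)) 2 (μ.prod μ) ≤ ENNReal.ofReal (δ k) := by
    intro t ht k
    have m1 : AEMeasurable (fun z : Ω × Ω => past xi k z.1) (μ.prod μ) :=
      ((hHm k).comp measurable_fst).aemeasurable
    have m2 := (identDistrib_coupledPast hS.xi_iid k).aemeasurable_snd
    calc _ ≤ eLpNorm (fun z : Ω × Ω => H t (past xi k z.1) - H t (coupledPast xi k z)) 4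
          (μ.prod μ) := eLpNorm_le_eLpNorm_of_exponent_le (by norm_num)
            (((hS.meas_H t ht).comp_aemeasurable m1).sub
              ((hS.meas_H t ht).comp_aemeasurable m2)).aestronglyMeasurable
      _ ≤ depMeasure μ xi H 4 k := eLpNorm_le_depMeasure ht
      _ ≤ _ := le_add_self
      _ ≤ _ := hC k
      _ ≤ ENNReal.ofReal (δ k) := ENNReal.ofReal_le_ofReal (by
          simp only [hδ]; gcongr; exact le_abs_self C)
  refine ⟨(∑' k, δ k) ^ 2 + 1, by positivity, fun n c => ?_⟩
  have hL2 : ∀ i ∈ Finset.Icc 1 n, MemLp (fun ω => c i * H (design n i) (past xi 0 ω)) 2 μ :=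
    fun i hi => (hS.H_sq _ (design_mem_Icc hi)).const_mul _
  have hL2' : ∀ i ∈ Finset.Icc 1 n, MemLp (fun ω => c i * H (design n i) (past xi i ω)) 2 μ :=
    fun i hi => ((identDistrib_past hS.xi_iid 0 i).comp
      ((hS.meas_H _ (design_mem_Icc hi)).const_mul (c i))).memLp_iff.1 (hL2 i hi)
  have hvar := variance_sum_past_le hS.xi_iid (I := Finset.Icc 1 n)
    (L := fun i x => c i * H (design n i) x)
    (fun i hi => (hS.meas_H _ (design_mem_Icc hi)).const_mul _) hL2 (c := fun i => |c i|) (δ := δ)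
    (fun _ _ => abs_nonneg _) hδ0 hδs (fun i hi k => by
      have : (fun z : Ω × Ω => c i * H (design n i) (past xi k z.1) -
          c i * H (design n i) (coupledPast xi k z)) = c i • fun z : Ω × Ω =>
          H (design n i) (past xi k z.1) - H (design n i) (coupledPast xi k z) := by
        ext z; simp [mul_sub]
      rw [this, eLpNorm_const_smul, ENNReal.ofReal_mul (abs_nonneg _), Real.enorm_eq_ofReal_abs]
      gcongr
      exact hdep _ (design_mem_Icc hi) k)
  have hsum : MemLp (fun ω => ∑ i ∈ Finset.Icc 1 n, c i * H (design n i) (past xi i ω)) 2 μ :=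
    memLp_finsetSum _ hL2'
  have hmean : ∫ ω, ∑ i ∈ Finset.Icc 1 n, c i * H (design n i) (past xi i ω) ∂μ = 0 := by
    rw [integral_finsetSum _ fun i hi => (hL2' i hi).integrable (by norm_num)]
    refine Finset.sum_eq_zero fun i hi => ?_
    have := ((identDistrib_past hS.xi_iid 0 i).comp (hS.meas_H _ (design_mem_Icc hi))).integral_eq
    simp only [Function.comp_apply] at this
    rw [integral_const_mul, ← this, hS.H_mean _ (design_mem_Icc hi), mul_zero]
  rw [variance_of_integral_eq_zero hsum.aemeasurable hmean] at hvar
  rw [← ofReal_integral_eq_lintegral_ofReal hsum.integrable_sq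
    (ae_of_all _ fun _ => sq_nonneg _)]
  refine ENNReal.ofReal_le_ofReal (hvar.trans ?_)
  simp only [sq_abs]
  have : 0 ≤ ∑ i ∈ Finset.Icc 1 n, c i ^ 2 := Finset.sum_nonneg fun _ _ => sq_nonneg _
  nlinarith

end Model

/-! ### Variance and mean of the norms of the scores -/

section Score

variable {Ω E F ι : Type*} [Fintype ι] [MeasurableSpace Ω] [MeasurableSpace E] [MeasurableSpace F]
  {μ : Measure Ω} [IsProbabilityMeasure μ] {eps : ℤ → Ω → E} {xi : ℤ → Ω → F}
  {G : ℝ → (ℕ → E) → EuclideanSpace ℝ ι} {V : ℝ → (ℕ → E) → ℝ} {H : ℝ → (ℕ → F) → ℝ}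
  {β : ℝ → ι → ℝ}

theorem measurable_Uproc (hS : StandingAssumptions μ eps xi G V H) {t : ℝ}
    (ht : t ∈ Icc (0 : ℝ) 1) : Measurable (Uproc G V H t) := by
  have h1 : Measurable fun r : ℕ → E × F => fun j => (r j).1 :=
    measurable_pi_lambda _ fun j => measurable_fst.comp (measurable_pi_apply j)
  have h2 : Measurable fun r : ℕ → E × F => fun j => (r j).2 :=
    measurable_pi_lambda _ fun j => measurable_snd.comp (measurable_pi_apply j)
  exact (((hS.meas_V t ht).comp h1).mul ((hS.meas_H t ht).comp h2)).smul ((hS.meas_G t ht).comp h1)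

/-- The norm of the score `U(t_i, R_i) = x_i ε_i`. -/
theorem norm_Uproc_eq (n : ℕ) (ω : Ω) (i : ℕ) :
    ‖Uproc G V H (design n i) (past (jointInnov eps xi) i ω)‖ =
      √(regressor eps G n ω i ⬝ᵥ regressor eps G n ω i) * |modelError eps xi V H n ω i| := by
  have h1 : ‖G (design n i) (past eps i ω)‖ =
      √(regressor eps G n ω i ⬝ᵥ regressor eps G n ω i) := by
    rw [EuclideanSpace.norm_eq]
    simp [dotProduct, regressor, sq]
  have h2 : Uproc G V H (design n i) (past (jointInnov eps xi) i ω) =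
      modelError eps xi V H n ω i • G (design n i) (past eps i ω) := by
    unfold modelError
    rw [mul_comm]
    rfl
  rw [h2, norm_smul, h1, Real.norm_eq_abs, mul_comm]

theorem identDistrib_Uproc (hS : StandingAssumptions μ eps xi G V H) {t : ℝ}
    (ht : t ∈ Icc (0 : ℝ) 1) (i : ℤ) :
    IdentDistrib (fun ω => ‖Uproc G V H t (past (jointInnov eps xi) 0 ω)‖)
      (fun ω => ‖Uproc G V H t (past (jointInnov eps xi) i ω)‖) μ μ :=
  (identDistrib_past (isIID_jointInnov hS.eps_iid hS.xi_iid hS.indep) 0 i).comp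
    (measurable_Uproc hS ht).norm

theorem exists_eLpNorm_Uproc_le (hA : ConditionA μ eps xi G V H β) :
    ∃ C : ℝ, 0 ≤ C ∧ ∀ t ∈ Icc (0 : ℝ) 1,
      eLpNorm (fun ω => Uproc G V H t (past (jointInnov eps xi) 0 ω)) 2 μ ≤ ENNReal.ofReal C :=
  exists_eLpNorm_two_le (by norm_num) hA.A3_moment hA.A3_lip

/-- The norm is 1-Lipschitz, so it inherits the dependence coefficients of the score. -/
theorem exists_variance_sum_score_le (hS : StandingAssumptions μ eps xi G V H)
    (hA : ConditionA μ eps xi G V H β) :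
    ∃ C : ℝ, 0 < C ∧ ∀ n : ℕ, Var[fun ω => ∑ i ∈ Finset.Icc 1 n,
      ‖Uproc G V H (design n i) (past (jointInnov eps xi) i ω)‖; μ] ≤ C * n := by
  obtain ⟨ρ, hρ, C, hC⟩ := hA.A6
  have hiid := isIID_jointInnov hS.eps_iid hS.xi_iid hS.indep
  set χ := jointInnov eps xi with hχ
  set δ : ℕ → ℝ := fun k => |C| * ρ ^ k with hδ
  have hδ0 : ∀ k, 0 ≤ δ k := fun k => mul_nonneg (abs_nonneg _) (pow_nonneg hρ.1.le _)
  have hδs : Summable δ := (summable_geometric_of_lt_one hρ.1.le hρ.2).mul_left _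
  have hdep : ∀ t ∈ Icc (0 : ℝ) 1, ∀ k : ℕ, eLpNorm (fun z : Ω × Ω =>
      ‖Uproc G V H t (past χ k z.1)‖ - ‖Uproc G V H t (coupledPast χ k z)‖) 2 (μ.prod μ) ≤
        ENNReal.ofReal (1 * δ k) := by
    intro t ht k
    have m1 : AEMeasurable (fun z : Ω × Ω => past χ k z.1) (μ.prod μ) :=
      ((measurable_past hiid k).comp measurable_fst).aemeasurable
    have m2 := (identDistrib_coupledPast hiid k).aemeasurable_snd
    have hU := measurable_Uproc hS ht
    calc _ ≤ eLpNorm (fun z : Ω × Ω => Uproc G V H t (past χ k z.1) -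
          Uproc G V H t (coupledPast χ k z)) 2 (μ.prod μ) := eLpNorm_mono fun z => by
            rw [Real.norm_eq_abs]; exact abs_norm_sub_norm_le _ _
      _ ≤ eLpNorm (fun z : Ω × Ω => Uproc G V H t (past χ k z.1) -
          Uproc G V H t (coupledPast χ k z)) 4 (μ.prod μ) :=
          eLpNorm_le_eLpNorm_of_exponent_le (by norm_num)
            ((hU.comp_aemeasurable m1).sub (hU.comp_aemeasurable m2)).aestronglyMeasurable
      _ ≤ depMeasure μ χ (Uproc G V H) 4 k := eLpNorm_le_depMeasure ht
      _ ≤ _ := hC k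
      _ ≤ _ := ENNReal.ofReal_le_ofReal (by
          rw [one_mul]
          exact mul_le_mul_of_nonneg_right (le_abs_self C) (pow_nonneg hρ.1.le _))
  refine ⟨(∑' k, δ k) ^ 2 + 1, by positivity, fun n => ?_⟩
  have := variance_sum_past_le hiid (I := Finset.Icc 1 n)
    (L := fun i x => ‖Uproc G V H (design n i) x‖)
    (fun i hi => (measurable_Uproc hS (design_mem_Icc hi)).norm)
    (fun i hi => ((hA.A3_moment _ (design_mem_Icc hi)).mono_exponent (by norm_num)).norm)
    (c := fun _ => 1) (δ := δ) (fun _ _ => zero_le_one) hδ0 hδs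
    (fun i hi k => hdep _ (design_mem_Icc hi) k)
  refine this.trans ?_
  simp only [one_pow, Finset.sum_const, Nat.card_Icc, Nat.add_sub_cancel, nsmul_eq_mul, mul_one]
  have : (0 : ℝ) ≤ n := Nat.cast_nonneg n
  nlinarith

/-- If the score vanished almost surely at `t = 0`, all its autocovariances there would vanish and
the long-run covariance `Λ(0)` would be zero, against the eigenvalue bound. -/
theorem integral_norm_Uproc_zero_pos [Nonempty ι]
    (hA : ConditionA μ eps xi G V H β) :
    0 < ∫ ω, ‖Uproc G V H 0 (past (jointInnov eps xi) 0 ω)‖ ∂μ := by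
  have h0 : (0 : ℝ) ∈ Icc (0 : ℝ) 1 := by simp
  have hint : Integrable (fun ω => ‖Uproc G V H 0 (past (jointInnov eps xi) 0 ω)‖) μ :=
    ((hA.A3_moment 0 h0).integrable (by norm_num)).norm
  refine lt_of_le_of_ne (integral_nonneg fun _ => norm_nonneg _) fun hz => ?_
  have hae := (integral_eq_zero_iff_of_nonneg (fun _ => norm_nonneg _) hint).1 hz.symm
  obtain ⟨c, hc, hΛ⟩ := hA.A7
  have hL : Lmat μ (jointInnov eps xi) (Uproc G V H) 0 = 0 := by
    ext j k
    simp only [Lmat, Matrix.zero_apply]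
    have : ∀ i : ℤ, cov[fun ω => Uproc G V H 0 (past (jointInnov eps xi) 0 ω) j,
        fun ω => Uproc G V H 0 (past (jointInnov eps xi) i ω) k; μ] = 0 := by
      intro i
      have hj : (fun ω => Uproc G V H 0 (past (jointInnov eps xi) 0 ω) j) =ᵐ[μ] fun _ => 0 := by
        filter_upwards [hae] with ω hω
        have : Uproc G V H 0 (past (jointInnov eps xi) 0 ω) = 0 := by simpa using hω
        rw [this]; rfl
      unfold covariance
      refine integral_eq_zero_of_ae ?_
      have hm : ∫ ω, Uproc G V H 0 (past (jointInnov eps xi) 0 ω) j ∂μ = 0 :=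
        integral_eq_zero_of_ae hj
      filter_upwards [hj] with ω hω
      simp [hm, hω]
    simp [this]
  have := hΛ 0 h0 (fun _ => 1)
  rw [hL] at this
  have hcard : (0 : ℝ) < Fintype.card ι := by exact_mod_cast Fintype.card_pos
  simp at this
  nlinarith

/-- Lipschitz continuity propagates positivity from `t = 0` to a neighbourhood. This already covers
a positive fraction of the design points, which is enough for linear growth of the sums. -/
theorem exists_integral_norm_Uproc_ge [Nonempty ι]
    (hA : ConditionA μ eps xi G V H β) :
    ∃ c τ : ℝ, 0 < c ∧ 0 < τ ∧ ∀ t ∈ Icc (0 : ℝ) 1, t ≤ τ →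
      c ≤ ∫ ω, ‖Uproc G V H t (past (jointInnov eps xi) 0 ω)‖ ∂μ := by
  have hpos := integral_norm_Uproc_zero_pos hA
  set m := ∫ ω, ‖Uproc G V H 0 (past (jointInnov eps xi) 0 ω)‖ ∂μ with hm
  obtain ⟨C, hC⟩ := hA.A3_lip
  have h0 : (0 : ℝ) ∈ Icc (0 : ℝ) 1 := by simp
  have hint : ∀ t ∈ Icc (0 : ℝ) 1,
      Integrable (fun ω => Uproc G V H t (past (jointInnov eps xi) 0 ω)) μ :=
    fun t ht => (hA.A3_moment t ht).integrable (by norm_num)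
  have hsub : ∀ t ∈ Icc (0 : ℝ) 1, Integrable (fun ω =>
      Uproc G V H t (past (jointInnov eps xi) 0 ω) -
        Uproc G V H 0 (past (jointInnov eps xi) 0 ω)) μ := fun t ht => (hint t ht).sub (hint 0 h0)
  refine ⟨m / 2, m / (2 * (|C| + 1)), by positivity, by positivity, fun t ht hτ => ?_⟩
  rcases ht.1.eq_or_lt with rfl | ht0
  · linarith
  have hd : ∫ ω, ‖Uproc G V H t (past (jointInnov eps xi) 0 ω) -
      Uproc G V H 0 (past (jointInnov eps xi) 0 ω)‖ ∂μ ≤ |C| * t := by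
    rw [integral_norm_eq_lintegral_enorm (hsub t ht).1,
      ← eLpNorm_one_eq_lintegral_enorm]
    refine ENNReal.toReal_le_of_le_ofReal (by positivity) ?_
    refine (eLpNorm_le_eLpNorm_of_exponent_le (q := 2) (by norm_num)
      (hsub t ht).1).trans ((hC 0 t le_rfl ht0 ht.2).trans ?_)
    refine ENNReal.ofReal_le_ofReal ?_
    rw [sub_zero]
    exact mul_le_mul_of_nonneg_right (le_abs_self C) ht0.le
  have hle : m ≤ ∫ ω, (‖Uproc G V H t (past (jointInnov eps xi) 0 ω)‖ +
      ‖Uproc G V H t (past (jointInnov eps xi) 0 ω) -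
      Uproc G V H 0 (past (jointInnov eps xi) 0 ω)‖) ∂μ := by
    refine integral_mono (hint 0 h0).norm
      ((hint t ht).norm.add (hsub t ht).norm) fun ω => ?_
    exact norm_le_norm_add_norm_sub _ _
  rw [integral_add (hint t ht).norm (hsub t ht).norm] at hle
  have h1 : |C| * t ≤ m / 2 := by
    rw [le_div_iff₀ (by positivity)] at hτ
    nlinarith [abs_nonneg C]
  linarith

end Score

/-! ### Stochastic orders -/

section StochasticOrder

variable {Ω : Type*} [MeasurableSpace Ω] {μ : Measure Ω}

/-- Markov's inequality. -/
theorem isBigOP_of_lintegral_le {X : ℕ → Ω → ℝ} {a : ℕ → ℝ} {C : ℝ} (hC : 0 ≤ C)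
    (hX : ∀ n, AEMeasurable (X n) μ) (ha : ∀ᶠ n in atTop, 0 < a n)
    (h : ∀ᶠ n in atTop, ∫⁻ ω, ENNReal.ofReal |X n ω| ∂μ ≤ ENNReal.ofReal (C * a n)) :
    IsBigOP μ X a := by
  intro η hη
  refine ⟨(C + 1) / η, by positivity, ?_⟩
  filter_upwards [ha, h] with n hn hle
  have hpos : 0 < (C + 1) / η * a n := by positivity
  have hm : AEMeasurable (fun ω => ENNReal.ofReal |X n ω|) μ :=
    ENNReal.measurable_ofReal.comp_aemeasurable (hX n).abs
  have hM := mul_meas_ge_le_lintegral₀ hm (ENNReal.ofReal ((C + 1) / η * a n))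
  have h2 : μ {ω | (C + 1) / η * a n < |X n ω|} ≤
      μ {ω | ENNReal.ofReal ((C + 1) / η * a n) ≤ ENNReal.ofReal |X n ω|} :=
    measure_mono fun ω (hω : _ < _) => ENNReal.ofReal_le_ofReal hω.le
  refine h2.trans ?_
  have h3 := hM.trans hle
  rw [mul_comm] at h3
  have h4 := (ENNReal.le_div_iff_mul_le (Or.inl (by simpa using hpos))
    (Or.inl ENNReal.ofReal_ne_top)).2 h3
  refine h4.trans ?_
  rw [← ENNReal.ofReal_div_of_pos hpos]
  refine ENNReal.ofReal_le_ofReal ?_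
  rw [div_le_iff₀ hpos]
  have : η * ((C + 1) / η * a n) = (C + 1) * a n := by field_simp
  rw [this]
  nlinarith

theorem IsBigOP.of_sq {X : ℕ → Ω → ℝ} {a : ℕ → ℝ} (ha : ∀ᶠ n in atTop, 0 ≤ a n)
    (h : IsBigOP μ (fun n ω => X n ω ^ 2) (fun n => a n ^ 2)) : IsBigOP μ X a := by
  intro η hη
  obtain ⟨C, hC, hle⟩ := h η hη
  refine ⟨√C, by positivity, ?_⟩
  filter_upwards [hle, ha] with n hn han
  refine (measure_mono fun ω (hω : √C * a n < |X n ω|) => ?_).trans hn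
  have h1 : (√C * a n) ^ 2 < |X n ω| ^ 2 := by gcongr
  rw [mul_pow, Real.sq_sqrt hC.le, sq_abs] at h1
  simpa [abs_of_nonneg (sq_nonneg (X n ω))] using h1

end StochasticOrder

/-! ### Linear growth of the sum of score norms, and second moments of the weights -/

section Score

variable {Ω E F ι : Type*} [Fintype ι] [MeasurableSpace Ω] [MeasurableSpace E] [MeasurableSpace F]
  {μ : Measure Ω} [IsProbabilityMeasure μ] {eps : ℤ → Ω → E} {xi : ℤ → Ω → F}
  {G : ℝ → (ℕ → E) → EuclideanSpace ℝ ι} {V : ℝ → (ℕ → E) → ℝ} {H : ℝ → (ℕ → F) → ℝ}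
  {β : ℝ → ι → ℝ}

theorem memLp_norm_Uproc (hS : StandingAssumptions μ eps xi G V H)
    (hA : ConditionA μ eps xi G V H β) {n i : ℕ} (hi : i ∈ Finset.Icc 1 n) :
    MemLp (fun ω => ‖Uproc G V H (design n i) (past (jointInnov eps xi) i ω)‖) 2 μ :=
  (identDistrib_Uproc hS (design_mem_Icc hi) i).memLp_iff.1
    ((hA.A3_moment _ (design_mem_Icc hi)).mono_exponent (by norm_num)).norm

theorem isBigOP_sum_score (hS : StandingAssumptions μ eps xi G V H)
    (hA : ConditionA μ eps xi G V H β) :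
    IsBigOP μ (fun n ω => ∑ i ∈ Finset.Icc 1 n,
      ‖Uproc G V H (design n i) (past (jointInnov eps xi) i ω)‖) (fun n => n) := by
  obtain ⟨C, hC0, hC⟩ := exists_eLpNorm_Uproc_le hA
  refine isBigOP_of_lintegral_le hC0 (fun n => ?_)
    ((eventually_gt_atTop 0).mono fun n hn => by exact_mod_cast hn) (Eventually.of_forall fun n => ?_)
  · exact (memLp_finsetSum _ fun i hi => memLp_norm_Uproc hS hA hi).aemeasurable
  · have h1 : ∀ ω, ENNReal.ofReal |∑ i ∈ Finset.Icc 1 n,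
        ‖Uproc G V H (design n i) (past (jointInnov eps xi) i ω)‖| =
        ∑ i ∈ Finset.Icc 1 n,
          ENNReal.ofReal ‖Uproc G V H (design n i) (past (jointInnov eps xi) i ω)‖ := by
      intro ω
      rw [abs_of_nonneg (Finset.sum_nonneg fun _ _ => norm_nonneg _),
        ENNReal.ofReal_sum_of_nonneg fun _ _ => norm_nonneg _]
    simp only [h1]
    have hm : ∀ i ∈ Finset.Icc 1 n, AEMeasurable (fun ω =>
        ENNReal.ofReal ‖Uproc G V H (design n i) (past (jointInnov eps xi) i ω)‖) μ := fun i hi =>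
      ENNReal.measurable_ofReal.comp_aemeasurable (memLp_norm_Uproc hS hA hi).aemeasurable
    rw [lintegral_finsetSum' _ hm]
    have h2 : ∀ i ∈ Finset.Icc 1 n, ∫⁻ ω,
        ENNReal.ofReal ‖Uproc G V H (design n i) (past (jointInnov eps xi) i ω)‖ ∂μ ≤
          ENNReal.ofReal C := by
      intro i hi
      have e := ((identDistrib_Uproc hS (design_mem_Icc hi) i).comp
        ENNReal.measurable_ofReal).lintegral_eq
      simp only [Function.comp_apply] at e
      rw [← e]
      simp only [ofReal_norm]
      rw [← eLpNorm_one_eq_lintegral_enorm]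
      exact (eLpNorm_le_eLpNorm_of_exponent_le (by norm_num)
        (hA.A3_moment _ (design_mem_Icc hi)).1).trans (hC _ (design_mem_Icc hi))
    refine (Finset.sum_le_sum h2).trans (le_of_eq ?_)
    rw [Finset.sum_const, nsmul_eq_mul, Nat.card_Icc, Nat.add_sub_cancel, mul_comm C,
      ENNReal.ofReal_mul (Nat.cast_nonneg n), ENNReal.ofReal_natCast]

/-- Chebyshev's inequality: the first `σ n` terms alone give a mean of order `n`, while the variance
is `O(n)`. -/
theorem exists_tendsto_sum_score_lt [Nonempty ι] (hS : StandingAssumptions μ eps xi G V H)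
    (hA : ConditionA μ eps xi G V H β) :
    ∃ c : ℝ, 0 < c ∧ Tendsto (fun n : ℕ => μ {ω | ∑ i ∈ Finset.Icc 1 n,
      ‖Uproc G V H (design n i) (past (jointInnov eps xi) i ω)‖ < c * n}) atTop (𝓝 0) := by
  obtain ⟨c, τ, hc, hτ, hlow⟩ := exists_integral_norm_Uproc_ge hA
  obtain ⟨C, hC, hvar⟩ := exists_variance_sum_score_le hS hA
  set σ := min τ 1 with hσ
  have hσ0 : 0 < σ := lt_min hτ one_pos
  set X : ℕ → Ω → ℝ := fun n ω => ∑ i ∈ Finset.Icc 1 n,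
      ‖Uproc G V H (design n i) (past (jointInnov eps xi) i ω)‖ with hX
  have hmem : ∀ n, MemLp (X n) 2 μ := fun n =>
    memLp_finsetSum _ fun i hi => memLp_norm_Uproc hS hA hi
  have hmean : ∀ᶠ n : ℕ in atTop, c * σ / 2 * n ≤ ∫ ω, X n ω ∂μ := by
    filter_upwards [(tendsto_natCast_atTop_atTop (R := ℝ)).eventually_ge_atTop (2 / σ)]
      with n hn
    have hn0 : (0 : ℝ) < n := lt_of_lt_of_le (by positivity) hn
    have e1 : ∫ ω, X n ω ∂μ = ∑ i ∈ Finset.Icc 1 n,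
        ∫ ω, ‖Uproc G V H (design n i) (past (jointInnov eps xi) 0 ω)‖ ∂μ := by
      rw [integral_finsetSum _ fun i hi => (memLp_norm_Uproc hS hA hi).integrable (by norm_num)]
      exact Finset.sum_congr rfl fun i hi =>
        (identDistrib_Uproc hS (design_mem_Icc hi) i).integral_eq.symm
    rw [e1]
    set k := ⌊σ * n⌋₊ with hk
    have hkσ : (k : ℝ) ≤ σ * n := Nat.floor_le (by positivity)
    have hkn : k ≤ n := by
      have : (k : ℝ) ≤ n := hkσ.trans (by nlinarith [min_le_right τ 1])
      exact_mod_cast this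
    have hk2 : σ * n / 2 ≤ k := by
      have := Nat.lt_floor_add_one (σ * n)
      rw [div_le_iff₀ hσ0] at hn
      linarith
    calc c * σ / 2 * n = (σ * n / 2) * c := by ring
      _ ≤ k * c := by gcongr
      _ = ∑ i ∈ Finset.Icc 1 k, c := by simp
      _ ≤ ∑ i ∈ Finset.Icc 1 k,
          ∫ ω, ‖Uproc G V H (design n i) (past (jointInnov eps xi) 0 ω)‖ ∂μ := by
        refine Finset.sum_le_sum fun i hi => hlow _ (design_mem_Icc
          (Finset.Icc_subset_Icc_right hkn hi)) ?_
        have : (i : ℝ) ≤ k := by exact_mod_cast (Finset.mem_Icc.1 hi).2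
        unfold design
        rw [div_le_iff₀ hn0]
        exact (this.trans hkσ).trans (by gcongr; exact min_le_left _ _)
      _ ≤ _ := Finset.sum_le_sum_of_subset_of_nonneg (Finset.Icc_subset_Icc_right hkn)
          fun _ _ _ => integral_nonneg fun _ => norm_nonneg _
  -- Half of the lower bound for the mean, so falling below `e n` is a deviation of at least `e n`.
  set e := c * σ / 4 with he
  have he0 : 0 < e := by positivity
  refine ⟨e, he0, ?_⟩
  have hlim : Tendsto (fun n : ℕ => ENNReal.ofReal (C / e ^ 2 * (n : ℝ)⁻¹)) atTop (𝓝 0) := by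
    rw [← ENNReal.ofReal_zero]
    refine ENNReal.tendsto_ofReal ?_
    simpa using (tendsto_inv_atTop_nhds_zero_nat (𝕜 := ℝ)).const_mul (C / e ^ 2)
  refine tendsto_of_tendsto_of_tendsto_of_le_of_le' tendsto_const_nhds hlim
    (Eventually.of_forall fun _ => zero_le) ?_
  filter_upwards [hmean, eventually_gt_atTop 0] with n hn hn0
  have hn0' : (0 : ℝ) < n := by exact_mod_cast hn0
  have hch := meas_ge_le_variance_div_sq (hmem n) (c := e * n) (by positivity)
  refine (measure_mono fun ω (hω : X n ω < e * n) => ?_).trans (hch.trans ?_)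
  · show e * n ≤ |X n ω - ∫ ω, X n ω ∂μ|
    rw [abs_sub_comm]
    refine le_trans ?_ (le_abs_self _)
    have : c * σ / 2 * n = 2 * (e * n) := by rw [he]; ring
    linarith
  · refine ENNReal.ofReal_le_ofReal ?_
    calc Var[X n; μ] / (e * n) ^ 2 ≤ C * n / (e * n) ^ 2 := by gcongr; exact hvar n
      _ = C / e ^ 2 * (n : ℝ)⁻¹ := by field_simp

/-- `E |x_i|² V_i²` is bounded. -/
theorem exists_lintegral_regressor_sq_mul_V_sq_le (hS : StandingAssumptions μ eps xi G V H)
    (hA : ConditionA μ eps xi G V H β) :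
    ∃ C : ℝ, 0 < C ∧ ∀ n, ∀ i ∈ Finset.Icc 1 n,
      ∫⁻ ω, ENNReal.ofReal ((regressor eps G n ω i ⬝ᵥ regressor eps G n ω i) *
        V (design n i) (past eps i ω) ^ 2) ∂μ ≤ ENNReal.ofReal C := by
  obtain ⟨C, hC0, hC⟩ := exists_eLpNorm_Uproc_le hA
  refine ⟨C ^ 2 + 1, by positivity, fun n i hi => ?_⟩
  have ht := design_mem_Icc hi
  set t := design n i with htdef
  have hind : IndepFun (past eps i) (past xi i) μ := by
    refine hS.indep.comp (φ := fun e : ℤ → E => fun j : ℕ => e (i - j))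
      (ψ := fun e : ℤ → F => fun j : ℕ => e (i - j)) ?_ ?_ <;>
    exact measurable_pi_lambda _ fun j => measurable_pi_apply _
  have hG2 : Measurable fun x => ENNReal.ofReal (‖G t x‖ ^ 2 * V t x ^ 2) :=
    (((hS.meas_G t ht).norm.pow_const 2).mul ((hS.meas_V t ht).pow_const 2)).ennreal_ofReal
  have hH2 : Measurable fun x => ENNReal.ofReal (H t x ^ 2) :=
    ((hS.meas_H t ht).pow_const 2).ennreal_ofReal
  -- `|G|² V²` and `H²` are independent and `E H² = 1`, so `E |G|² V² = E |U|²`. No fourth moment of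
  -- `V` enters.
  have hprod := lintegral_mul_eq_lintegral_mul_lintegral_of_indepFun
    (hG2.comp (measurable_past hS.eps_iid i)) (hH2.comp (measurable_past hS.xi_iid i))
    (hind.comp hG2 hH2)
  have hHone : ∫⁻ ω, ENNReal.ofReal (H t (past xi i ω) ^ 2) ∂μ = 1 := by
    have e := ((identDistrib_past hS.xi_iid 0 i).comp hH2).lintegral_eq
    simp only [Function.comp_apply] at e
    rw [← e, ← ofReal_integral_eq_lintegral_ofReal (hS.H_sq t ht).integrable_sq
      (ae_of_all _ fun _ => sq_nonneg _)]
    have hv := hS.H_var t ht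
    rw [variance_of_integral_eq_zero (hS.H_sq t ht).aemeasurable (hS.H_mean t ht)] at hv
    rw [hv, ENNReal.ofReal_one]
  have hG : ∀ ω, ‖G t (past eps i ω)‖ ^ 2 =
      regressor eps G n ω i ⬝ᵥ regressor eps G n ω i := by
    intro ω
    rw [EuclideanSpace.norm_sq_eq]
    simp [dotProduct, regressor, sq, htdef]
  simp only [Pi.mul_apply, Function.comp_apply] at hprod
  rw [hHone, mul_one] at hprod
  simp only [← hG]
  rw [← hprod]
  have hU : ∀ ω, ENNReal.ofReal (‖G t (past eps i ω)‖ ^ 2 * V t (past eps i ω) ^ 2) *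
      ENNReal.ofReal (H t (past xi i ω) ^ 2) =
      ‖Uproc G V H t (past (jointInnov eps xi) i ω)‖ₑ ^ (2 : ℝ) := by
    intro ω
    have h2 : Uproc G V H t (past (jointInnov eps xi) i ω) =
      (V t (past eps i ω) * H t (past xi i ω)) • G t (past eps i ω) := rfl
    rw [← ENNReal.ofReal_mul (by positivity), ← ofReal_norm, h2, norm_smul,
      Real.norm_eq_abs, ENNReal.ofReal_rpow_of_nonneg (by positivity) (by norm_num)]
    congr 1
    rw [Real.rpow_two, mul_pow, sq_abs]
    ring
  simp only [hU]
  have e := ((identDistrib_past (isIID_jointInnov hS.eps_iid hS.xi_iid hS.indep) 0 i).comp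
    (measurable_Uproc hS ht)).eLpNorm_eq (p := 2)
  simp only [Function.comp_def] at e
  have h1 := hC t ht
  rw [e, eLpNorm_eq_lintegral_rpow_enorm_toReal (by norm_num) (by norm_num)] at h1
  simp only [ENNReal.toReal_ofNat] at h1
  have h3 := ENNReal.rpow_le_rpow h1 (z := 2) (by norm_num)
  rw [← ENNReal.rpow_mul, ENNReal.ofReal_rpow_of_nonneg hC0 (by norm_num)] at h3
  norm_num at h3
  norm_num
  exact h3.trans (ENNReal.ofReal_le_ofReal (by linarith))

end Score

/-! ### The local linear smoother -/

noncomputable section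

/-- The kernel weight of observation `j` in the fit at `t_i`. -/
def kernelWeight (K : ℝ → ℝ) (b : ℝ) (n i j : ℕ) : ℝ := K ((design n j - design n i) / b)

/-- The regressors `(x_j, x_j (t_j - t_i) / b)` of the local linear fit at `t_i`. -/
def localDesign {ι : Type*} (b : ℝ) (n : ℕ) (x : ℕ → ι → ℝ) (i j : ℕ) : ι ⊕ ι → ℝ :=
  Sum.elim (x j) fun a => x j a * ((design n j - design n i) / b)

/-- The Gram matrix of the local linear fit at `t_i`. -/
def localGram {ι : Type*} (K : ℝ → ℝ) (b : ℝ) (n : ℕ) (x : ℕ → ι → ℝ) (i : ℕ) :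
    Matrix (ι ⊕ ι) (ι ⊕ ι) ℝ :=
  fun a c => ∑ j ∈ Finset.Icc 1 n,
    kernelWeight K b n i j * (localDesign b n x i j a * localDesign b n x i j c)

/-- The matrix that maps the responses to the fitted values at the design points. -/
def smoother {ι : Type*} [Fintype ι] [DecidableEq ι] (K : ℝ → ℝ) (b : ℝ) (n : ℕ) (x : ℕ → ι → ℝ)
    (i j : ℕ) : ℝ :=
  kernelWeight K b n i j *
    (Sum.elim (x i) (fun _ => 0) ⬝ᵥ (localGram K b n x i)⁻¹.mulVec (localDesign b n x i j))

end

section Smoother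

variable {ι : Type*} [Fintype ι] {K : ℝ → ℝ} {b : ℝ} {n : ℕ} {x : ℕ → ι → ℝ} {i : ℕ}

theorem dotProduct_self_nonneg_real {κ : Type*} [Fintype κ] (u : κ → ℝ) : 0 ≤ u ⬝ᵥ u :=
  Finset.sum_nonneg fun _ _ => mul_self_nonneg _

theorem abs_dotProduct_le {κ : Type*} [Fintype κ] (u v : κ → ℝ) :
    |u ⬝ᵥ v| ≤ √(u ⬝ᵥ u) * √(v ⬝ᵥ v) := by
  rw [← Real.sqrt_mul (dotProduct_self_nonneg_real u)]
  refine Real.abs_le_sqrt ?_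
  have := Finset.sum_mul_sq_le_sq_mul_sq Finset.univ u v
  simpa [dotProduct, sq] using this

theorem dotProduct_sq_le {κ : Type*} [Fintype κ] (u v : κ → ℝ) :
    (u ⬝ᵥ v) ^ 2 ≤ (u ⬝ᵥ u) * (v ⬝ᵥ v) := by
  have := Finset.sum_mul_sq_le_sq_mul_sq Finset.univ u v
  simpa [dotProduct, sq] using this

theorem localGram_mulVec (η : ι ⊕ ι → ℝ) (a : ι ⊕ ι) :
    (localGram K b n x i).mulVec η a = ∑ j ∈ Finset.Icc 1 n,
      kernelWeight K b n i j * (localDesign b n x i j ⬝ᵥ η) * localDesign b n x i j a := by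
  simp only [Matrix.mulVec, dotProduct, localGram, Finset.sum_mul, Finset.mul_sum]
  rw [Finset.sum_comm]
  exact Finset.sum_congr rfl fun j _ => Finset.sum_congr rfl fun c _ => by ring

theorem dotProduct_localGram_mulVec (η : ι ⊕ ι → ℝ) :
    η ⬝ᵥ (localGram K b n x i).mulVec η = ∑ j ∈ Finset.Icc 1 n,
      kernelWeight K b n i j * (localDesign b n x i j ⬝ᵥ η) ^ 2 := by
  have : η ⬝ᵥ (localGram K b n x i).mulVec η = ∑ a, η a *
      (localGram K b n x i).mulVec η a := rfl
  rw [this]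
  simp only [localGram_mulVec, Finset.mul_sum]
  rw [Finset.sum_comm]
  refine Finset.sum_congr rfl fun j _ => ?_
  rw [sq, ← mul_assoc]
  conv_rhs => enter [2]; rw [dotProduct]
  rw [Finset.mul_sum]
  exact Finset.sum_congr rfl fun a _ => by ring

theorem localDesign_dotProduct (η : ι ⊕ ι → ℝ) (j : ℕ) :
    localDesign b n x i j ⬝ᵥ η = x j ⬝ᵥ (fun a => η (Sum.inl a)) +
      (x j ⬝ᵥ fun a => η (Sum.inr a)) * ((design n j - design n i) / b) := by
  simp only [dotProduct, localDesign, Fintype.sum_sum_type, Sum.elim_inl, Sum.elim_inr,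
    Finset.sum_mul]
  congr 1
  exact Finset.sum_congr rfl fun a _ => by ring

variable [DecidableEq ι] {κ : ℝ}

/-- Coercivity of the Gram matrix of the local linear fit at `t_i`. -/
def GramCoercive (K : ℝ → ℝ) (b : ℝ) (n : ℕ) (x : ℕ → ι → ℝ) (i : ℕ) (κ : ℝ) : Prop :=
  ∀ η : ι ⊕ ι → ℝ, κ * (η ⬝ᵥ η) ≤ ∑ j ∈ Finset.Icc 1 n,
    kernelWeight K b n i j * (localDesign b n x i j ⬝ᵥ η) ^ 2

theorem GramCoercive.mulVec_injective (h : GramCoercive K b n x i κ) (hκ : 0 < κ) :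
    Function.Injective (localGram K b n x i).mulVec := by
  intro u v huv
  have h1 : (localGram K b n x i).mulVec (u - v) = 0 := by
    rw [Matrix.mulVec_sub, huv, sub_self]
  have h2 := h (u - v)
  rw [← dotProduct_localGram_mulVec, h1, dotProduct_zero] at h2
  have h3 : (u - v) ⬝ᵥ (u - v) = 0 :=
    le_antisymm (by nlinarith) (dotProduct_self_nonneg_real _)
  exact sub_eq_zero.1 (dotProduct_self_eq_zero.1 h3)

theorem GramCoercive.inv_mulVec (h : GramCoercive K b n x i κ) (hκ : 0 < κ) (η : ι ⊕ ι → ℝ) :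
    (localGram K b n x i)⁻¹.mulVec ((localGram K b n x i).mulVec η) = η := by
  have hu : IsUnit (localGram K b n x i) :=
    Matrix.mulVec_injective_iff_isUnit.1 (h.mulVec_injective hκ)
  rw [Matrix.mulVec_mulVec, Matrix.nonsing_inv_mul _ ((Matrix.isUnit_iff_isUnit_det _).1 hu),
    Matrix.one_mulVec]

theorem GramCoercive.mulVec_inv (h : GramCoercive K b n x i κ) (hκ : 0 < κ) (η : ι ⊕ ι → ℝ) :
    (localGram K b n x i).mulVec ((localGram K b n x i)⁻¹.mulVec η) = η := by
  have hu : IsUnit (localGram K b n x i) :=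
    Matrix.mulVec_injective_iff_isUnit.1 (h.mulVec_injective hκ)
  rw [Matrix.mulVec_mulVec, Matrix.mul_nonsing_inv _ ((Matrix.isUnit_iff_isUnit_det _).1 hu),
    Matrix.one_mulVec]

/-- For `g` the solution with right side `v`, coercivity and Cauchy–Schwarz give `κ |g|² ≤ g ⬝ v ≤
|g| |v|`, hence `|g| ≤ |v| / κ`. -/
theorem GramCoercive.abs_dotProduct_inv_mulVec_le (h : GramCoercive K b n x i κ) (hκ : 0 < κ)
    (u v : ι ⊕ ι → ℝ) :
    |u ⬝ᵥ (localGram K b n x i)⁻¹.mulVec v| ≤ √(u ⬝ᵥ u) * √(v ⬝ᵥ v) / κ := by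
  set g := (localGram K b n x i)⁻¹.mulVec v with hg
  have h1 := h g
  rw [← dotProduct_localGram_mulVec, h.mulVec_inv hκ] at h1
  have h2 := (le_abs_self _).trans (abs_dotProduct_le g v)
  have hgg : κ * √(g ⬝ᵥ g) ≤ √(v ⬝ᵥ v) := by
    rcases (Real.sqrt_nonneg (g ⬝ᵥ g)).eq_or_lt with h0 | h0
    · rw [← h0, mul_zero]; positivity
    · have h3 : √(g ⬝ᵥ g) * √(g ⬝ᵥ g) = g ⬝ᵥ g := Real.mul_self_sqrt (dotProduct_self_nonneg_real g)
      have : κ * √(g ⬝ᵥ g) * √(g ⬝ᵥ g) ≤ √(v ⬝ᵥ v) * √(g ⬝ᵥ g) := by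
        rw [mul_assoc, h3]; linarith
      exact le_of_mul_le_mul_right this h0
  refine (abs_dotProduct_le u g).trans ?_
  rw [mul_div_assoc]
  gcongr
  rw [le_div_iff₀ hκ]
  linarith

theorem kernelWeight_eq_zero (hK : IsKernel K) (hb : 0 < b) {j : ℕ}
    (hij : b < |design n j - design n i|) : kernelWeight K b n i j = 0 := by
  refine hK.supp _ fun hmem => ?_
  have : |(design n j - design n i) / b| ≤ 1 := abs_le.2 hmem
  rw [abs_div, abs_of_pos hb, div_le_one hb] at this
  linarith

theorem smoother_eq_zero (hK : IsKernel K) (hb : 0 < b) {j : ℕ}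
    (hij : b < |design n j - design n i|) : smoother K b n x i j = 0 := by
  rw [smoother, kernelWeight_eq_zero hK hb hij, zero_mul]

/-- Inside the window the rescaled distance is at most one, so the local design vector has norm at
most `2 |x_j|`. Outside, the weight is zero. -/
theorem abs_smoother_le (hK : IsKernel K) {Kmax : ℝ} (hKm : ∀ u, K u ≤ Kmax) (hb : 0 < b)
    (h : GramCoercive K b n x i κ) (hκ : 0 < κ) (j : ℕ) :
    |smoother K b n x i j| ≤ 2 * Kmax / κ * (√(x i ⬝ᵥ x i) * √(x j ⬝ᵥ x j)) := by
  have hKm0 : 0 ≤ Kmax := (hK.nonneg 0).trans (hKm 0)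
  by_cases hij : b < |design n j - design n i|
  · rw [smoother_eq_zero hK hb hij, abs_zero]
    positivity
  rw [not_lt] at hij
  rw [smoother, abs_mul]
  have h1 : |kernelWeight K b n i j| ≤ Kmax := by
    rw [kernelWeight, abs_of_nonneg (hK.nonneg _)]
    exact hKm _
  have h2 := h.abs_dotProduct_inv_mulVec_le hκ (Sum.elim (x i) fun _ => 0)
    (localDesign b n x i j)
  have e1 : (Sum.elim (x i) fun _ => 0 : ι ⊕ ι → ℝ) ⬝ᵥ (Sum.elim (x i) fun _ => 0) =
      x i ⬝ᵥ x i := by simp [dotProduct]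
  have hu : ((design n j - design n i) / b) ^ 2 ≤ 1 := by
    rw [sq_le_one_iff_abs_le_one, abs_div, abs_of_pos hb, div_le_one hb]
    exact hij
  have e2 : localDesign b n x i j ⬝ᵥ localDesign b n x i j ≤ 2 ^ 2 * (x j ⬝ᵥ x j) := by
    have : localDesign b n x i j ⬝ᵥ localDesign b n x i j =
        x j ⬝ᵥ x j + (x j ⬝ᵥ x j) * ((design n j - design n i) / b) ^ 2 := by
      simp only [dotProduct, localDesign, Fintype.sum_sum_type, Sum.elim_inl, Sum.elim_inr,
        Finset.sum_mul]
      congr 1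
      exact Finset.sum_congr rfl fun a _ => by ring
    rw [this]
    nlinarith [dotProduct_self_nonneg_real (x j)]
  rw [e1] at h2
  have h3 : √(localDesign b n x i j ⬝ᵥ localDesign b n x i j) ≤ 2 * √(x j ⬝ᵥ x j) := by
    refine (Real.sqrt_le_sqrt e2).trans ?_
    rw [Real.sqrt_mul (by norm_num), Real.sqrt_sq (by norm_num)]
  calc _ ≤ Kmax * (√(x i ⬝ᵥ x i) * √(localDesign b n x i j ⬝ᵥ localDesign b n x i j) / κ) :=
        mul_le_mul h1 h2 (abs_nonneg _) hKm0
    _ ≤ Kmax * (√(x i ⬝ᵥ x i) * (2 * √(x j ⬝ᵥ x j)) / κ) := by gcongr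
    _ = _ := by ring

/-- Solutions of the normal equations give the fitted values of the smoother. -/
theorem sum_smoother_mul_eq (h : GramCoercive K b n x i κ) (hκ : 0 < κ) {y : ℕ → ℝ}
    {η : ι ⊕ ι → ℝ}
    (hη : ∀ a, ∑ j ∈ Finset.Icc 1 n,
      kernelWeight K b n i j * (y j - localDesign b n x i j ⬝ᵥ η) * localDesign b n x i j a = 0) :
    ∑ j ∈ Finset.Icc 1 n, smoother K b n x i j * y j = x i ⬝ᵥ fun a => η (Sum.inl a) := by
  have h1 : (localGram K b n x i).mulVec η =
      ∑ j ∈ Finset.Icc 1 n, (kernelWeight K b n i j * y j) • localDesign b n x i j := by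
    ext a
    have := hη a
    simp only [mul_sub, sub_mul, Finset.sum_sub_distrib] at this
    rw [localGram_mulVec, ← sub_eq_zero.1 this]
    simp [Finset.sum_apply]
  have h2 := h.inv_mulVec hκ η
  rw [h1, Matrix.mulVec_sum] at h2
  have h3 : x i ⬝ᵥ (fun a => η (Sum.inl a)) = Sum.elim (x i) (fun _ => 0) ⬝ᵥ η := by
    simp [dotProduct]
  rw [h3]
  conv_rhs => rw [← h2]
  rw [dotProduct_sum]
  refine Finset.sum_congr rfl fun j _ => ?_
  rw [Matrix.mulVec_smul, dotProduct_smul, smul_eq_mul, smoother]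
  ring

/-- Data that follow the local model exactly leave no residual, so the true coefficients solve the
normal equations. This is what reduces the bias to second order. -/
theorem sum_smoother_mul_linear (h : GramCoercive K b n x i κ) (hκ : 0 < κ) (hb : b ≠ 0)
    (α₀ α₁ : ι → ℝ) :
    ∑ j ∈ Finset.Icc 1 n, smoother K b n x i j *
      (x j ⬝ᵥ α₀ + (x j ⬝ᵥ α₁) * (design n j - design n i)) = x i ⬝ᵥ α₀ := by
  refine sum_smoother_mul_eq h hκ (η := Sum.elim α₀ fun a => b * α₁ a) fun a => ?_
  refine Finset.sum_eq_zero fun j _ => ?_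
  have : (x j ⬝ᵥ fun a => b * α₁ a) = b * (x j ⬝ᵥ α₁) := by
    simp only [dotProduct, Finset.mul_sum]
    exact Finset.sum_congr rfl fun a _ => by ring
  rw [localDesign_dotProduct]
  simp only [Sum.elim_inl, Sum.elim_inr, this]
  have : b * (x j ⬝ᵥ α₁) * ((design n j - design n i) / b) =
      (x j ⬝ᵥ α₁) * (design n j - design n i) := by field_simp
  rw [this]
  ring

/-- Local linear estimates are given by the smoother. -/
theorem IsLocalLinearEstimate.dotProduct_eq (h : GramCoercive K b n x i κ) (hκ : 0 < κ)
    (hb : b ≠ 0) {y : ℕ → ℝ} {βh : ι → ℝ}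
    (hβ : IsLocalLinearEstimate K b n x y (design n i) βh) :
    x i ⬝ᵥ βh = ∑ j ∈ Finset.Icc 1 n, smoother K b n x i j * y j := by
  obtain ⟨slope, hmin⟩ := hβ
  set η : ι ⊕ ι → ℝ := Sum.elim βh fun a => b * slope a with hη
  have hloss : ∀ ζ : ι ⊕ ι → ℝ, localLoss K b n x y (design n i)
      (fun a => ζ (Sum.inl a), fun a => ζ (Sum.inr a) / b) =
      ∑ j ∈ Finset.Icc 1 n, (y j - localDesign b n x i j ⬝ᵥ ζ) ^ 2 * kernelWeight K b n i j := by
    intro ζ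
    refine Finset.sum_congr rfl fun j _ => ?_
    rw [localDesign_dotProduct, kernelWeight]
    congr 2
    have : (x j ⬝ᵥ fun a => ζ (Sum.inr a) / b) = (x j ⬝ᵥ fun a => ζ (Sum.inr a)) / b := by
      simp only [dotProduct, Finset.sum_div]
      exact Finset.sum_congr rfl fun a _ => by ring
    rw [this]
    ring
  have hηloss := hloss η
  have e1 : (fun a => η (Sum.inr a) / b) = slope := by
    ext a; simp [hη, hb]
  have e2 : (fun a => η (Sum.inl a)) = βh := by ext a; simp [hη]
  rw [e1, e2] at hηloss
  have key : ∀ ζ : ι ⊕ ι → ℝ, ∑ j ∈ Finset.Icc 1 n,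
      kernelWeight K b n i j * (y j - localDesign b n x i j ⬝ᵥ η) *
        (localDesign b n x i j ⬝ᵥ ζ) = 0 := by
    intro ζ
    set A := ∑ j ∈ Finset.Icc 1 n, kernelWeight K b n i j * (y j - localDesign b n x i j ⬝ᵥ η) *
        (localDesign b n x i j ⬝ᵥ ζ) with hA
    set B := ∑ j ∈ Finset.Icc 1 n, kernelWeight K b n i j * (localDesign b n x i j ⬝ᵥ ζ) ^ 2 with hB
    -- Moving from the minimiser in direction `ζ` by `s` changes the loss by `-2 s A + s² B`.
    have hs : ∀ s : ℝ, 0 ≤ -2 * s * A + s ^ 2 * B := by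
      intro s
      have h1 : localLoss K b n x y (design n i) (βh, slope) ≤
          localLoss K b n x y (design n i) (fun a => (η + s • ζ) (Sum.inl a),
            fun a => (η + s • ζ) (Sum.inr a) / b) := hmin (mem_univ _)
      rw [hloss, hηloss] at h1
      have h2 : ∑ j ∈ Finset.Icc 1 n, (y j - localDesign b n x i j ⬝ᵥ (η + s • ζ)) ^ 2 *
          kernelWeight K b n i j = ∑ j ∈ Finset.Icc 1 n,
          (y j - localDesign b n x i j ⬝ᵥ η) ^ 2 * kernelWeight K b n i j +
            (-2 * s * A + s ^ 2 * B) := by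
        rw [hA, hB, Finset.mul_sum, Finset.mul_sum, ← Finset.sum_add_distrib,
          ← Finset.sum_add_distrib]
        refine Finset.sum_congr rfl fun j _ => ?_
        rw [dotProduct_add, dotProduct_smul, smul_eq_mul]
        ring
      linarith
    by_contra hne
    have hB0 : 0 ≤ B := by
      have := hs 1; have := hs (-1); linarith
    -- This `s` makes the quadratic equal to `-A² (B + 2) / (B + 1)²`, negative unless `A = 0`; the
    -- `+ 1` covers `B = 0`.
    have h3 := hs (A / (B + 1))
    have h4 : -2 * (A / (B + 1)) * A + (A / (B + 1)) ^ 2 * B =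
        -(A ^ 2 * (B + 2)) / (B + 1) ^ 2 := by field_simp; ring
    rw [h4] at h3
    have h5 : 0 < A ^ 2 * (B + 2) / (B + 1) ^ 2 := by positivity
    rw [neg_div] at h3
    linarith
  rw [sum_smoother_mul_eq h hκ (η := η), e2]
  intro a
  have := key (Pi.single a 1)
  simpa using this

end Smoother

/-! ### Coercivity of the local Gram matrices from block averages -/

/-- The `l`-th block of `m` consecutive observations. -/
def blockOf (n m l : ℕ) : Finset ℕ := {j ∈ Finset.Icc 1 n | j / m = l}

section Blocks

variable {n m : ℕ}

theorem blockOf_subset (l : ℕ) : blockOf n m l ⊆ Finset.Icc 1 n := Finset.filter_subset _ _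

theorem card_blockOf_le (hm : 0 < m) (l : ℕ) : (blockOf n m l).card ≤ m := by
  have : blockOf n m l ⊆ Finset.Ico (l * m) (l * m + m) := by
    intro j hj
    rw [blockOf, Finset.mem_filter] at hj
    rw [Finset.mem_Ico, ← hj.2]
    exact ⟨Nat.div_mul_le_self j m, Nat.lt_div_mul_add hm⟩
  simpa using Finset.card_le_card this

theorem sum_le_card_mul_of_blocks {r : ℕ → ℝ} (hr : ∀ j, 0 ≤ r j) {C : ℝ}
    (h : ∀ l, ∑ j ∈ blockOf n m l, r j ≤ C * m) {W T : Finset ℕ} (hW : W ⊆ Finset.Icc 1 n)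
    (hT : ∀ j ∈ W, j / m ∈ T) : ∑ j ∈ W, r j ≤ T.card * (C * m) := by
  rw [← Finset.sum_fiberwise_of_maps_to hT, ← nsmul_eq_mul]
  refine Finset.sum_le_card_nsmul _ _ _ fun l _ => (le_trans ?_ (h l))
  refine Finset.sum_le_sum_of_subset_of_nonneg ?_ fun _ _ _ => hr _
  intro j hj
  rw [Finset.mem_filter] at hj
  rw [blockOf, Finset.mem_filter]
  exact ⟨hW hj.1, hj.2⟩

theorem sum_le_of_blocks (hmn : m ≤ n) {r : ℕ → ℝ} (hr : ∀ j, 0 ≤ r j) {C : ℝ}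
    (hC : 0 ≤ C) (h : ∀ l, ∑ j ∈ blockOf n m l, r j ≤ C * m) :
    ∑ j ∈ Finset.Icc 1 n, r j ≤ 2 * C * n := by
  refine (sum_le_card_mul_of_blocks hr h (T := Finset.range (n / m + 1)) subset_rfl
    fun j hj => ?_).trans ?_
  · rw [Finset.mem_range, Nat.lt_succ_iff]
    exact Nat.div_le_div_right (Finset.mem_Icc.1 hj).2
  · rw [Finset.card_range]
    have h1 : ((n / m : ℕ) : ℝ) * m ≤ n := by exact_mod_cast Nat.div_mul_le_self n m
    have h2 : (m : ℝ) ≤ n := by exact_mod_cast hmn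
    push_cast
    nlinarith

/-- A window of half-width `n b` around `i` meets blocks of total length at most `2 n b + 2 m`, and
`m ≤ n b`. -/
theorem sum_near_le_of_blocks (hm : 0 < m) {b : ℝ} (hb : 0 < b) (hmn : m ≤ n * b)
    {r : ℕ → ℝ} (hr : ∀ j, 0 ≤ r j) {C : ℝ}
    (hC : 0 ≤ C) (h : ∀ l, ∑ j ∈ blockOf n m l, r j ≤ C * m) (i : ℕ) :
    ∑ j ∈ Finset.Icc 1 n with |design n j - design n i| ≤ b, r j ≤ 4 * C * (n * b) := by
  set k := ⌊n * b⌋₊ with hk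
  have hm' : (0 : ℝ) < m := by exact_mod_cast hm
  have hn : (0 : ℝ) < n := by
    by_contra! h0
    nlinarith
  have hnear : ∀ j ∈ Finset.Icc 1 n, |design n j - design n i| ≤ b → j ≤ i + k ∧ i ≤ j + k := by
    intro j _ hj
    have h1 : |(j : ℝ) - i| ≤ n * b := by
      have : (j : ℝ) - i = n * (design n j - design n i) := by unfold design; field_simp
      rw [this, abs_mul, abs_of_pos hn]
      gcongr
    rw [abs_le] at h1
    constructor
    · rcases le_or_gt j i with h2 | h2
      · omega
      · have : j - i ≤ k := Nat.le_floor (by rw [Nat.cast_sub h2.le]; exact h1.2)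
        omega
    · rcases le_or_gt i j with h2 | h2
      · omega
      · have : i - j ≤ k := Nat.le_floor (by rw [Nat.cast_sub h2.le]; linarith [h1.1])
        omega
  refine (sum_le_card_mul_of_blocks hr h
    (T := Finset.Icc ((i - k) / m) ((i + k) / m)) (Finset.filter_subset _ _) fun j hj => ?_).trans ?_
  · rw [Finset.mem_filter] at hj
    obtain ⟨h1, h2⟩ := hnear j hj.1 hj.2
    rw [Finset.mem_Icc]
    exact ⟨Nat.div_le_div_right (by omega), Nat.div_le_div_right h1⟩
  · have hcard : ((Finset.Icc ((i - k) / m) ((i + k) / m)).card : ℝ) * m ≤ 2 * (n * b) + 2 * m := by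
      have hk' : (k : ℝ) ≤ n * b := Nat.floor_le (by positivity)
      have h1 : (i + k) / m * m ≤ i + k := Nat.div_mul_le_self _ _
      have h2 : i - k < (i - k) / m * m + m := Nat.lt_div_mul_add hm
      have h3 : (Finset.Icc ((i - k) / m) ((i + k) / m)).card * m ≤ 2 * k + 2 * m := by
        rw [Nat.card_Icc, Nat.sub_mul, Nat.add_mul]
        omega
      have : ((Finset.Icc ((i - k) / m) ((i + k) / m)).card : ℝ) * m ≤ 2 * k + 2 * m := by
        exact_mod_cast h3
      linarith
    calc _ = C * (((Finset.Icc ((i - k) / m) ((i + k) / m)).card : ℝ) * m) := by ring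
      _ ≤ C * (2 * (n * b) + 2 * m) := by gcongr
      _ ≤ C * (2 * (n * b) + 2 * (n * b)) := by gcongr
      _ = _ := by ring

/-- The first block that starts at or after `a`. Positivity of `a` excludes block `0`, which lacks
the index `0`, and `a + 2 m ≤ n` excludes a truncated last block. -/
theorem exists_full_block (hm : 0 < m) {a : ℝ} (ha : 0 < a) (han : a + 2 * m ≤ n) :
    ∃ l, (blockOf n m l).card = m ∧ ∀ j ∈ blockOf n m l, a ≤ j ∧ (j : ℝ) ≤ a + 2 * m := by
  have hm' : (0 : ℝ) < m := by exact_mod_cast hm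
  set l := ⌈a / m⌉₊ with hl
  have h1 : a ≤ (l * m : ℕ) := by
    have := Nat.le_ceil (a / m)
    rw [div_le_iff₀ hm'] at this
    exact_mod_cast this
  have h2 : ((l * m : ℕ) : ℝ) < a + m := by
    have := Nat.ceil_lt_add_one (a := a / m) (by positivity)
    have h3 : (l : ℝ) * m < (a / m + 1) * m := by gcongr
    rw [add_mul, div_mul_cancel₀ _ hm'.ne', one_mul] at h3
    exact_mod_cast h3
  have h3 : blockOf n m l = Finset.Ico (l * m) (l * m + m) := by
    ext j
    rw [blockOf, Finset.mem_filter, Finset.mem_Ico, Finset.mem_Icc]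
    constructor
    · rintro ⟨-, h4⟩
      rw [← h4]
      exact ⟨Nat.div_mul_le_self j m, Nat.lt_div_mul_add hm⟩
    · rintro ⟨h4, h5⟩
      have h6 : 0 < l * m := by
        have : (0 : ℝ) < (l * m : ℕ) := ha.trans_le h1
        exact_mod_cast this
      have h7 : (j : ℝ) < ((l * m : ℕ) : ℝ) + m := by exact_mod_cast h5
      have h8 : j ≤ n := by
        have : (j : ℝ) ≤ n := by linarith
        exact_mod_cast this
      refine ⟨⟨by omega, h8⟩, ?_⟩
      rw [Nat.div_eq_iff hm]
      constructor
      · linarith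
      · omega
  refine ⟨l, by rw [h3]; simp, fun j hj => ?_⟩
  rw [h3, Finset.mem_Ico] at hj
  have h4 : ((l * m : ℕ) : ℝ) ≤ j := by exact_mod_cast hj.1
  have h5 : (j : ℝ) < ((l * m : ℕ) : ℝ) + m := by exact_mod_cast hj.2
  constructor <;> linarith

end Blocks

/-- A symmetric density is positive somewhere in `(0, 1)`, since the points `-1, 0, 1` are
negligible, and it is continuous there. Two separated distances `u₁ < u₂` are extracted, with a
margin `ρ` for the width of a block, because one distance cannot separate intercept from slope. -/
theorem IsKernel.exists_pos {K : ℝ → ℝ} (hK : IsKernel K) :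
    ∃ κ u₁ u₂ ρ : ℝ, 0 < κ ∧ 0 < ρ ∧ ρ < u₁ ∧ u₂ + ρ ≤ 1 ∧ 2 * ρ < u₂ - u₁ ∧
      ∀ u, u₁ - ρ ≤ |u| → |u| ≤ u₂ + ρ → κ ≤ K u := by
  obtain ⟨u, hu0, hu1, hu⟩ : ∃ u : ℝ, 0 < u ∧ u < 1 ∧ 0 < K u := by
    by_contra! hcon
    have hz : K =ᵐ[volume] fun _ => 0 := by
      have hfin : ({-1, 0, 1} : Set ℝ).Finite := by simp
      filter_upwards [hfin.countable.ae_notMem volume] with v hv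
      simp only [mem_insert_iff, mem_singleton_iff, not_or] at hv
      by_cases hv1 : v ∈ Icc (-1 : ℝ) 1
      · rcases lt_or_gt_of_ne hv.2.1 with h | h
        · rw [← hK.symm]
          exact le_antisymm (hcon (-v) (by linarith)
            (by have := lt_of_le_of_ne hv1.1 (Ne.symm hv.1); linarith)) (hK.nonneg _)
        · exact le_antisymm (hcon v h (lt_of_le_of_ne hv1.2 hv.2.2)) (hK.nonneg _)
      · exact hK.supp v hv1
    have := hK.integral_one
    rw [integral_congr_ae hz] at this
    simp at this
  have hcont : ContinuousAt K u :=
    hK.smooth.continuousOn.continuousAt (Icc_mem_nhds (by linarith) hu1)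
  have hev : ∀ᶠ v in 𝓝 u, K u / 2 < K v ∧ 0 < v ∧ v < 1 :=
    (hcont.eventually (lt_mem_nhds (by linarith))).and ((lt_mem_nhds hu0).and (gt_mem_nhds hu1))
  obtain ⟨ε, hε, hball⟩ := Metric.eventually_nhds_iff.1 hev
  have hb : ∀ v, |v - u| ≤ ε / 2 → K u / 2 < K v ∧ 0 < v ∧ v < 1 := fun v hv =>
    hball (by rw [Real.dist_eq]; linarith)
  refine ⟨K u / 2, u - ε / 3, u + ε / 3, ε / 6, by positivity, by positivity, ?_, ?_, by linarith,
    fun v h1 h2 => ?_⟩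
  · have := (hb (u - ε / 2) (by rw [abs_le]; constructor <;> linarith)).2.1
    linarith
  · have := (hb (u + ε / 2) (by rw [abs_le]; constructor <;> linarith)).2.2
    linarith
  · have h3 := (hb |v| (by rw [abs_le]; constructor <;> linarith)).1
    rcases abs_choice v with h4 | h4
    · rw [h4] at h3; exact h3.le
    · rw [h4, hK.symm] at h3; exact h3.le

section Coercive

variable {ι : Type*} [Fintype ι] {K : ℝ → ℝ} {b : ℝ} {n m i : ℕ} {x : ℕ → ι → ℝ}

/-- Near every design point there are full blocks at any given relative distance, on one side. -/
theorem exists_block_near (hm : 0 < m) (hi : i ∈ Finset.Icc 1 n) (hb : 0 < b) (hb2 : b ≤ 1 / 2)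
    {ρ : ℝ} (hmρ : m ≤ ρ * (n * b)) :
    ∃ σ : ℝ, |σ| = 1 ∧ ∀ u, ρ < u → u + ρ ≤ 1 → ∃ l, (blockOf n m l).card = m ∧
      ∀ j ∈ blockOf n m l, |(design n j - design n i) / b - σ * u| ≤ ρ := by
  have hi' := Finset.mem_Icc.1 hi
  have hn : (0 : ℝ) < n := by exact_mod_cast (by omega : 0 < n)
  have hnb : 0 < n * b := by positivity
  have hi1 : (0 : ℝ) < i := by exact_mod_cast (by omega : 0 < i)
  have hin : (i : ℝ) ≤ n := by exact_mod_cast hi'.2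
  have hu : ∀ j : ℕ, (design n j - design n i) / b = ((j : ℝ) - i) / (n * b) := by
    intro j; unfold design; field_simp
  have hnb2 : n * b ≤ n / 2 := by nlinarith
  -- Blocks are taken on the side with the longer stretch of data. As `b ≤ 1/2`, a full half-window
  -- fits there, so points near the boundary need no separate treatment.
  rcases le_or_gt (2 * (i : ℝ)) n with h | h
  · refine ⟨1, by simp, fun u hu1 hu2 => ?_⟩
    obtain ⟨l, hl, hj⟩ := exists_full_block (n := n) hm (a := i + (u - ρ) * (n * b))
      (by nlinarith) (by nlinarith)
    refine ⟨l, hl, fun j hjl => ?_⟩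
    obtain ⟨h1, h2⟩ := hj j hjl
    rw [hu, abs_le, one_mul]
    constructor
    · have : u - ρ ≤ ((j : ℝ) - i) / (n * b) := by rw [le_div_iff₀ hnb]; linarith
      linarith
    · have : ((j : ℝ) - i) / (n * b) ≤ u + ρ := by rw [div_le_iff₀ hnb]; nlinarith
      linarith
  · refine ⟨-1, by simp, fun u hu1 hu2 => ?_⟩
    obtain ⟨l, hl, hj⟩ := exists_full_block (n := n) hm (a := i - (u + ρ) * (n * b))
      (by nlinarith) (by nlinarith)
    refine ⟨l, hl, fun j hjl => ?_⟩
    obtain ⟨h1, h2⟩ := hj j hjl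
    rw [hu, abs_le, neg_one_mul]
    constructor
    · have : -(u + ρ) ≤ ((j : ℝ) - i) / (n * b) := by rw [le_div_iff₀ hnb]; linarith
      linarith
    · have : ((j : ℝ) - i) / (n * b) ≤ -u + ρ := by rw [div_le_iff₀ hnb]; nlinarith
      linarith

/-- An affine function is determined, stably, by its values at two distinct points. -/
theorem sq_add_sq_le_of_two_points {σ u₁ u₂ : ℝ} (hσ : σ ^ 2 = 1) (hd : 0 < u₂ - u₁)
    (h0 : 0 ≤ u₁) (h1 : u₁ ≤ 1) (p q : ℝ) :
    p ^ 2 + q ^ 2 ≤ (2 + 6 / (u₂ - u₁) ^ 2) * ((p + σ * u₁ * q) ^ 2 + (p + σ * u₂ * q) ^ 2) := by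
  have hq : ((p + σ * u₂ * q) - (p + σ * u₁ * q)) ^ 2 = (u₂ - u₁) ^ 2 * q ^ 2 := by
    linear_combination (u₂ - u₁) ^ 2 * q ^ 2 * hσ
  have hp : (σ * u₁ * q) ^ 2 ≤ q ^ 2 := by
    rw [mul_pow, mul_pow, hσ, one_mul]
    nlinarith [sq_nonneg q, pow_le_one₀ h0 h1 (n := 2)]
  set A := p + σ * u₁ * q with hA
  set B := p + σ * u₂ * q
  have h2 : q ^ 2 ≤ 2 / (u₂ - u₁) ^ 2 * (A ^ 2 + B ^ 2) := by
    rw [div_mul_eq_mul_div, le_div_iff₀ (by positivity)]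
    nlinarith [sq_nonneg (A + B)]
  have h3 : p ^ 2 ≤ 2 * A ^ 2 + 2 * q ^ 2 := by
    have : p = A - σ * u₁ * q := by rw [hA]; ring
    rw [this]
    nlinarith [sq_nonneg (A + σ * u₁ * q)]
  have h5 : (2 + 6 / (u₂ - u₁) ^ 2) * (A ^ 2 + B ^ 2) =
      2 * (A ^ 2 + B ^ 2) + 3 * (2 / (u₂ - u₁) ^ 2 * (A ^ 2 + B ^ 2)) := by ring
  rw [h5]
  linarith [sq_nonneg B]

/-- On a block near relative distance `σ u`, the linear form is `x_j ⬝ (η₀ + σ u η₁)` up to an error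
`ρ |x_j| |η₁|`. The block lower bound controls `|η₀ + σ u η₁|²`; the values at `u₁` and `u₂`
together control `η₀` and `η₁`, and a small `ρ` lets the error be absorbed. -/
theorem gramCoercive_of_blocks (hK : IsKernel K) {κ u₁ u₂ ρ c C : ℝ} (hκ : 0 < κ) (hρ : 0 < ρ)
    (hu1 : ρ < u₁) (hu2 : u₂ + ρ ≤ 1) (hd : 2 * ρ < u₂ - u₁)
    (hKκ : ∀ u, u₁ - ρ ≤ |u| → |u| ≤ u₂ + ρ → κ ≤ K u)
    (hc : 0 < c) (hρC : 2 * ρ ^ 2 * C * (2 + 6 / (u₂ - u₁) ^ 2) ≤ c / 4)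
    (hm : 0 < m) (hb : 0 < b) (hb2 : b ≤ 1 / 2) (hmρ : m ≤ ρ * (n * b))
    (hup : ∀ l, ∑ j ∈ blockOf n m l, x j ⬝ᵥ x j ≤ C * m)
    (hlow : ∀ l, (blockOf n m l).card = m → ∀ v, c * m * (v ⬝ᵥ v) ≤
      ∑ j ∈ blockOf n m l, (x j ⬝ᵥ v) ^ 2)
    (hi : i ∈ Finset.Icc 1 n) :
    GramCoercive K b n x i (κ * m * (c / (4 * (2 + 6 / (u₂ - u₁) ^ 2)))) := by
  intro η
  set η₀ : ι → ℝ := fun a => η (Sum.inl a) with hη₀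
  set η₁ : ι → ℝ := fun a => η (Sum.inr a) with hη₁
  set Q := 2 + 6 / (u₂ - u₁) ^ 2 with hQ
  have hd0 : 0 < u₂ - u₁ := by linarith
  have hQ0 : 0 < Q := by positivity
  obtain ⟨σ, hσ, hblk⟩ := exists_block_near hm hi hb hb2 hmρ
  have hσ2 : σ ^ 2 = 1 := by rw [← sq_abs, hσ, one_pow]
  have hm' : (0 : ℝ) < m := by exact_mod_cast hm
  have hone : ∀ u, u₁ ≤ u → u ≤ u₂ → ∃ l,
      (∀ j ∈ blockOf n m l, |(design n j - design n i) / b - σ * u| ≤ ρ) ∧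
      κ * (c / 2 * m * ((η₀ + (σ * u) • η₁) ⬝ᵥ (η₀ + (σ * u) • η₁)) - ρ ^ 2 * (C * m) * (η₁ ⬝ᵥ η₁)) ≤
        ∑ j ∈ blockOf n m l, kernelWeight K b n i j * (localDesign b n x i j ⬝ᵥ η) ^ 2 := by
    intro u hul huu
    obtain ⟨l, hcard, hl⟩ := hblk u (by linarith) (by linarith)
    refine ⟨l, hl, ?_⟩
    have hterm : ∀ j ∈ blockOf n m l,
        κ * (1 / 2 * (x j ⬝ᵥ (η₀ + (σ * u) • η₁)) ^ 2 - ρ ^ 2 * (x j ⬝ᵥ x j) * (η₁ ⬝ᵥ η₁)) ≤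
          kernelWeight K b n i j * (localDesign b n x i j ⬝ᵥ η) ^ 2 := by
      intro j hj
      set w := (design n j - design n i) / b with hw
      have hwσ := hl j hj
      have hw1 : |(|w| - u)| ≤ ρ := by
        have h1 : |σ * u| = u := by rw [abs_mul, hσ, one_mul, abs_of_pos (by linarith)]
        have h2 := abs_abs_sub_abs_le w (σ * u)
        rw [h1] at h2
        exact h2.trans hwσ
      rw [abs_le] at hw1
      have hk : κ ≤ kernelWeight K b n i j := hKκ w (by linarith [hw1.1]) (by linarith [hw1.2])
      have hlin : localDesign b n x i j ⬝ᵥ η =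
          x j ⬝ᵥ (η₀ + (σ * u) • η₁) + (w - σ * u) * (x j ⬝ᵥ η₁) := by
        rw [localDesign_dotProduct, dotProduct_add, dotProduct_smul, smul_eq_mul]
        ring
      have hcs := dotProduct_sq_le (x j) η₁
      have he : (w - σ * u) ^ 2 ≤ ρ ^ 2 := sq_le_sq' (by linarith [(abs_le.1 hwσ).1])
        (abs_le.1 hwσ).2
      have h1 : ((w - σ * u) * (x j ⬝ᵥ η₁)) ^ 2 ≤ ρ ^ 2 * (x j ⬝ᵥ x j) * (η₁ ⬝ᵥ η₁) := by
        rw [mul_pow, mul_assoc]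
        exact mul_le_mul he hcs (sq_nonneg _) (sq_nonneg _)
      -- `(a + e)² ≥ a² / 2 - e²`.
      have h2 : 1 / 2 * (x j ⬝ᵥ (η₀ + (σ * u) • η₁)) ^ 2 - ρ ^ 2 * (x j ⬝ᵥ x j) * (η₁ ⬝ᵥ η₁) ≤
          (localDesign b n x i j ⬝ᵥ η) ^ 2 := by
        rw [hlin]
        nlinarith [sq_nonneg (x j ⬝ᵥ (η₀ + (σ * u) • η₁) + 2 * ((w - σ * u) * (x j ⬝ᵥ η₁)))]
      calc _ ≤ κ * (localDesign b n x i j ⬝ᵥ η) ^ 2 := by gcongr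
        _ ≤ _ := by gcongr
    refine le_trans ?_ (Finset.sum_le_sum hterm)
    rw [← Finset.mul_sum, Finset.sum_sub_distrib, ← Finset.mul_sum, ← Finset.sum_mul,
      ← Finset.mul_sum]
    have h1 := hlow l hcard (η₀ + (σ * u) • η₁)
    have h2 : ρ ^ 2 * (∑ j ∈ blockOf n m l, x j ⬝ᵥ x j) * (η₁ ⬝ᵥ η₁) ≤
        ρ ^ 2 * (C * m) * (η₁ ⬝ᵥ η₁) := by
      have := dotProduct_self_nonneg_real η₁
      gcongr
      exact hup l
    refine mul_le_mul_of_nonneg_left ?_ hκ.le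
    linarith
  obtain ⟨l₁, hl₁, hs₁⟩ := hone u₁ le_rfl (by linarith)
  obtain ⟨l₂, hl₂, hs₂⟩ := hone u₂ (by linarith) le_rfl
  -- The two blocks stay within `ρ` of centres more than `2 ρ` apart.
  have hdisj : Disjoint (blockOf n m l₁) (blockOf n m l₂) := by
    rw [Finset.disjoint_left]
    intro j h1 h2
    have h3 := abs_sub_le (σ * u₂) ((design n j - design n i) / b) (σ * u₁)
    rw [← mul_sub, abs_mul, hσ, one_mul, abs_of_pos hd0, abs_sub_comm (σ * u₂)] at h3
    linarith [hl₁ j h1, hl₂ j h2]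
  have hsum : ∑ j ∈ blockOf n m l₁, kernelWeight K b n i j * (localDesign b n x i j ⬝ᵥ η) ^ 2 +
      ∑ j ∈ blockOf n m l₂, kernelWeight K b n i j * (localDesign b n x i j ⬝ᵥ η) ^ 2 ≤
      ∑ j ∈ Finset.Icc 1 n, kernelWeight K b n i j * (localDesign b n x i j ⬝ᵥ η) ^ 2 := by
    rw [← Finset.sum_union hdisj]
    exact Finset.sum_le_sum_of_subset_of_nonneg
      (Finset.union_subset (blockOf_subset _) (blockOf_subset _))
      fun j _ _ => mul_nonneg (hK.nonneg _) (sq_nonneg _)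
  have hη : η ⬝ᵥ η = η₀ ⬝ᵥ η₀ + η₁ ⬝ᵥ η₁ := by
    simp [dotProduct, hη₀, hη₁]
  have hQle : η₀ ⬝ᵥ η₀ + η₁ ⬝ᵥ η₁ ≤ Q * ((η₀ + (σ * u₁) • η₁) ⬝ᵥ (η₀ + (σ * u₁) • η₁) +
      (η₀ + (σ * u₂) • η₁) ⬝ᵥ (η₀ + (σ * u₂) • η₁)) := by
    simp only [dotProduct, ← Finset.sum_add_distrib, Finset.mul_sum]
    refine Finset.sum_le_sum fun a _ => ?_
    simp only [Pi.add_apply, Pi.smul_apply, smul_eq_mul]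
    have := sq_add_sq_le_of_two_points hσ2 hd0 (by linarith) (by linarith) (η₀ a) (η₁ a)
    simp only [← sq]
    exact this
  refine le_trans ?_ hsum
  refine le_trans ?_ (add_le_add hs₁ hs₂)
  set N := η₀ ⬝ᵥ η₀ + η₁ ⬝ᵥ η₁ with hN
  set w := (η₀ + (σ * u₁) • η₁) ⬝ᵥ (η₀ + (σ * u₁) • η₁) +
      (η₀ + (σ * u₂) • η₁) ⬝ᵥ (η₀ + (σ * u₂) • η₁) with hw
  have hN1 : η₁ ⬝ᵥ η₁ ≤ N := by linarith [dotProduct_self_nonneg_real η₀]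
  have hN0 : 0 ≤ N := by
    linarith [dotProduct_self_nonneg_real η₀, dotProduct_self_nonneg_real η₁]
  have hfin : c / (4 * Q) * N ≤ c / 2 * w - 2 * ρ ^ 2 * C * (η₁ ⬝ᵥ η₁) := by
    have h1 : c / 2 * (N / Q) ≤ c / 2 * w := by
      gcongr
      rw [div_le_iff₀ hQ0]
      linarith
    have h2 : 2 * ρ ^ 2 * C * (η₁ ⬝ᵥ η₁) ≤ c / 4 / Q * N := by
      have h3 : 2 * ρ ^ 2 * C ≤ c / 4 / Q := by rw [le_div_iff₀ hQ0]; exact hρC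
      exact mul_le_mul h3 hN1 (dotProduct_self_nonneg_real _) (by positivity)
    have h3 : c / (4 * Q) * N = c / 2 * (N / Q) - c / 4 / Q * N := by field_simp; ring
    linarith
  rw [hη]
  calc κ * m * (c / (4 * Q)) * N = κ * m * (c / (4 * Q) * N) := by ring
    _ ≤ κ * m * (c / 2 * w - 2 * ρ ^ 2 * C * (η₁ ⬝ᵥ η₁)) := by gcongr
    _ = _ := by rw [hw]; ring

end Coercive

/-! ### Residual operators of a smoother -/

noncomputable section

/-- The residuals `(I - S) y`. -/
def resid (n : ℕ) (S : ℕ → ℕ → ℝ) (y : ℕ → ℝ) (i : ℕ) : ℝ :=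
  y i - ∑ j ∈ Finset.Icc 1 n, S i j * y j

/-- The adjoint `(I - S)ᵀ w`. -/
def residAdjoint (n : ℕ) (S : ℕ → ℕ → ℝ) (w : ℕ → ℝ) (j : ℕ) : ℝ :=
  w j - ∑ i ∈ Finset.Icc 1 n, S i j * w i

end

/-- Size conditions on a smoother with bandwidth `b` for regressors of norm `r`. -/
structure SmootherBounds (n : ℕ) (b : ℝ) (r : ℕ → ℝ) (S : ℕ → ℕ → ℝ) (A : ℝ) : Prop where
  A_nonneg : 0 ≤ A
  b_pos : 0 < b
  n_pos : 0 < n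
  r_nonneg : ∀ i, 0 ≤ r i
  abs_le : ∀ i ∈ Finset.Icc 1 n, ∀ j, |S i j| ≤ A / (n * b) * (r i * r j)
  eq_zero : ∀ i j, b < |design n j - design n i| → S i j = 0
  near : ∀ i ∈ Finset.Icc 1 n,
    ∑ j ∈ Finset.Icc 1 n with |design n j - design n i| ≤ b, r j ^ 2 ≤ A * (n * b)
  total : ∑ i ∈ Finset.Icc 1 n, r i ^ 2 ≤ A * n

section Residuals

variable {n : ℕ} {b A : ℝ} {r : ℕ → ℝ} {S : ℕ → ℕ → ℝ}

theorem sum_resid_mul_resid (u v : ℕ → ℝ) :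
    ∑ i ∈ Finset.Icc 1 n, resid n S u i * resid n S v i =
      ∑ i ∈ Finset.Icc 1 n, u i * residAdjoint n S (resid n S v) i := by
  have h1 : ∑ i ∈ Finset.Icc 1 n, (∑ j ∈ Finset.Icc 1 n, S i j * u j) * resid n S v i =
      ∑ i ∈ Finset.Icc 1 n, u i * ∑ j ∈ Finset.Icc 1 n, S j i * resid n S v j := by
    simp only [Finset.sum_mul, Finset.mul_sum]
    rw [Finset.sum_comm]
    exact Finset.sum_congr rfl fun i _ => Finset.sum_congr rfl fun j _ => by ring
  calc _ = ∑ i ∈ Finset.Icc 1 n, (u i * resid n S v i -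
        (∑ j ∈ Finset.Icc 1 n, S i j * u j) * resid n S v i) :=
        Finset.sum_congr rfl fun i _ => by rw [resid, sub_mul]
    _ = _ := by
        rw [Finset.sum_sub_distrib, h1, ← Finset.sum_sub_distrib]
        exact Finset.sum_congr rfl fun i _ => by rw [residAdjoint, mul_sub]

theorem resid_add (u v : ℕ → ℝ) (i : ℕ) : resid n S (u + v) i = resid n S u i + resid n S v i := by
  simp only [resid, Pi.add_apply, mul_add, Finset.sum_add_distrib]
  ring

theorem resid_sub (u v : ℕ → ℝ) (i : ℕ) : resid n S (u - v) i = resid n S u i - resid n S v i := by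
  simp only [resid, Pi.sub_apply, mul_sub, Finset.sum_sub_distrib]
  ring

theorem resid_sum {q : ℕ} (h : Fin q → ℝ) (z : Fin q → ℕ → ℝ) (i : ℕ) :
    resid n S (fun j => ∑ l, h l * z l j) i = ∑ l, h l * resid n S (z l) i := by
  simp only [resid, mul_sub, Finset.sum_sub_distrib, Finset.mul_sum]
  rw [Finset.sum_comm]
  congr 1
  exact Finset.sum_congr rfl fun j _ => Finset.sum_congr rfl fun l _ => by ring

theorem SmootherBounds.nb_pos (hS : SmootherBounds n b r S A) : 0 < n * b :=
  mul_pos (by exact_mod_cast hS.n_pos) hS.b_pos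

/-- A weighted Schur test: the kernel is at most `r_i r_j A / (n b)`, and the window sum of `r_j²`
is at most `A n b`. Domination by a multiple of `r` is thus preserved, which replaces any uniform
bound on the regressors. -/
theorem SmootherBounds.abs_sum_mul_le (hS : SmootherBounds n b r S A) {y : ℕ → ℝ} {τ : ℝ}
    (hτ : 0 ≤ τ) {i : ℕ} (hi : i ∈ Finset.Icc 1 n)
    (hy : ∀ j ∈ Finset.Icc 1 n, |design n j - design n i| ≤ b → |y j| ≤ τ * r j) :
    |∑ j ∈ Finset.Icc 1 n, S i j * y j| ≤ A ^ 2 * τ * r i := by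
  have hnb := hS.nb_pos
  have hA := hS.A_nonneg
  have hri := hS.r_nonneg i
  have h1 : ∑ j ∈ Finset.Icc 1 n, S i j * y j =
      ∑ j ∈ Finset.Icc 1 n with |design n j - design n i| ≤ b, S i j * y j := by
    rw [Finset.sum_filter]
    refine Finset.sum_congr rfl fun j _ => ?_
    split_ifs with h
    · rfl
    · rw [hS.eq_zero i j (not_le.1 h), zero_mul]
  rw [h1]
  refine (Finset.abs_sum_le_sum_abs _ _).trans ?_
  calc _ ≤ ∑ j ∈ Finset.Icc 1 n with |design n j - design n i| ≤ b,
        A / (n * b) * τ * r i * r j ^ 2 := by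
        refine Finset.sum_le_sum fun j hj => ?_
        rw [Finset.mem_filter] at hj
        have hrj := hS.r_nonneg j
        rw [abs_mul]
        calc _ ≤ A / (n * b) * (r i * r j) * (τ * r j) :=
              mul_le_mul (hS.abs_le i hi j) (hy j hj.1 hj.2) (abs_nonneg _) (by positivity)
          _ = _ := by ring
    _ = A / (n * b) * τ * r i *
        ∑ j ∈ Finset.Icc 1 n with |design n j - design n i| ≤ b, r j ^ 2 := by
        rw [Finset.mul_sum]
    _ ≤ A / (n * b) * τ * r i * (A * (n * b)) := by
        gcongr
        exact hS.near i hi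
    _ = A ^ 2 * τ * r i := by
        generalize (n : ℝ) * b = m at hnb
        field_simp

/-- The same test for the transpose; both the size bound and the window are symmetric in the two
indices. -/
theorem SmootherBounds.abs_sum_mul_le' (hS : SmootherBounds n b r S A) {y : ℕ → ℝ} {τ : ℝ}
    (hτ : 0 ≤ τ) {j : ℕ} (hj : j ∈ Finset.Icc 1 n)
    (hy : ∀ i ∈ Finset.Icc 1 n, |y i| ≤ τ * r i) :
    |∑ i ∈ Finset.Icc 1 n, S i j * y i| ≤ A ^ 2 * τ * r j := by
  have hnb := hS.nb_pos
  have hA := hS.A_nonneg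
  have hrj := hS.r_nonneg j
  have h1 : ∑ i ∈ Finset.Icc 1 n, S i j * y i =
      ∑ i ∈ Finset.Icc 1 n with |design n i - design n j| ≤ b, S i j * y i := by
    rw [Finset.sum_filter]
    refine Finset.sum_congr rfl fun i _ => ?_
    split_ifs with h
    · rfl
    · rw [hS.eq_zero i j (by rw [abs_sub_comm]; exact not_le.1 h), zero_mul]
  rw [h1]
  refine (Finset.abs_sum_le_sum_abs _ _).trans ?_
  calc _ ≤ ∑ i ∈ Finset.Icc 1 n with |design n i - design n j| ≤ b,
        A / (n * b) * τ * r j * r i ^ 2 := by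
        refine Finset.sum_le_sum fun i hi => ?_
        rw [Finset.mem_filter] at hi
        have hri := hS.r_nonneg i
        rw [abs_mul]
        calc _ ≤ A / (n * b) * (r i * r j) * (τ * r i) :=
              mul_le_mul (hS.abs_le i hi.1 j) (hy i hi.1) (abs_nonneg _) (by positivity)
          _ = _ := by ring
    _ = A / (n * b) * τ * r j *
        ∑ i ∈ Finset.Icc 1 n with |design n i - design n j| ≤ b, r i ^ 2 := by
        rw [Finset.mul_sum]
    _ ≤ A / (n * b) * τ * r j * (A * (n * b)) := by
        gcongr
        exact hS.near j hj
    _ = A ^ 2 * τ * r j := by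
        generalize (n : ℝ) * b = m at hnb
        field_simp

theorem SmootherBounds.sum_sq_le (hS : SmootherBounds n b r S A) {j : ℕ}
    (hj : j ∈ Finset.Icc 1 n) :
    ∑ i ∈ Finset.Icc 1 n, S i j ^ 2 ≤ A ^ 3 / (n * b) * r j ^ 2 := by
  have hnb := hS.nb_pos
  have hA := hS.A_nonneg
  have h1 : ∑ i ∈ Finset.Icc 1 n, S i j ^ 2 =
      ∑ i ∈ Finset.Icc 1 n with |design n i - design n j| ≤ b, S i j ^ 2 := by
    rw [Finset.sum_filter]
    refine Finset.sum_congr rfl fun i _ => ?_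
    split_ifs with h
    · rfl
    · rw [hS.eq_zero i j (by rw [abs_sub_comm]; exact not_le.1 h), sq, zero_mul]
  rw [h1]
  calc _ ≤ ∑ i ∈ Finset.Icc 1 n with |design n i - design n j| ≤ b,
        (A / (n * b)) ^ 2 * r j ^ 2 * r i ^ 2 := by
        refine Finset.sum_le_sum fun i hi => ?_
        rw [Finset.mem_filter] at hi
        rw [← sq_abs]
        calc _ ≤ (A / (n * b) * (r i * r j)) ^ 2 :=
              pow_le_pow_left₀ (abs_nonneg _) (hS.abs_le i hi.1 j) 2
          _ = _ := by ring
    _ = (A / (n * b)) ^ 2 * r j ^ 2 *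
        ∑ i ∈ Finset.Icc 1 n with |design n i - design n j| ≤ b, r i ^ 2 := by
        rw [Finset.mul_sum]
    _ ≤ (A / (n * b)) ^ 2 * r j ^ 2 * (A * (n * b)) := by
        gcongr
        exact hS.near j hj
    _ = _ := by field_simp

theorem SmootherBounds.abs_resid_le (hS : SmootherBounds n b r S A) {y : ℕ → ℝ} {τ : ℝ}
    (hτ : 0 ≤ τ) (hy : ∀ j ∈ Finset.Icc 1 n, |y j| ≤ τ * r j) {i : ℕ} (hi : i ∈ Finset.Icc 1 n) :
    |resid n S y i| ≤ (1 + A ^ 2) * τ * r i := by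
  have h1 := hS.abs_sum_mul_le hτ hi fun j hj _ => hy j hj
  have h2 := hy i hi
  have h3 := abs_sub (y i) (∑ j ∈ Finset.Icc 1 n, S i j * y j)
  unfold resid
  linarith

theorem SmootherBounds.abs_residAdjoint_resid_le (hS : SmootherBounds n b r S A) {y : ℕ → ℝ}
    {τ : ℝ} (hτ : 0 ≤ τ) (hy : ∀ j ∈ Finset.Icc 1 n, |y j| ≤ τ * r j) {i : ℕ}
    (hi : i ∈ Finset.Icc 1 n) :
    |residAdjoint n S (resid n S y) i| ≤ (1 + A ^ 2) ^ 2 * τ * r i := by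
  have h0 : ∀ j ∈ Finset.Icc 1 n, |resid n S y j| ≤ (1 + A ^ 2) * τ * r j := fun j hj =>
    hS.abs_resid_le hτ hy hj
  have h1 := hS.abs_sum_mul_le' (by positivity) hi h0
  have h2 := h0 i hi
  have h3 := abs_sub (resid n S y i) (∑ j ∈ Finset.Icc 1 n, S j i * resid n S y j)
  unfold residAdjoint
  have : (1 + A ^ 2) ^ 2 * τ * r i = (1 + A ^ 2) * τ * r i + A ^ 2 * ((1 + A ^ 2) * τ) * r i := by
    ring
  linarith

/-- Effect on the residual sum of squares of a perturbation `d = ∑ h_l z_l + d'` of the responses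
`ℓ + e`. -/
theorem SmootherBounds.abs_sum_resid_sq_sub_le (hS : SmootherBounds n b r S A) {q : ℕ}
    {ℓ e d' : ℕ → ℝ} {h : Fin q → ℝ} {z : Fin q → ℕ → ℝ} {B L τ : ℝ} (hB : 0 ≤ B) (hL : 0 ≤ L)
    (hτ : 0 ≤ τ) (hτ1 : τ ≤ 1) (hh : ∀ l, |h l| ≤ τ)
    (hℓ : ∀ i ∈ Finset.Icc 1 n, |resid n S ℓ i| ≤ B * r i)
    (hz : ∀ l, ∀ i ∈ Finset.Icc 1 n, |z l i| ≤ L * r i)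
    (hd' : ∀ i ∈ Finset.Icc 1 n, |d' i| ≤ L * τ ^ 2 * r i) :
    |∑ i ∈ Finset.Icc 1 n, resid n S (ℓ + e - ((fun j => ∑ l, h l * z l j) + d')) i ^ 2 -
      ∑ i ∈ Finset.Icc 1 n, resid n S (ℓ + e) i ^ 2| ≤
      2 * (B * ((1 + A ^ 2) * (L * (q + 1) * τ)) * (A * n)) +
      2 * ((1 + A ^ 2) ^ 2 * (L * τ ^ 2) * ∑ i ∈ Finset.Icc 1 n, r i * |e i|) +
      2 * (τ * ∑ l, |∑ i ∈ Finset.Icc 1 n, e i * residAdjoint n S (resid n S (z l)) i|) +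
      ((1 + A ^ 2) * (L * (q + 1) * τ)) ^ 2 * (A * n) := by
  have hA := hS.A_nonneg
  set D := 1 + A ^ 2 with hD
  set d : ℕ → ℝ := (fun j => ∑ l, h l * z l j) + d' with hd
  have hdle : ∀ i ∈ Finset.Icc 1 n, |d i| ≤ L * (q + 1) * τ * r i := by
    intro i hi
    have hri := hS.r_nonneg i
    have h1 : |∑ l, h l * z l i| ≤ q * (τ * (L * r i)) := by
      refine (Finset.abs_sum_le_sum_abs _ _).trans ?_
      have : ∀ l ∈ (Finset.univ : Finset (Fin q)), |h l * z l i| ≤ τ * (L * r i) := fun l _ => by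
        rw [abs_mul]
        exact mul_le_mul (hh l) (hz l i hi) (abs_nonneg _) hτ
      simpa using Finset.sum_le_card_nsmul _ _ _ this
    -- Since `τ ≤ 1`, the quadratic remainder counts as one more first-order term, whence the factor
    -- `q + 1`.
    have h2 : L * τ ^ 2 * r i ≤ L * τ * r i := by
      gcongr
      nlinarith
    have h3 := abs_add_le (∑ l, h l * z l i) (d' i)
    have h4 := hd' i hi
    simp only [hd, Pi.add_apply]
    nlinarith
  have hrd : ∀ i ∈ Finset.Icc 1 n, |resid n S d i| ≤ D * (L * (q + 1) * τ) * r i :=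
    fun i hi => hS.abs_resid_le (by positivity) hdle hi
  -- In the cross term with `e`, the coefficients `h l` are pulled out of the sums: they may depend
  -- on the errors, whereas the scores may not. The remainder `d'` may depend on them too, so it is
  -- only bounded in absolute value.
  have hexp : ∑ i ∈ Finset.Icc 1 n, resid n S (ℓ + e - d) i ^ 2 -
      ∑ i ∈ Finset.Icc 1 n, resid n S (ℓ + e) i ^ 2 =
      -2 * ∑ i ∈ Finset.Icc 1 n, resid n S ℓ i * resid n S d i +
      -2 * ∑ i ∈ Finset.Icc 1 n, resid n S e i * resid n S d' i +
      -2 * ∑ l, h l * ∑ i ∈ Finset.Icc 1 n, resid n S e i * resid n S (z l) i +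
      ∑ i ∈ Finset.Icc 1 n, resid n S d i ^ 2 := by
    have h1 : ∑ l, h l * ∑ i ∈ Finset.Icc 1 n, resid n S e i * resid n S (z l) i =
        ∑ i ∈ Finset.Icc 1 n, resid n S e i * resid n S (fun j => ∑ l, h l * z l j) i := by
      simp only [resid_sum, Finset.mul_sum]
      rw [Finset.sum_comm]
      exact Finset.sum_congr rfl fun i _ => Finset.sum_congr rfl fun l _ => by ring
    rw [h1, Finset.mul_sum, Finset.mul_sum, Finset.mul_sum, ← Finset.sum_sub_distrib,
      ← Finset.sum_add_distrib, ← Finset.sum_add_distrib, ← Finset.sum_add_distrib]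
    refine Finset.sum_congr rfl fun i _ => ?_
    rw [resid_sub, hd, resid_add, resid_add]
    ring
  rw [hexp]
  have t1 : |∑ i ∈ Finset.Icc 1 n, resid n S ℓ i * resid n S d i| ≤
      B * (D * (L * (q + 1) * τ)) * (A * n) := by
    refine (Finset.abs_sum_le_sum_abs _ _).trans ?_
    calc _ ≤ ∑ i ∈ Finset.Icc 1 n, B * (D * (L * (q + 1) * τ)) * r i ^ 2 := by
          refine Finset.sum_le_sum fun i hi => ?_
          have hri := hS.r_nonneg i
          rw [abs_mul]
          calc _ ≤ (B * r i) * (D * (L * (q + 1) * τ) * r i) :=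
                mul_le_mul (hℓ i hi) (hrd i hi) (abs_nonneg _) (by positivity)
            _ = _ := by ring
      _ ≤ _ := by
          rw [← Finset.mul_sum]
          exact mul_le_mul_of_nonneg_left hS.total (by positivity)
  have t2 : |∑ i ∈ Finset.Icc 1 n, resid n S e i * resid n S d' i| ≤
      D ^ 2 * (L * τ ^ 2) * ∑ i ∈ Finset.Icc 1 n, r i * |e i| := by
    rw [sum_resid_mul_resid, Finset.mul_sum]
    refine (Finset.abs_sum_le_sum_abs _ _).trans (Finset.sum_le_sum fun i hi => ?_)
    have := hS.abs_residAdjoint_resid_le (τ := L * τ ^ 2) (by positivity) hd' hi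
    rw [abs_mul]
    calc _ ≤ |e i| * (D ^ 2 * (L * τ ^ 2) * r i) := by gcongr
      _ = _ := by ring
  have t3 : |∑ l, h l * ∑ i ∈ Finset.Icc 1 n, resid n S e i * resid n S (z l) i| ≤
      τ * ∑ l, |∑ i ∈ Finset.Icc 1 n, e i * residAdjoint n S (resid n S (z l)) i| := by
    rw [Finset.mul_sum]
    refine (Finset.abs_sum_le_sum_abs _ _).trans (Finset.sum_le_sum fun l _ => ?_)
    rw [abs_mul, sum_resid_mul_resid]
    gcongr
    exact hh l
  have t4 : ∑ i ∈ Finset.Icc 1 n, resid n S d i ^ 2 ≤ (D * (L * (q + 1) * τ)) ^ 2 * (A * n) := by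
    calc _ ≤ ∑ i ∈ Finset.Icc 1 n, (D * (L * (q + 1) * τ)) ^ 2 * r i ^ 2 := by
          refine Finset.sum_le_sum fun i hi => ?_
          rw [← sq_abs, ← mul_pow]
          exact pow_le_pow_left₀ (abs_nonneg _) (hrd i hi) 2
      _ ≤ _ := by
          rw [← Finset.mul_sum]
          exact mul_le_mul_of_nonneg_left hS.total (by positivity)
  have t5 : 0 ≤ ∑ i ∈ Finset.Icc 1 n, resid n S d i ^ 2 :=
    Finset.sum_nonneg fun _ _ => sq_nonneg _
  rw [_root_.abs_le] at t1 t2 t3 ⊢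
  constructor <;> linarith [t1.1, t1.2, t2.1, t2.2, t3.1, t3.2]

/-- The identity `e = (I - S)(ℓ + e) + S e - (I - S) ℓ` and `(a + b + c)² ≤ 3 (a² + b² + c²)`. -/
theorem SmootherBounds.sum_sq_le_sum_resid_sq (hS : SmootherBounds n b r S A) {ℓ e : ℕ → ℝ}
    {B : ℝ} (hℓ : ∀ i ∈ Finset.Icc 1 n, |resid n S ℓ i| ≤ B * r i) :
    ∑ i ∈ Finset.Icc 1 n, e i ^ 2 ≤ 3 * ∑ i ∈ Finset.Icc 1 n, resid n S (ℓ + e) i ^ 2 +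
      3 * ∑ i ∈ Finset.Icc 1 n, (∑ j ∈ Finset.Icc 1 n, S i j * e j) ^ 2 +
      3 * (B ^ 2 * (A * n)) := by
  have h1 : ∑ i ∈ Finset.Icc 1 n, resid n S ℓ i ^ 2 ≤ B ^ 2 * (A * n) := by
    calc _ ≤ ∑ i ∈ Finset.Icc 1 n, B ^ 2 * r i ^ 2 := by
          refine Finset.sum_le_sum fun i hi => ?_
          rw [← sq_abs, ← mul_pow]
          exact pow_le_pow_left₀ (abs_nonneg _) (hℓ i hi) 2
      _ ≤ _ := by
          rw [← Finset.mul_sum]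
          exact mul_le_mul_of_nonneg_left hS.total (by positivity)
  have h2 : ∑ i ∈ Finset.Icc 1 n, e i ^ 2 ≤ ∑ i ∈ Finset.Icc 1 n,
      (3 * resid n S (ℓ + e) i ^ 2 + 3 * (∑ j ∈ Finset.Icc 1 n, S i j * e j) ^ 2 +
        3 * resid n S ℓ i ^ 2) := by
    refine Finset.sum_le_sum fun i _ => ?_
    have h3 : e i = resid n S (ℓ + e) i + ∑ j ∈ Finset.Icc 1 n, S i j * e j - resid n S ℓ i := by
      rw [resid_add, resid, resid]; ring
    set p := resid n S (ℓ + e) i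
    set s := ∑ j ∈ Finset.Icc 1 n, S i j * e j
    set t := resid n S ℓ i
    rw [h3]
    nlinarith [sq_nonneg (p - s), sq_nonneg (p + t), sq_nonneg (s + t)]
  rw [Finset.sum_add_distrib, Finset.sum_add_distrib, ← Finset.mul_sum, ← Finset.mul_sum,
    ← Finset.mul_sum] at h2
  linarith

end Residuals

/-! ### Taylor expansions -/

/-- The one-sided derivative is Lipschitz on the compact interval, and the mean value inequality is
applied to the function minus its tangent at `s`. One constant serves all `s`, end points included.
-/
theorem exists_taylor_bound_Icc {f : ℝ → ℝ} (hf : ContDiffOn ℝ 2 f (Icc 0 1)) :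
    ∃ C : ℝ, 0 ≤ C ∧ ∀ s ∈ Icc (0 : ℝ) 1, ∃ d : ℝ, ∀ t ∈ Icc (0 : ℝ) 1,
      |f t - f s - d * (t - s)| ≤ C * (t - s) ^ 2 := by
  have hu : UniqueDiffOn ℝ (Icc (0 : ℝ) 1) := uniqueDiffOn_Icc one_pos
  set g := derivWithin f (Icc 0 1) with hg
  have hg1 : ContDiffOn ℝ 1 g (Icc 0 1) := hf.derivWithin hu (by norm_num)
  have hgc : ContinuousOn (derivWithin g (Icc 0 1)) (Icc 0 1) :=
    hg1.continuousOn_derivWithin hu le_rfl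
  obtain ⟨C, hC⟩ := isCompact_Icc.exists_bound_of_continuousOn hgc
  have hC0 : 0 ≤ C := (norm_nonneg _).trans (hC 0 (by simp))
  have hlip : ∀ s ∈ Icc (0 : ℝ) 1, ∀ t ∈ Icc (0 : ℝ) 1, ‖g t - g s‖ ≤ C * ‖t - s‖ :=
    fun s hs t ht => (convex_Icc (0 : ℝ) 1).norm_image_sub_le_of_norm_derivWithin_le
      (hg1.differentiableOn (by norm_num)) hC hs ht
  refine ⟨C, hC0, fun s hs => ⟨g s, fun t ht => ?_⟩⟩
  have hsub : uIcc s t ⊆ Icc 0 1 := (convex_Icc (0 : ℝ) 1).ordConnected.uIcc_subset hs ht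
  have hder : ∀ τ ∈ uIcc s t, HasDerivWithinAt (fun τ => f τ - g s * (τ - s)) (g τ - g s)
      (uIcc s t) τ := by
    intro τ hτ
    have h1 : HasDerivWithinAt f (g τ) (uIcc s t) τ :=
      ((hf.differentiableOn (by norm_num)) τ (hsub hτ)).hasDerivWithinAt.mono hsub
    have h2 : HasDerivWithinAt (fun τ => g s * (τ - s)) (g s) (uIcc s t) τ := by
      simpa using (((hasDerivAt_id τ).sub_const s).const_mul (g s)).hasDerivWithinAt
    exact h1.sub h2
  have hbd : ∀ τ ∈ uIcc s t, ‖g τ - g s‖ ≤ C * |t - s| := by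
    intro τ hτ
    refine (hlip s hs τ (hsub hτ)).trans ?_
    gcongr
    rw [Real.norm_eq_abs]
    exact abs_sub_left_of_mem_uIcc hτ
  have := (convex_uIcc s t).norm_image_sub_le_of_norm_hasDerivWithin_le hder hbd
    left_mem_uIcc right_mem_uIcc
  simp only [Real.norm_eq_abs, sub_self, mul_zero, sub_zero] at this
  calc |f t - f s - g s * (t - s)| = |f t - g s * (t - s) - f s| := by ring_nf
    _ ≤ C * |t - s| * |t - s| := this
    _ = C * (t - s) ^ 2 := by rw [mul_assoc, ← sq, sq_abs]

/-- The mean value inequality twice: on the ball for the derivative, then on the closed ball of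
radius `‖θ - θ₀‖` for the function. Balls supply the convexity that `Θ` may lack. -/
theorem norm_sub_sub_fderiv_le {E F : Type*} [NormedAddCommGroup E] [NormedSpace ℝ E]
    [NormedAddCommGroup F] [NormedSpace ℝ F] {f : E → F} {Θ : Set E} (hΘ : IsOpen Θ) {θ₀ : E}
    {ρ C : ℝ} (hball : Metric.ball θ₀ ρ ⊆ Θ) (hf : ContDiffOn ℝ 2 f Θ)
    (hC : ∀ θ ∈ Θ, ‖iteratedFDeriv ℝ 1 f θ‖ + ‖iteratedFDeriv ℝ 2 f θ‖ ≤ C) {θ : E}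
    (hθ : θ ∈ Metric.ball θ₀ ρ) :
    ‖f θ - f θ₀ - fderiv ℝ f θ₀ (θ - θ₀)‖ ≤ C * ‖θ - θ₀‖ ^ 2 := by
  have hρ : 0 < ρ := lt_of_le_of_lt dist_nonneg hθ
  have hdiff : ∀ x ∈ Θ, DifferentiableAt ℝ f x := fun x hx =>
    ((hf.contDiffAt (hΘ.mem_nhds hx)).differentiableAt (by norm_num))
  have hdiff2 : ∀ x ∈ Θ, DifferentiableAt ℝ (fderiv ℝ f) x := fun x hx =>
    ((hf.contDiffAt (hΘ.mem_nhds hx)).fderiv_right (m := 1) (by norm_num)).differentiableAt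
      (by norm_num)
  have hbd2 : ∀ x ∈ Θ, ‖fderiv ℝ (fderiv ℝ f) x‖ ≤ C := by
    intro x hx
    rw [← norm_iteratedFDeriv_one, norm_iteratedFDeriv_fderiv]
    exact (le_add_of_nonneg_left (norm_nonneg _)).trans (hC x hx)
  have hC0 : 0 ≤ C := le_trans (by positivity) (hC θ₀ (hball (Metric.mem_ball_self hρ)))
  have hlip : ∀ x ∈ Metric.ball θ₀ ρ, ‖fderiv ℝ f x - fderiv ℝ f θ₀‖ ≤ C * ‖x - θ₀‖ :=
    fun x hx => (convex_ball θ₀ ρ).norm_image_sub_le_of_norm_fderiv_le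
      (fun y hy => hdiff2 y (hball hy)) (fun y hy => hbd2 y (hball hy))
      (Metric.mem_ball_self hρ) hx
  have hsub : Metric.closedBall θ₀ ‖θ - θ₀‖ ⊆ Metric.ball θ₀ ρ :=
    Metric.closedBall_subset_ball (by rwa [← dist_eq_norm])
  have := (convex_closedBall θ₀ ‖θ - θ₀‖).norm_image_sub_le_of_norm_fderiv_le'
    (φ := fderiv ℝ f θ₀) (C := C * ‖θ - θ₀‖) (fun y hy => hdiff y (hball (hsub hy)))
    (fun y hy => (hlip y (hsub hy)).trans (by
      gcongr
      rw [← dist_eq_norm]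
      exact hy))
    (Metric.mem_closedBall_self (norm_nonneg _))
    (show θ ∈ Metric.closedBall θ₀ ‖θ - θ₀‖ by rw [Metric.mem_closedBall, dist_eq_norm])
  calc _ ≤ C * ‖θ - θ₀‖ * ‖θ - θ₀‖ := this
    _ = _ := by ring

/-! ### Bias and size of the local linear smoother -/

theorem IsKernel.exists_le {K : ℝ → ℝ} (hK : IsKernel K) : ∃ C : ℝ, 0 < C ∧ ∀ u, K u ≤ C := by
  obtain ⟨C, hC⟩ := isCompact_Icc.exists_bound_of_continuousOn hK.smooth.continuousOn
  refine ⟨|C| + 1, by positivity, fun u => ?_⟩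
  by_cases hu : u ∈ Icc (-1 : ℝ) 1
  · have := (le_abs_self _).trans (hC u hu)
    linarith [le_abs_self C]
  · rw [hK.supp u hu]; positivity

section LocalLinear

variable {ι : Type*} [Fintype ι] [DecidableEq ι] {K : ℝ → ℝ}

/-- The smoother reproduces the linear expansion of `β` at `t_i`, so only the Taylor remainder is
left, of size `b²` inside the window. -/
theorem exists_bias_bound {β : ℝ → ι → ℝ} (hβ : ∀ a, ContDiffOn ℝ 2 (fun t => β t a) (Icc 0 1)) :
    ∃ C : ℝ, 0 ≤ C ∧ ∀ (n : ℕ) (b A : ℝ) (x : ℕ → ι → ℝ) (r : ℕ → ℝ),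
      SmootherBounds n b r (smoother K b n x) A → (∀ j, √(x j ⬝ᵥ x j) ≤ r j) →
      ∀ i ∈ Finset.Icc 1 n, ∀ κ, 0 < κ → GramCoercive K b n x i κ →
      |resid n (smoother K b n x) (fun j => x j ⬝ᵥ β (design n j)) i| ≤
        A ^ 2 * (C * b ^ 2) * r i := by
  choose C hC0 hC using fun a => exists_taylor_bound_Icc (hβ a)
  refine ⟨√(∑ a, C a ^ 2), Real.sqrt_nonneg _, fun n b A x r hS hr i hi κ hκ hG => ?_⟩
  choose! d hd using hC
  set s := design n i with hs
  have hsI := design_mem_Icc hi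
  set α₁ : ι → ℝ := fun a => d a s with hα₁
  set R : ℕ → ι → ℝ := fun j a =>
    β (design n j) a - β s a - d a s * (design n j - s) with hR
  have hdec : ∀ j, x j ⬝ᵥ β (design n j) =
      (x j ⬝ᵥ β s + (x j ⬝ᵥ α₁) * (design n j - s)) + x j ⬝ᵥ R j := by
    intro j
    simp only [dotProduct, Finset.sum_mul, ← Finset.sum_add_distrib]
    refine Finset.sum_congr rfl fun a _ => ?_
    simp only [hR, hα₁]
    ring
  have hres : resid n (smoother K b n x) (fun j => x j ⬝ᵥ β (design n j)) i =
      -∑ j ∈ Finset.Icc 1 n, smoother K b n x i j * (x j ⬝ᵥ R j) := by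
    have h1 := sum_smoother_mul_linear hG hκ hS.b_pos.ne' (β s) α₁
    have h2 : ∑ j ∈ Finset.Icc 1 n, smoother K b n x i j * (x j ⬝ᵥ β (design n j)) =
        x i ⬝ᵥ β s + ∑ j ∈ Finset.Icc 1 n, smoother K b n x i j * (x j ⬝ᵥ R j) := by
      rw [← h1, ← Finset.sum_add_distrib]
      refine Finset.sum_congr rfl fun j _ => ?_
      rw [hdec j, mul_add]
    rw [resid, h2]
    ring
  rw [hres, abs_neg]
  refine hS.abs_sum_mul_le (by positivity) hi fun j hj hnear => ?_
  have h1 : R j ⬝ᵥ R j ≤ (∑ a, C a ^ 2) * (b ^ 2) ^ 2 := by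
    rw [Finset.sum_mul]
    refine Finset.sum_le_sum fun a _ => ?_
    rw [← sq, ← sq_abs, ← mul_pow]
    refine pow_le_pow_left₀ (abs_nonneg _) ((hd a s hsI _ (design_mem_Icc hj)).trans ?_) 2
    have := hC0 a
    gcongr C a * ?_
    rw [← sq_abs]
    gcongr
  have h2 : √(R j ⬝ᵥ R j) ≤ √(∑ a, C a ^ 2) * b ^ 2 := by
    refine (Real.sqrt_le_sqrt h1).trans ?_
    rw [Real.sqrt_mul (Finset.sum_nonneg fun _ _ => sq_nonneg _), Real.sqrt_sq (sq_nonneg _)]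
  calc _ ≤ √(x j ⬝ᵥ x j) * √(R j ⬝ᵥ R j) := abs_dotProduct_le _ _
    _ ≤ r j * (√(∑ a, C a ^ 2) * b ^ 2) :=
        mul_le_mul (hr j) h2 (Real.sqrt_nonneg _) (hS.r_nonneg j)
    _ = _ := by ring

/-- Block averages control the local linear smoother. -/
theorem exists_smootherBounds_of_blocks (hK : IsKernel K) {c C : ℝ} (hc : 0 < c) (hC : 0 < C) :
    ∃ ρ A : ℝ, 0 < ρ ∧ 0 ≤ A ∧ ∀ (n : ℕ) (b : ℝ) (x : ℕ → ι → ℝ) (r : ℕ → ℝ), 0 < b → b ≤ 1 / 2 →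
      1 ≤ ρ * (n * b) → (∀ i, 0 ≤ r i) → (∀ j, x j ⬝ᵥ x j ≤ r j ^ 2) →
      (∀ l, ∑ j ∈ blockOf n ⌊ρ * (n * b)⌋₊ l, r j ^ 2 ≤ C * ⌊ρ * (n * b)⌋₊) →
      (∀ l, (blockOf n ⌊ρ * (n * b)⌋₊ l).card = ⌊ρ * (n * b)⌋₊ → ∀ v,
        c * ⌊ρ * (n * b)⌋₊ * (v ⬝ᵥ v) ≤ ∑ j ∈ blockOf n ⌊ρ * (n * b)⌋₊ l, (x j ⬝ᵥ v) ^ 2) →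
      SmootherBounds n b r (smoother K b n x) A ∧
        ∃ κ, 0 < κ ∧ ∀ i ∈ Finset.Icc 1 n, GramCoercive K b n x i κ := by
  obtain ⟨κ, u₁, u₂, ρ₀, hκ, hρ₀, hu1, hu2, hd, hKκ⟩ := hK.exists_pos
  obtain ⟨Km, hKm0, hKm⟩ := hK.exists_le
  set Q := 2 + 6 / (u₂ - u₁) ^ 2 with hQ
  have hQ0 : 0 < Q := by
    have : 0 < u₂ - u₁ := by linarith
    positivity
  -- Since `ρ² ≤ ρ`, the second entry gives `2 ρ² C Q ≤ c / 4`, the smallness that absorbs the slope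
  -- error within a block.
  set ρ := min ρ₀ (c / (8 * (C * Q))) with hρ
  have hρ0 : 0 < ρ := lt_min hρ₀ (by positivity)
  have hρρ₀ : ρ ≤ ρ₀ := min_le_left _ _
  have hρ1 : ρ ≤ 1 := by linarith
  have hρC : 2 * ρ ^ 2 * C * Q ≤ c / 4 := by
    have h1 : ρ ≤ c / (8 * (C * Q)) := min_le_right _ _
    rw [le_div_iff₀ (by positivity)] at h1
    have h2 : ρ ^ 2 ≤ ρ := by nlinarith
    have h3 : ρ ^ 2 * (C * Q) ≤ ρ * (C * Q) := by gcongr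
    linarith
  -- The first summand bounds the entries of the smoother through the coercivity constant, the
  -- second the window sums and the total sum.
  set A := 2 * Km / (κ * (ρ / 2) * (c / (4 * Q))) + 4 * C with hA
  refine ⟨ρ, A, hρ0, by positivity, fun n b x r hb hb2 hnb hr hxr hup hlow => ?_⟩
  set m := ⌊ρ * (n * b)⌋₊ with hm
  have hm0 : 0 < m := Nat.floor_pos.2 hnb
  have hn : 0 < n := by
    rcases Nat.eq_zero_or_pos n with h | h
    · subst h; norm_num at hnb
    · exact h
  have hn' : (0 : ℝ) < n := by exact_mod_cast hn
  have hnb0 : 0 < n * b := by positivity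
  have hmle : (m : ℝ) ≤ ρ * (n * b) := Nat.floor_le (by positivity)
  -- Rounding down a number that is at least one loses at most half of it.
  have hmge : ρ / 2 * (n * b) ≤ m := by
    have := Nat.lt_floor_add_one (ρ * (n * b))
    have h1 : (1 : ℝ) ≤ m := by exact_mod_cast hm0
    linarith
  have hmnb : (m : ℝ) ≤ n * b := hmle.trans (by nlinarith)
  have hmn : m ≤ n := by
    have : (m : ℝ) ≤ n := hmnb.trans (by nlinarith)
    exact_mod_cast this
  have hup' : ∀ l, ∑ j ∈ blockOf n m l, x j ⬝ᵥ x j ≤ C * m := fun l =>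
    (Finset.sum_le_sum fun j _ => hxr j).trans (hup l)
  set κ' := κ * m * (c / (4 * Q)) with hκ'
  have hκ'0 : 0 < κ' := by positivity
  have hG : ∀ i ∈ Finset.Icc 1 n, GramCoercive K b n x i κ' := fun i hi =>
    gramCoercive_of_blocks hK hκ hρ0 (by linarith) (by linarith) (by linarith)
      (fun u h1 h2 => hKκ u (by linarith) (by linarith)) hc hρC hm0 hb hb2 hmle hup' hlow hi
  have hA4 : 4 * C ≤ A := by
    have : 0 ≤ 2 * Km / (κ * (ρ / 2) * (c / (4 * Q))) := by positivity
    linarith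
  refine ⟨⟨by positivity, hb, hn, hr, fun i hi j => ?_, fun i j hij => smoother_eq_zero hK hb hij,
    fun i _ => ?_, ?_⟩, κ', hκ'0, hG⟩
  · refine (abs_smoother_le hK hKm hb (hG i hi) hκ'0 j).trans ?_
    have hs : ∀ j, √(x j ⬝ᵥ x j) ≤ r j := fun j => Real.sqrt_le_iff.2 ⟨hr j, hxr j⟩
    have h1 : 2 * Km / κ' ≤ A / (n * b) := by
      have h2 : κ * (ρ / 2) * (c / (4 * Q)) * (n * b) ≤ κ' := by
        calc _ = κ * (ρ / 2 * (n * b)) * (c / (4 * Q)) := by ring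
          _ ≤ _ := by rw [hκ']; gcongr
      calc 2 * Km / κ' ≤ 2 * Km / (κ * (ρ / 2) * (c / (4 * Q)) * (n * b)) := by gcongr
        _ = 2 * Km / (κ * (ρ / 2) * (c / (4 * Q))) / (n * b) := by rw [div_div]
        _ ≤ A / (n * b) := by gcongr; linarith
    have := hr i
    gcongr
    · exact hs i
    · exact hs j
  · refine (sum_near_le_of_blocks hm0 hb hmnb (fun j => sq_nonneg (r j)) hC.le hup i).trans ?_
    gcongr
  · refine (sum_le_of_blocks hmn (fun j => sq_nonneg (r j)) hC.le hup).trans ?_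
    gcongr
    linarith

end LocalLinear

/-! ### Consequences of the bandwidth condition -/

section Bandwidth

variable {b : ℕ → ℝ}

theorem BandwidthCondition.tendsto_mul_pow_four (hb : BandwidthCondition b) :
    Tendsto (fun n : ℕ => (n : ℝ) * b n ^ 4) atTop atTop := by
  refine tendsto_atTop_mono' atTop ?_ hb.lower
  have h : Tendsto (fun n : ℕ => Real.log n) atTop atTop :=
    Real.tendsto_log_atTop.comp tendsto_natCast_atTop_atTop
  filter_upwards [h.eventually_ge_atTop 1] with n hn
  have := hb.pos n
  exact div_le_self (by positivity) (one_le_pow₀ hn)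

theorem BandwidthCondition.tendsto_zero (hb : BandwidthCondition b) :
    Tendsto b atTop (𝓝 0) := by
  obtain ⟨C, hC⟩ := hb.upper
  have h1 : Tendsto (fun n : ℕ => b n ^ (9 / 2 : ℝ)) atTop (𝓝 0) := by
    refine tendsto_of_tendsto_of_tendsto_of_le_of_le' tendsto_const_nhds
      (tendsto_const_div_atTop_nhds_zero_nat C)
      (Eventually.of_forall fun n => Real.rpow_nonneg (hb.pos n).le _) ?_
    filter_upwards [hC, eventually_gt_atTop 0] with n hn hn0
    rw [le_div_iff₀ (by exact_mod_cast hn0), mul_comm]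
    exact hn
  have h2 := h1.rpow_const (p := 2 / 9) (Or.inr (by norm_num))
  rw [Real.zero_rpow (by norm_num)] at h2
  refine h2.congr fun n => ?_
  rw [← Real.rpow_mul (hb.pos n).le]
  norm_num

theorem BandwidthCondition.tendsto_mul_sq (hb : BandwidthCondition b) :
    Tendsto (fun n : ℕ => (n : ℝ) * b n ^ 2) atTop atTop := by
  refine tendsto_atTop_mono' atTop ?_ hb.tendsto_mul_pow_four
  filter_upwards [hb.tendsto_zero.eventually_le_const one_pos] with n hn
  gcongr ?_ * ?_
  exact pow_le_pow_of_le_one (hb.pos n).le hn (by norm_num)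

theorem BandwidthCondition.tendsto_mul (hb : BandwidthCondition b) :
    Tendsto (fun n : ℕ => (n : ℝ) * b n) atTop atTop := by
  refine tendsto_atTop_mono' atTop ?_ hb.tendsto_mul_sq
  filter_upwards [hb.tendsto_zero.eventually_le_const one_pos] with n hn
  gcongr ?_ * ?_
  exact pow_le_of_le_one (hb.pos n).le hn (by norm_num)

theorem BandwidthCondition.tendsto_sqrt_mul_sq (hb : BandwidthCondition b) :
    Tendsto (fun n : ℕ => √(n : ℝ) * b n ^ 2) atTop atTop := by
  refine (Real.tendsto_sqrt_atTop.comp hb.tendsto_mul_pow_four).congr fun n => ?_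
  rw [Function.comp_apply, Real.sqrt_mul (Nat.cast_nonneg n), show b n ^ 4 = (b n ^ 2) ^ 2 by ring,
    Real.sqrt_sq (sq_nonneg _)]

/-- `b⁵ = b^{9/2} √b`, where the first factor times `n` is bounded. The square root of `n b⁵` is the
order of the difference of the normalised statistics. -/
theorem BandwidthCondition.tendsto_mul_pow_five (hb : BandwidthCondition b) :
    Tendsto (fun n : ℕ => (n : ℝ) * b n ^ 5) atTop (𝓝 0) := by
  obtain ⟨C, hC⟩ := hb.upper
  have h2 := (hb.tendsto_zero.sqrt).const_mul C
  rw [Real.sqrt_zero, mul_zero] at h2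
  refine tendsto_of_tendsto_of_tendsto_of_le_of_le' tendsto_const_nhds h2
    (Eventually.of_forall fun n => ?_) ?_
  · have := hb.pos n; positivity
  filter_upwards [hC] with n hn
  have h5 : b n ^ 5 = b n ^ (9 / 2 : ℝ) * √(b n) := by
    rw [Real.sqrt_eq_rpow, ← Real.rpow_add (hb.pos n), ← Real.rpow_natCast]
    norm_num
  rw [h5, ← mul_assoc]
  gcongr

end Bandwidth

/-! ### Paths of the regressors with regular block averages -/

/-- The innovation paths along which all block averages of `x_j x_jᵀ` are close to `M(t_j)`. -/
def regularPaths {E ι : Type*} (G : ℝ → (ℕ → E) → EuclideanSpace ℝ ι)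
    (M : ℝ → Matrix ι ι ℝ) (n m : ℕ) (δ : ℝ) : Set (ℤ → E) :=
  {e | ∀ a c l, |∑ j ∈ blockOf n m l, (regressor (fun i (e : ℤ → E) => e i) G n e j a *
    regressor (fun i (e : ℤ → E) => e i) G n e j c - M (design n j) a c)| ≤ δ * m}

/-- Entrywise deviations `δ m` change the quadratic form by at most `δ m (∑ |v_a|)² ≤ δ m p |v|²`,
with `p` the dimension, so half of the lower bound `c` survives. -/
theorem block_bounds_of_deviation {ι : Type*} [Fintype ι] {n m l : ℕ} {c C δ : ℝ}
    {M : ℕ → Matrix ι ι ℝ} {x : ℕ → ι → ℝ} (hm : 0 < m) (hC : 0 ≤ C)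
    (hδ : δ * Fintype.card ι ≤ c / 2)
    (hlow : ∀ j ∈ Finset.Icc 1 n, ∀ v : ι → ℝ, c * ∑ i, v i ^ 2 ≤ v ⬝ᵥ (M j).mulVec v)
    (hup : ∀ j ∈ Finset.Icc 1 n, ∑ a, M j a a ≤ C)
    (hdev : ∀ a c, |∑ j ∈ blockOf n m l, (x j a * x j c - M j a c)| ≤ δ * m) :
    ∑ j ∈ blockOf n m l, x j ⬝ᵥ x j ≤ (C + c / 2) * m ∧
      ((blockOf n m l).card = m → ∀ v : ι → ℝ,
        c / 2 * m * (v ⬝ᵥ v) ≤ ∑ j ∈ blockOf n m l, (x j ⬝ᵥ v) ^ 2) := by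
  constructor
  · have h1 : ∑ j ∈ blockOf n m l, x j ⬝ᵥ x j =
        ∑ j ∈ blockOf n m l, ∑ a, M j a a +
          ∑ a, ∑ j ∈ blockOf n m l, (x j a * x j a - M j a a) := by
      rw [Finset.sum_comm (s := Finset.univ), ← Finset.sum_add_distrib]
      refine Finset.sum_congr rfl fun j _ => ?_
      rw [← Finset.sum_add_distrib]
      exact Finset.sum_congr rfl fun a _ => by ring
    have h2 : ∑ j ∈ blockOf n m l, ∑ a, M j a a ≤ C * m := by
      calc _ ≤ ∑ j ∈ blockOf n m l, C :=
            Finset.sum_le_sum fun j hj => hup j (blockOf_subset l hj)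
        _ = (blockOf n m l).card * C := by rw [Finset.sum_const, nsmul_eq_mul]
        _ ≤ m * C := by
            gcongr
            exact card_blockOf_le hm l
        _ = _ := mul_comm _ _
    have h3 : ∑ a, ∑ j ∈ blockOf n m l, (x j a * x j a - M j a a) ≤
        Fintype.card ι * (δ * m) := by
      have := Finset.sum_le_card_nsmul Finset.univ
        (fun a => ∑ j ∈ blockOf n m l, (x j a * x j a - M j a a)) (δ * m)
        fun a _ => (le_abs_self _).trans (hdev a a)
      simpa using this
    have h4 : Fintype.card ι * (δ * m) ≤ c / 2 * m := by
      calc _ = (δ * Fintype.card ι) * m := by ring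
        _ ≤ _ := by gcongr
    rw [h1]
    linarith
  · intro hcard v
    have h1 : ∑ j ∈ blockOf n m l, (x j ⬝ᵥ v) ^ 2 =
        ∑ j ∈ blockOf n m l, v ⬝ᵥ (M j).mulVec v +
          ∑ a, ∑ d, v a * v d * ∑ j ∈ blockOf n m l, (x j a * x j d - M j a d) := by
      have : ∑ a, ∑ d, v a * v d * ∑ j ∈ blockOf n m l, (x j a * x j d - M j a d) =
          ∑ j ∈ blockOf n m l, ∑ a, ∑ d, v a * v d * (x j a * x j d - M j a d) := by
        rw [Finset.sum_comm (s := blockOf n m l)]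
        refine Finset.sum_congr rfl fun a _ => ?_
        rw [Finset.sum_comm (s := blockOf n m l)]
        exact Finset.sum_congr rfl fun d _ => Finset.mul_sum _ _ _
      rw [this, ← Finset.sum_add_distrib]
      refine Finset.sum_congr rfl fun j _ => ?_
      simp only [dotProduct, Matrix.mulVec, Finset.mul_sum, sq, Finset.sum_mul]
      rw [Finset.sum_comm (s := Finset.univ) (t := Finset.univ)
        (f := fun i i_1 => x j i_1 * v i_1 * (x j i * v i)), ← Finset.sum_add_distrib]
      refine Finset.sum_congr rfl fun a _ => ?_
      rw [← Finset.sum_add_distrib]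
      exact Finset.sum_congr rfl fun d _ => by ring
    have h2 : m * (c * (v ⬝ᵥ v)) ≤ ∑ j ∈ blockOf n m l, v ⬝ᵥ (M j).mulVec v := by
      have := Finset.card_nsmul_le_sum (blockOf n m l) (fun j => v ⬝ᵥ (M j).mulVec v)
        (c * (v ⬝ᵥ v)) fun j hj => by
          have := hlow j (blockOf_subset l hj) v
          simpa [dotProduct, sq] using this
      rwa [hcard, nsmul_eq_mul] at this
    have h3 : |∑ a, ∑ d, v a * v d * ∑ j ∈ blockOf n m l, (x j a * x j d - M j a d)| ≤
        δ * m * (Fintype.card ι * (v ⬝ᵥ v)) := by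
      calc _ ≤ ∑ a, ∑ d, |v a| * |v d| * (δ * m) := by
            refine (Finset.abs_sum_le_sum_abs _ _).trans (Finset.sum_le_sum fun a _ => ?_)
            refine (Finset.abs_sum_le_sum_abs _ _).trans (Finset.sum_le_sum fun d _ => ?_)
            rw [abs_mul, abs_mul]
            gcongr
            exact hdev a d
        _ = δ * m * (∑ a, |v a|) ^ 2 := by
            rw [sq, Finset.sum_mul_sum, Finset.mul_sum]
            refine Finset.sum_congr rfl fun a _ => ?_
            rw [Finset.mul_sum]
            exact Finset.sum_congr rfl fun d _ => by ring
        _ ≤ _ := by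
            rcases isEmpty_or_nonempty ι with h | ⟨⟨a⟩⟩
            · simp
            have : 0 ≤ δ * m := (abs_nonneg _).trans (hdev a a)
            gcongr
            have := sq_sum_le_card_mul_sum_sq (s := Finset.univ) (f := fun a => |v a|)
            simpa [dotProduct, sq] using this
    have h4 : δ * m * (Fintype.card ι * (v ⬝ᵥ v)) ≤ c / 2 * m * (v ⬝ᵥ v) := by
      have := dotProduct_self_nonneg_real v
      calc _ = (δ * Fintype.card ι) * m * (v ⬝ᵥ v) := by ring
        _ ≤ _ := by gcongr
    rw [h1]
    have := neg_abs_le (∑ a, ∑ d, v a * v d * ∑ j ∈ blockOf n m l, (x j a * x j d - M j a d))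
    linarith

section RegularPaths

variable {Ω E F ι : Type*} [Fintype ι] [MeasurableSpace Ω] [MeasurableSpace E] [MeasurableSpace F]
  {μ : Measure Ω} [IsProbabilityMeasure μ] {eps : ℤ → Ω → E} {xi : ℤ → Ω → F}
  {G : ℝ → (ℕ → E) → EuclideanSpace ℝ ι} {V : ℝ → (ℕ → E) → ℝ} {H : ℝ → (ℕ → F) → ℝ}
  {β : ℝ → ι → ℝ}

theorem measurable_regressor_path (hS : StandingAssumptions μ eps xi G V H) {n j : ℕ}
    (hj : j ∈ Finset.Icc 1 n) (a : ι) :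
    Measurable fun e : ℤ → E => regressor (fun i (e : ℤ → E) => e i) G n e j a :=
  (EuclideanSpace.proj a : EuclideanSpace ℝ ι →L[ℝ] ℝ).continuous.measurable.comp
    ((hS.meas_G _ (design_mem_Icc hj)).comp
      (measurable_pi_lambda _ fun _ => measurable_pi_apply _))

theorem measurableSet_regularPaths (hS : StandingAssumptions μ eps xi G V H)
    (M : ℝ → Matrix ι ι ℝ) (n m : ℕ) (δ : ℝ) : MeasurableSet (regularPaths G M n m δ) := by
  have : regularPaths G M n m δ = ⋂ a, ⋂ c, ⋂ l, {e | |∑ j ∈ blockOf n m l,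
      (regressor (fun i (e : ℤ → E) => e i) G n e j a *
        regressor (fun i (e : ℤ → E) => e i) G n e j c - M (design n j) a c)| ≤ δ * m} := by
    ext e; simp [regularPaths]
  rw [this]
  refine MeasurableSet.iInter fun a => MeasurableSet.iInter fun c => MeasurableSet.iInter fun l =>
    measurableSet_le ?_ measurable_const
  refine (Finset.measurable_sum _ fun j hj => ?_).abs
  exact ((measurable_regressor_path hS (blockOf_subset l hj) a).mul
    (measurable_regressor_path hS (blockOf_subset l hj) c)).sub_const _

theorem integral_regressor_mul (hS : StandingAssumptions μ eps xi G V H) {n j : ℕ}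
    (hj : j ∈ Finset.Icc 1 n) (a c : ι) :
    ∫ ω, regressor eps G n ω j a * regressor eps G n ω j c ∂μ = Mmat μ eps G (design n j) a c := by
  have hm : ∀ a, Measurable fun x => G (design n j) x a := fun a =>
    (EuclideanSpace.proj a : EuclideanSpace ℝ ι →L[ℝ] ℝ).continuous.measurable.comp
      (hS.meas_G _ (design_mem_Icc hj))
  exact ((identDistrib_past hS.eps_iid j 0).comp ((hm a).mul (hm c))).integral_eq

/-- By Chebyshev one block fails with probability `O(1 / m)`. There are at most `n / m + 1` blocks,
so the total is `O(n / m² + 1 / m)`; as `m` is of order `n b`, this is `O(1 / (n b²) + 1 / (n b))`,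
and `n b² → ∞`. -/
theorem tendsto_measure_not_regularPaths (hS : StandingAssumptions μ eps xi G V H)
    (hA : ConditionA μ eps xi G V H β) {b : ℕ → ℝ} (hb : BandwidthCondition b) {ρ δ : ℝ}
    (hρ : 0 < ρ) (hδ : 0 < δ) :
    Tendsto (fun n : ℕ => μ {ω | (fun i => eps i ω) ∉
      regularPaths G (Mmat μ eps G) n ⌊ρ * (n * b n)⌋₊ δ}) atTop (𝓝 0) := by
  obtain ⟨C, hC0, hC⟩ := exists_variance_sum_regressor_le hS hA
  set p := Fintype.card ι
  set m : ℕ → ℕ := fun n => ⌊ρ * (n * b n)⌋₊ with hm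
  have hnb := hb.tendsto_mul.const_mul_atTop hρ
  have hm1 : Tendsto (fun n => (m n : ℝ)) atTop atTop := by
    have := tendsto_nat_floor_atTop (α := ℝ)
    exact tendsto_natCast_atTop_atTop.comp (this.comp hnb)
  have hm2 : Tendsto (fun n : ℕ => (m n : ℝ) ^ 2 / n) atTop atTop := by
    refine tendsto_atTop_mono' atTop ?_ (hb.tendsto_mul_sq.const_mul_atTop
      (show 0 < (ρ / 2) ^ 2 by positivity))
    filter_upwards [eventually_gt_atTop 0, hm1.eventually_ge_atTop 1] with n hn h1
    have hn' : (0 : ℝ) < n := by exact_mod_cast hn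
    have := Nat.lt_floor_add_one (ρ * (n * b n))
    have hge : ρ / 2 * (n * b n) ≤ m n := by simp only [hm] at h1 ⊢; linarith
    have hbn := hb.pos n
    rw [le_div_iff₀ hn']
    calc _ = (ρ / 2 * (n * b n)) ^ 2 := by ring
      _ ≤ _ := by gcongr
  have hlim : Tendsto (fun n : ℕ => ENNReal.ofReal
      ((p : ℝ) ^ 2 * (C / δ ^ 2) * (((m n : ℝ) ^ 2 / n)⁻¹ + ((m n : ℝ))⁻¹))) atTop (𝓝 0) := by
    have := ((tendsto_inv_atTop_zero.comp hm2).add (tendsto_inv_atTop_zero.comp hm1)).const_mul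
      ((p : ℝ) ^ 2 * (C / δ ^ 2))
    have := ENNReal.tendsto_ofReal this
    simpa using this
  refine tendsto_of_tendsto_of_tendsto_of_le_of_le' tendsto_const_nhds hlim
    (Eventually.of_forall fun _ => zero_le) ?_
  filter_upwards [eventually_gt_atTop 0, hm1.eventually_ge_atTop 1] with n hn h1
  have hmpos : (0 : ℝ) < m n := by linarith
  have hmpos' : 0 < m n := by exact_mod_cast hmpos
  have hn' : (0 : ℝ) < n := by exact_mod_cast hn
  have hsub : {ω | (fun i => eps i ω) ∉ regularPaths G (Mmat μ eps G) n (m n) δ} ⊆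
      ⋃ a : ι, ⋃ c : ι, ⋃ l ∈ Finset.range (n / m n + 1), {ω | δ * m n ≤
        |∑ j ∈ blockOf n (m n) l, regressor eps G n ω j a * regressor eps G n ω j c -
          μ[fun ω => ∑ j ∈ blockOf n (m n) l,
            regressor eps G n ω j a * regressor eps G n ω j c]|} := by
    intro ω hω
    simp only [regularPaths, mem_ofPred_eq, not_forall, not_le] at hω
    obtain ⟨a, c, l, hl⟩ := hω
    -- Empty blocks deviate by zero, which leaves finitely many indices `l` for the union bound.
    have hne : (blockOf n (m n) l).Nonempty := by
      by_contra hne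
      rw [Finset.not_nonempty_iff_eq_empty] at hne
      rw [hne, Finset.sum_empty, abs_zero] at hl
      have : 0 ≤ δ * m n := by positivity
      linarith
    obtain ⟨j, hj⟩ := hne
    have hlr : l ∈ Finset.range (n / m n + 1) := by
      simp only [blockOf, Finset.mem_filter, Finset.mem_Icc] at hj
      rw [Finset.mem_range, ← hj.2]
      exact Nat.lt_succ_of_le (Nat.div_le_div_right hj.1.2)
    simp only [mem_iUnion]
    refine ⟨a, c, l, hlr, ?_⟩
    have hint : ∫ ω, ∑ j ∈ blockOf n (m n) l,
        regressor eps G n ω j a * regressor eps G n ω j c ∂μ =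
        ∑ j ∈ blockOf n (m n) l, Mmat μ eps G (design n j) a c := by
      rw [integral_finsetSum _ fun j hj =>
        ((hC a c n _ (blockOf_subset l)).1 j hj).integrable (by norm_num)]
      exact Finset.sum_congr rfl fun j hj => integral_regressor_mul hS (blockOf_subset l hj) a c
    rw [mem_ofPred_eq, hint, ← Finset.sum_sub_distrib]
    exact hl.le
  refine (measure_mono hsub).trans ?_
  have hone : ∀ a c l, μ {ω | δ * m n ≤
        |∑ j ∈ blockOf n (m n) l, regressor eps G n ω j a * regressor eps G n ω j c -
          μ[fun ω => ∑ j ∈ blockOf n (m n) l,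
            regressor eps G n ω j a * regressor eps G n ω j c]|} ≤
      ENNReal.ofReal (C / δ ^ 2 * (m n : ℝ)⁻¹) := by
    intro a c l
    obtain ⟨hL2, hvar⟩ := hC a c n _ (blockOf_subset (m := m n) l)
    refine (meas_ge_le_variance_div_sq (memLp_finsetSum _ hL2) (by positivity)).trans
      (ENNReal.ofReal_le_ofReal ?_)
    have hcard : ((blockOf n (m n) l).card : ℝ) ≤ m n := by
      exact_mod_cast card_blockOf_le hmpos' l
    calc _ ≤ C * m n / (δ * m n) ^ 2 := by gcongr; exact hvar.trans (by gcongr)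
      _ = _ := by field_simp
  calc _ ≤ ∑ a : ι, ∑ c : ι, ∑ l ∈ Finset.range (n / m n + 1),
        ENNReal.ofReal (C / δ ^ 2 * (m n : ℝ)⁻¹) := by
        refine (measure_iUnion_fintype_le _ _).trans (Finset.sum_le_sum fun a _ => ?_)
        refine (measure_iUnion_fintype_le _ _).trans (Finset.sum_le_sum fun c _ => ?_)
        exact (measure_biUnion_finset_le _ _).trans (Finset.sum_le_sum fun l _ => hone a c l)
    _ = ENNReal.ofReal ((p : ℝ) ^ 2 * ((n / m n + 1 : ℕ) * (C / δ ^ 2 * (m n : ℝ)⁻¹))) := by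
        simp only [Finset.sum_const, nsmul_eq_mul, Finset.card_univ, Finset.card_range]
        rw [← ENNReal.ofReal_natCast, ← ENNReal.ofReal_natCast (n / m n + 1),
          ← ENNReal.ofReal_mul (by positivity), ← ENNReal.ofReal_mul (by positivity),
          ← ENNReal.ofReal_mul (by positivity)]
        congr 1
        ring
    _ ≤ _ := by
        refine ENNReal.ofReal_le_ofReal ?_
        have h2 : ((n / m n : ℕ) : ℝ) ≤ n / m n := Nat.cast_div_le
        have h3 : (((n / m n + 1 : ℕ) : ℝ)) * (m n : ℝ)⁻¹ ≤ ((m n : ℝ) ^ 2 / n)⁻¹ + (m n : ℝ)⁻¹ := by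
          push_cast
          rw [add_mul, one_mul]
          gcongr
          calc _ ≤ (n : ℝ) / m n * (m n : ℝ)⁻¹ := by gcongr
            _ = _ := by field_simp
        calc _ = (p : ℝ) ^ 2 * (C / δ ^ 2) * ((n / m n + 1 : ℕ) * (m n : ℝ)⁻¹) := by ring
          _ ≤ _ := by gcongr

end RegularPaths

/-! ### Measurability of the smoother -/

section MeasurableSmoother

variable {α ι : Type*} [MeasurableSpace α] [Fintype ι] [DecidableEq ι] {n : ℕ}

/-- Adjugate over determinant; at singular matrices both sides are zero by convention. -/
theorem measurable_matrix_inv_apply {κ : Type*} [Fintype κ] [DecidableEq κ]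
    {M : α → Matrix κ κ ℝ} (hM : ∀ a c, Measurable fun e => M e a c) (a c : κ) :
    Measurable fun e => (M e)⁻¹ a c := by
  have hdet : ∀ N : α → Matrix κ κ ℝ, (∀ a c, Measurable fun e => N e a c) →
      Measurable fun e => (N e).det := by
    intro N hN
    simp only [Matrix.det_apply]
    exact Finset.measurable_sum _ fun σ _ =>
      (Finset.measurable_prod _ fun k _ => hN _ _).const_smul _
  have hadj : Measurable fun e => (M e).adjugate a c := by
    simp only [Matrix.adjugate_apply]
    refine hdet _ fun k l => ?_
    simp only [Matrix.updateRow_apply]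
    split_ifs
    · exact measurable_const
    · exact hM k l
  have : (fun e => (M e)⁻¹ a c) = fun e => ((M e).det)⁻¹ * (M e).adjugate a c := by
    ext e
    rw [Matrix.inv_def, Matrix.smul_apply, Ring.inverse_eq_inv', smul_eq_mul]
  rw [this]
  exact (hdet M hM).inv.mul hadj

theorem measurable_smoother (K : ℝ → ℝ) (b : ℝ) {x : α → ℕ → ι → ℝ}
    (hx : ∀ j ∈ Finset.Icc 1 n, ∀ a, Measurable fun e => x e j a) {i j : ℕ}
    (hi : i ∈ Finset.Icc 1 n) (hj : j ∈ Finset.Icc 1 n) :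
    Measurable fun e => smoother K b n (x e) i j := by
  have hd : ∀ j ∈ Finset.Icc 1 n, ∀ a, Measurable fun e => localDesign b n (x e) i j a := by
    rintro j hj (a | a)
    · exact hx j hj a
    · exact (hx j hj a).mul_const _
  have hg : ∀ a c, Measurable fun e => localGram K b n (x e) i a c := fun a c =>
    Finset.measurable_sum _ fun k hk => ((hd k hk a).mul (hd k hk c)).const_mul _
  refine Measurable.const_mul ?_ _
  refine Finset.measurable_sum _ fun a _ => Measurable.mul ?_ ?_
  · rcases a with a | a
    · exact hx i hi a
    · exact measurable_const
  · exact Finset.measurable_sum _ fun c _ => (measurable_matrix_inv_apply hg a c).mul (hd j hj c)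

theorem measurable_resid {S : α → ℕ → ℕ → ℝ}
    (hS : ∀ i ∈ Finset.Icc 1 n, ∀ j ∈ Finset.Icc 1 n, Measurable fun e => S e i j)
    {z : α → ℕ → ℝ} (hz : ∀ i ∈ Finset.Icc 1 n, Measurable fun e => z e i) {i : ℕ}
    (hi : i ∈ Finset.Icc 1 n) : Measurable fun e => resid n (S e) (z e) i :=
  (hz i hi).sub (Finset.measurable_sum _ fun j hj => (hS i hi j hj).mul (hz j hj))

theorem measurable_residAdjoint {S : α → ℕ → ℕ → ℝ}
    (hS : ∀ i ∈ Finset.Icc 1 n, ∀ j ∈ Finset.Icc 1 n, Measurable fun e => S e i j)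
    {z : α → ℕ → ℝ} (hz : ∀ i ∈ Finset.Icc 1 n, Measurable fun e => z e i) {i : ℕ}
    (hi : i ∈ Finset.Icc 1 n) : Measurable fun e => residAdjoint n (S e) (z e) i :=
  (hz i hi).sub (Finset.measurable_sum _ fun j hj => (hS j hj i hi).mul (hz j hj))

end MeasurableSmoother

/-! ### Second moments of linear forms in the errors -/

section LinearForms

variable {Ω E F ι : Type*} [Fintype ι] [MeasurableSpace Ω] [MeasurableSpace E] [MeasurableSpace F]
  {μ : Measure Ω} [IsProbabilityMeasure μ] {eps : ℤ → Ω → E} {xi : ℤ → Ω → F}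
  {G : ℝ → (ℕ → E) → EuclideanSpace ℝ ι} {V : ℝ → (ℕ → E) → ℝ} {H : ℝ → (ℕ → F) → ℝ}
  {β : ℝ → ι → ℝ}

theorem exists_trace_Mmat_le
    (hA : ConditionA μ eps xi G V H β) :
    ∃ C : ℝ, 0 ≤ C ∧ ∀ t ∈ Icc (0 : ℝ) 1, ∑ a, Mmat μ eps G t a a ≤ C := by
  obtain ⟨C, hC0, hC⟩ := exists_eLpNorm_two_le (by norm_num) hA.A2_moment hA.A2_lip
  refine ⟨C ^ 2, by positivity, fun t ht => ?_⟩
  have hL2 : MemLp (fun ω => G t (past eps 0 ω)) 2 μ :=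
    (hA.A2_moment t ht).mono_exponent (by norm_num)
  have hint : ∀ a, Integrable (fun ω => G t (past eps 0 ω) a * G t (past eps 0 ω) a) μ := by
    intro a
    have : MemLp (fun ω => G t (past eps 0 ω) a) 2 μ :=
      (EuclideanSpace.proj a : EuclideanSpace ℝ ι →L[ℝ] ℝ).comp_memLp' hL2
    simpa [sq] using this.integrable_sq
  have h1 : ∑ a, Mmat μ eps G t a a = ∫ ω, ‖G t (past eps 0 ω)‖ ^ 2 ∂μ := by
    simp only [Mmat]
    rw [← integral_finsetSum _ fun a _ => hint a]
    congr 1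
    ext ω
    rw [EuclideanSpace.norm_sq_eq]
    simp [sq]
  have h2 : ∫ ω, ‖G t (past eps 0 ω)‖ ^ 2 ∂μ =
      (eLpNorm (fun ω => ‖G t (past eps 0 ω)‖) 2 μ).toReal ^ 2 :=
    integral_sq_eq_eLpNorm hL2.norm.aestronglyMeasurable
  rw [h1, h2, eLpNorm_norm]
  have := ENNReal.toReal_mono ENNReal.ofReal_ne_top (hC t ht)
  rw [ENNReal.toReal_ofReal hC0] at this
  gcongr

/-- The two innovation sequences have a product law, so by Tonelli the weights are frozen while the
`xi` are integrated out. This plays the role of conditioning on the regressors. -/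
theorem exists_lintegral_sq_sum_mul_H_le (hS : StandingAssumptions μ eps xi G V H)
    (hA : ConditionA μ eps xi G V H β) :
    ∃ C : ℝ, 0 < C ∧ ∀ (n : ℕ) (c : ℕ → (ℤ → E) → ℝ), (∀ i ∈ Finset.Icc 1 n, Measurable (c i)) →
      ∫⁻ ω, ENNReal.ofReal ((∑ i ∈ Finset.Icc 1 n,
          c i (fun k => eps k ω) * H (design n i) (past xi i ω)) ^ 2) ∂μ ≤
        ENNReal.ofReal C * ∑ i ∈ Finset.Icc 1 n,
          ∫⁻ ω, ENNReal.ofReal (c i (fun k => eps k ω) ^ 2) ∂μ := by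
  obtain ⟨C, hC0, hC⟩ := exists_lintegral_sq_sum_H_le hS hA
  refine ⟨C, hC0, fun n c hc => ?_⟩
  have hX : Measurable fun ω k => eps k ω := measurable_pi_lambda _ hS.eps_iid.1
  have hY : Measurable fun ω k => xi k ω := measurable_pi_lambda _ hS.xi_iid.1
  set f : (ℤ → E) × (ℤ → F) → ℝ≥0∞ := fun p => ENNReal.ofReal ((∑ i ∈ Finset.Icc 1 n,
    c i p.1 * H (design n i) (fun j : ℕ => p.2 (i - j))) ^ 2) with hf
  have hfm : Measurable f := by
    refine (Measurable.pow_const (Finset.measurable_sum _ fun i hi => ?_) 2).ennreal_ofReal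
    refine ((hc i hi).comp measurable_fst).mul ((hS.meas_H _ (design_mem_Icc hi)).comp ?_)
    exact measurable_pi_lambda _ fun j => (measurable_pi_apply _).comp measurable_snd
  have hlaw := (indepFun_iff_map_prod_eq_prod_map_map hX.aemeasurable hY.aemeasurable).1 hS.indep
  have : IsProbabilityMeasure (μ.map fun ω k => xi k ω) :=
    Measure.isProbabilityMeasure_map hY.aemeasurable
  have : IsProbabilityMeasure (μ.map fun ω k => eps k ω) :=
    Measure.isProbabilityMeasure_map hX.aemeasurable
  calc ∫⁻ ω, f (fun k => eps k ω, fun k => xi k ω) ∂μ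
      = ∫⁻ p, f p ∂(μ.map fun ω => ((fun k => eps k ω), fun k => xi k ω)) :=
        (lintegral_map hfm (hX.prodMk hY)).symm
    _ = ∫⁻ e, ∫⁻ u, f (e, u) ∂(μ.map fun ω k => xi k ω) ∂(μ.map fun ω k => eps k ω) := by
        rw [hlaw, lintegral_prod _ hfm.aemeasurable]
    _ ≤ ∫⁻ e, ENNReal.ofReal C * ∑ i ∈ Finset.Icc 1 n, ENNReal.ofReal (c i e ^ 2)
          ∂(μ.map fun ω k => eps k ω) := by
        refine lintegral_mono fun e => ?_
        have : Measurable fun u => f (e, u) := hfm.comp measurable_prodMk_left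
        rw [lintegral_map this hY]
        refine (hC n fun i => c i e).trans_eq ?_
        rw [ENNReal.ofReal_mul hC0.le, ENNReal.ofReal_sum_of_nonneg fun _ _ => sq_nonneg _]
    _ = _ := by
        have hm : ∀ i ∈ Finset.Icc 1 n, Measurable fun e => ENNReal.ofReal (c i e ^ 2) :=
          fun i hi => ((hc i hi).pow_const 2).ennreal_ofReal
        rw [lintegral_const_mul _ (Finset.measurable_sum _ hm), lintegral_finsetSum _ hm]
        congr 1
        exact Finset.sum_congr rfl fun i hi => lintegral_map (hm i hi) hX

/-- The norms of the regressors along an innovation path. -/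
noncomputable def pathNorm {E ι : Type*} [Fintype ι] (G : ℝ → (ℕ → E) → EuclideanSpace ℝ ι)
    (n : ℕ) (e : ℤ → E) (j : ℕ) : ℝ :=
  √(regressor (fun i (e : ℤ → E) => e i) G n e j ⬝ᵥ regressor (fun i (e : ℤ → E) => e i) G n e j)

/-- The factor `V` of the error joins the weights. Summing the squared weights over the forms first
leaves `D |x_i|² V_i²`, whose mean is bounded, so a whole family of forms costs no more than one. -/
theorem exists_lintegral_linear_forms_le (hS : StandingAssumptions μ eps xi G V H)
    (hA : ConditionA μ eps xi G V H β) :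
    ∃ C : ℝ, 0 < C ∧ ∀ (n : ℕ) (s : Finset ℕ) (w : (ℤ → E) → ℕ → ℕ → ℝ) (D : ℝ),
      (∀ k ∈ s, ∀ i ∈ Finset.Icc 1 n, Measurable fun e => w e k i) → 0 ≤ D →
      (∀ i ∈ Finset.Icc 1 n, ∀ e, ∑ k ∈ s, w e k i ^ 2 ≤ D * pathNorm G n e i ^ 2) →
      ∫⁻ ω, ENNReal.ofReal (∑ k ∈ s, (∑ i ∈ Finset.Icc 1 n,
          w (fun j => eps j ω) k i * modelError eps xi V H n ω i) ^ 2) ∂μ ≤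
        ENNReal.ofReal (C * (n * D)) := by
  obtain ⟨C, hC0, hC⟩ := exists_lintegral_sq_sum_mul_H_le hS hA
  obtain ⟨B, hB0, hB⟩ := exists_lintegral_regressor_sq_mul_V_sq_le hS hA
  refine ⟨C * B, by positivity, fun n s w D hw hD hle => ?_⟩
  set c : ℕ → ℕ → (ℤ → E) → ℝ := fun k i e =>
    w e k i * V (design n i) (fun j : ℕ => e (i - j)) with hc
  have hX : Measurable fun ω k => eps k ω := measurable_pi_lambda _ hS.eps_iid.1
  have hY : Measurable fun ω k => xi k ω := measurable_pi_lambda _ hS.xi_iid.1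
  have hcm : ∀ k ∈ s, ∀ i ∈ Finset.Icc 1 n, Measurable (c k i) := fun k hk i hi =>
    (hw k hk i hi).mul ((hS.meas_V _ (design_mem_Icc hi)).comp
      (measurable_pi_lambda _ fun _ => measurable_pi_apply _))
  have hsum : ∀ k ω, ∑ i ∈ Finset.Icc 1 n, w (fun j => eps j ω) k i * modelError eps xi V H n ω i =
      ∑ i ∈ Finset.Icc 1 n, c k i (fun j => eps j ω) * H (design n i) (past xi i ω) := by
    intro k ω
    refine Finset.sum_congr rfl fun i _ => ?_
    have : V (design n i) (past eps i ω) =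
      V (design n i) (fun j : ℕ => (fun j => eps j ω) ((i : ℤ) - j)) := rfl
    rw [modelError, this]
    simp only [hc]
    ring
  simp only [hsum]
  have hm : ∀ k ∈ s, Measurable fun ω => ENNReal.ofReal ((∑ i ∈ Finset.Icc 1 n,
      c k i (fun j => eps j ω) * H (design n i) (past xi i ω)) ^ 2) := fun k hk =>
    (Measurable.pow_const (Finset.measurable_sum _ fun i hi => ((hcm k hk i hi).comp hX).mul
      ((hS.meas_H _ (design_mem_Icc hi)).comp (measurable_past hS.xi_iid i))) 2).ennreal_ofReal
  have hm2 : ∀ k ∈ s, ∀ i ∈ Finset.Icc 1 n,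
      Measurable fun ω => ENNReal.ofReal (c k i (fun j => eps j ω) ^ 2) := fun k hk i hi =>
    (((hcm k hk i hi).comp hX).pow_const 2).ennreal_ofReal
  calc _ = ∑ k ∈ s, ∫⁻ ω, ENNReal.ofReal ((∑ i ∈ Finset.Icc 1 n,
        c k i (fun j => eps j ω) * H (design n i) (past xi i ω)) ^ 2) ∂μ := by
        rw [← lintegral_finsetSum _ hm]
        exact lintegral_congr fun ω => ENNReal.ofReal_sum_of_nonneg fun _ _ => sq_nonneg _
    _ ≤ ∑ k ∈ s, ENNReal.ofReal C * ∑ i ∈ Finset.Icc 1 n,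
          ∫⁻ ω, ENNReal.ofReal (c k i (fun j => eps j ω) ^ 2) ∂μ :=
        Finset.sum_le_sum fun k hk => hC n (c k) (hcm k hk)
    _ = ENNReal.ofReal C * ∑ i ∈ Finset.Icc 1 n,
          ∫⁻ ω, ∑ k ∈ s, ENNReal.ofReal (c k i (fun j => eps j ω) ^ 2) ∂μ := by
        rw [← Finset.mul_sum, Finset.sum_comm]
        congr 1
        exact Finset.sum_congr rfl fun i hi =>
          (lintegral_finsetSum _ fun k hk => hm2 k hk i hi).symm
    _ ≤ ENNReal.ofReal C * ∑ i ∈ Finset.Icc 1 n, ENNReal.ofReal D * ENNReal.ofReal B := by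
        gcongr with i hi
        refine le_trans ?_ (mul_le_mul_right (hB n i hi) _)
        rw [← lintegral_const_mul' _ _ ENNReal.ofReal_ne_top]
        refine lintegral_mono fun ω => ?_
        rw [← ENNReal.ofReal_sum_of_nonneg fun _ _ => sq_nonneg _, ← ENNReal.ofReal_mul hD]
        refine ENNReal.ofReal_le_ofReal ?_
        simp only [hc, mul_pow]
        rw [← Finset.sum_mul, ← mul_assoc]
        have h1 := hle i hi fun j => eps j ω
        rw [pathNorm, Real.sq_sqrt (dotProduct_self_nonneg_real _)] at h1
        exact mul_le_mul_of_nonneg_right h1 (sq_nonneg _)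
    _ = _ := by
        rw [Finset.sum_const, Nat.card_Icc, Nat.add_sub_cancel, nsmul_eq_mul,
          ← ENNReal.ofReal_natCast, ← ENNReal.ofReal_mul hD, ← ENNReal.ofReal_mul (by positivity),
          ← ENNReal.ofReal_mul hC0.le]
        congr 1
        ring

/-- Second moments of `⟨ε, (I - S)ᵀ (I - S) z⟩` and of the smoothed errors `S ε`, on an event
that depends only on the innovations of the regressors. -/
theorem exists_lintegral_smoothed_errors_le (hS : StandingAssumptions μ eps xi G V H)
    (hA : ConditionA μ eps xi G V H β) :
    ∃ C : ℝ, 0 < C ∧ ∀ (n : ℕ) (b A : ℝ) (P : Set (ℤ → E)) (S : (ℤ → E) → ℕ → ℕ → ℝ),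
      MeasurableSet P → 0 < b →
      (∀ i ∈ Finset.Icc 1 n, ∀ j ∈ Finset.Icc 1 n, Measurable fun e => S e i j) →
      (∀ e ∈ P, SmootherBounds n b (pathNorm G n e) (S e) A) → 0 ≤ A →
      (∀ (L : ℝ) (z : (ℤ → E) → ℕ → ℝ), 0 ≤ L →
        (∀ i ∈ Finset.Icc 1 n, Measurable fun e => z e i) →
        (∀ e ∈ P, ∀ i ∈ Finset.Icc 1 n, |z e i| ≤ L * pathNorm G n e i) →
        ∫⁻ ω, ENNReal.ofReal ((P.indicator 1 (fun j => eps j ω) * ∑ i ∈ Finset.Icc 1 n,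
          modelError eps xi V H n ω i * residAdjoint n (S fun j => eps j ω)
            (resid n (S fun j => eps j ω) (z fun j => eps j ω)) i) ^ 2) ∂μ ≤
          ENNReal.ofReal (C * (n * ((1 + A ^ 2) ^ 2 * L) ^ 2))) ∧
      ∫⁻ ω, ENNReal.ofReal (P.indicator 1 (fun j => eps j ω) * ∑ i ∈ Finset.Icc 1 n,
        (∑ j ∈ Finset.Icc 1 n, S (fun j => eps j ω) i j * modelError eps xi V H n ω j) ^ 2) ∂μ ≤
        ENNReal.ofReal (C * (n * (A ^ 3 / (n * b)))) := by
  obtain ⟨C, hC0, hC⟩ := exists_lintegral_linear_forms_le hS hA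
  refine ⟨C, hC0, fun n b A P S hP hb hSm hSb hA0 => ⟨fun L z hL hz hzL => ?_, ?_⟩⟩
  -- A single form, with a dummy index.
  · have := hC n {0} (fun e _ i => P.indicator 1 e * residAdjoint n (S e) (resid n (S e) (z e)) i)
      (((1 + A ^ 2) ^ 2 * L) ^ 2)
      (fun _ _ i hi => (measurable_one.indicator hP).mul (measurable_residAdjoint hSm
        (fun i hi => measurable_resid hSm hz hi) hi)) (by positivity) ?_
    · refine le_of_eq_of_le (lintegral_congr fun ω => ?_) this
      rw [Finset.sum_singleton, Finset.mul_sum]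
      congr 2
      exact Finset.sum_congr rfl fun i _ => by ring
    · intro i hi e
      rw [Finset.sum_singleton, ← mul_pow]
      by_cases he : e ∈ P
      · have h1 := (hSb e he).abs_residAdjoint_resid_le hL (hzL e he) hi
        rw [indicator_of_mem he, Pi.one_apply, one_mul, ← sq_abs]
        exact pow_le_pow_left₀ (abs_nonneg _) h1 2
      · rw [indicator_of_notMem he, zero_mul, zero_pow two_ne_zero]
        positivity
  -- One form for each fitted value; the squared weights attached to error `j` add up over a column
  -- of the smoother.
  · have := hC n (Finset.Icc 1 n) (fun e i j => P.indicator 1 e * S e i j) (A ^ 3 / (n * b))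
      (fun i hi j hj => (measurable_one.indicator hP).mul (hSm i hi j hj)) (by positivity) ?_
    · refine le_of_eq_of_le (lintegral_congr fun ω => ?_) this
      rw [Finset.mul_sum]
      congr 1
      refine Finset.sum_congr rfl fun i _ => ?_
      simp only [mul_assoc]
      rw [← Finset.mul_sum, mul_pow]
      congr 1
      -- The indicator equals its own square.
      by_cases he : (fun j => eps j ω) ∈ P
      · simp [he]
      · simp [he]
    · intro j hj e
      by_cases he : e ∈ P
      · simp only [indicator_of_mem he, Pi.one_apply, one_mul]
        exact (hSb e he).sum_sq_le hj
      · simp only [indicator_of_notMem he, zero_mul, zero_pow two_ne_zero, Finset.sum_const_zero]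
        positivity

end LinearForms

/-! ### Residual sums of squares of the adjusted responses -/

theorem resid_congr {n : ℕ} {S : ℕ → ℕ → ℝ} {y y' : ℕ → ℝ}
    (h : ∀ j ∈ Finset.Icc 1 n, y j = y' j) {i : ℕ} (hi : i ∈ Finset.Icc 1 n) :
    resid n S y i = resid n S y' i := by
  rw [resid, resid, h i hi, Finset.sum_congr rfl fun j hj => by rw [h j hj]]

section Adjusted

variable {ι₁ ι₂ : Type*} [Fintype ι₁] [Fintype ι₂] [DecidableEq ι₂] {K : ℝ → ℝ} {b κ : ℝ} {n : ℕ}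

theorem rss_eq_sum_resid_sq {ι : Type*} [Fintype ι] [DecidableEq ι] {x : ℕ → ι → ℝ} {y : ℕ → ℝ}
    {βh : ℕ → ι → ℝ} (hκ : 0 < κ) (hb : b ≠ 0) (hG : ∀ i ∈ Finset.Icc 1 n, GramCoercive K b n x i κ)
    (hβ : ∀ i ∈ Finset.Icc 1 n, IsLocalLinearEstimate K b n x y (design n i) (βh i)) :
    RSS n x y βh = ∑ i ∈ Finset.Icc 1 n, resid n (smoother K b n x) y i ^ 2 := by
  refine Finset.sum_congr rfl fun i hi => ?_
  rw [(hβ i hi).dotProduct_eq (hG i hi) hκ hb, resid]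

/-- The scores `∂β₀(t_j, θ₀)/∂θ_l · x_j^{(1)}` of the parametric part. -/
noncomputable def parametricScore {q : ℕ} (D : ℕ → EuclideanSpace ℝ (Fin q) →L[ℝ] EuclideanSpace ℝ ι₁)
    (x : ℕ → ι₁ ⊕ ι₂ → ℝ) (l : Fin q) (j : ℕ) : ℝ :=
  ∑ a, D j (EuclideanSpace.single l 1) a * block1 x j a

theorem abs_sum_mul_block1_le (x : ℕ → ι₁ ⊕ ι₂ → ℝ) (v : EuclideanSpace ℝ ι₁) (j : ℕ) :
    |∑ a, v a * block1 x j a| ≤ ‖v‖ * √(x j ⬝ᵥ x j) := by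
  refine (abs_dotProduct_le (fun a => v a) (block1 x j)).trans ?_
  have h1 : √((fun a => v a) ⬝ᵥ fun a => v a) = ‖v‖ := by
    rw [EuclideanSpace.norm_eq]
    simp [dotProduct, sq]
  rw [h1]
  refine mul_le_mul_of_nonneg_left (Real.sqrt_le_sqrt ?_) (norm_nonneg v)
  simp only [dotProduct, Fintype.sum_sum_type, block1]
  have : 0 ≤ ∑ a, x j (Sum.inr a) * x j (Sum.inr a) :=
    Finset.sum_nonneg fun _ _ => mul_self_nonneg _
  linarith

theorem abs_parametricScore_le {q : ℕ} {D : ℕ → EuclideanSpace ℝ (Fin q) →L[ℝ] EuclideanSpace ℝ ι₁}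
    {L : ℝ} {j : ℕ} (hD : ‖D j‖ ≤ L) (x : ℕ → ι₁ ⊕ ι₂ → ℝ) (l : Fin q) :
    |parametricScore D x l j| ≤ L * √(x j ⬝ᵥ x j) := by
  refine (abs_sum_mul_block1_le x _ j).trans ?_
  gcongr
  refine ((D j).le_opNorm _).trans ?_
  rw [PiLp.norm_single]
  simpa using hD

theorem block2_dotProduct_self_le (x : ℕ → ι₁ ⊕ ι₂ → ℝ) (j : ℕ) :
    block2 x j ⬝ᵥ block2 x j ≤ x j ⬝ᵥ x j := by
  simp only [dotProduct, Fintype.sum_sum_type, block2]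
  have : 0 ≤ ∑ a, x j (Sum.inl a) * x j (Sum.inl a) :=
    Finset.sum_nonneg fun _ _ => mul_self_nonneg _
  linarith

theorem adjusted_eq {q : ℕ} {x : ℕ → ι₁ ⊕ ι₂ → ℝ} {y ε : ℕ → ℝ} {β : ℝ → ι₁ ⊕ ι₂ → ℝ}
    {β₀ : ℝ → EuclideanSpace ℝ (Fin q) → EuclideanSpace ℝ ι₁} {θ₀ : EuclideanSpace ℝ (Fin q)}
    (hy : ∀ j, y j = x j ⬝ᵥ β (design n j) + ε j)
    (hnull : ∀ t ∈ Icc (0 : ℝ) 1, ∀ a, β t (Sum.inl a) = β₀ t θ₀ a) {j : ℕ}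
    (hj : j ∈ Finset.Icc 1 n) :
    adjusted β₀ θ₀ n x y j =
      ((fun j => block2 x j ⬝ᵥ fun a => β (design n j) (Sum.inr a)) + ε) j := by
  simp only [adjusted, hy, Pi.add_apply, dotProduct, Fintype.sum_sum_type, block1, block2]
  have : ∑ a, β₀ (design n j) θ₀ a * x j (Sum.inl a) =
      ∑ a, x j (Sum.inl a) * β (design n j) (Sum.inl a) :=
    Finset.sum_congr rfl fun a _ => by rw [hnull _ (design_mem_Icc hj), mul_comm]
  rw [this]
  ring

/-- The perturbation bound with `h` the coordinates of `θ - θ₀`, `z` the parametric scores, and `d'`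
the Taylor remainder of the family paired with `x^{(1)}`. -/
theorem abs_sum_resid_adjusted_sub_le {q : ℕ} {S : ℕ → ℕ → ℝ} {A : ℝ} {x : ℕ → ι₁ ⊕ ι₂ → ℝ}
    (hS : SmootherBounds n b (fun j => √(x j ⬝ᵥ x j)) S A)
    {y ε : ℕ → ℝ} {β : ℝ → ι₁ ⊕ ι₂ → ℝ}
    {β₀ : ℝ → EuclideanSpace ℝ (Fin q) → EuclideanSpace ℝ ι₁} {θ₀ θ : EuclideanSpace ℝ (Fin q)}
    {D : ℕ → EuclideanSpace ℝ (Fin q) →L[ℝ] EuclideanSpace ℝ ι₁} {B L τ : ℝ}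
    (hy : ∀ j, y j = x j ⬝ᵥ β (design n j) + ε j)
    (hnull : ∀ t ∈ Icc (0 : ℝ) 1, ∀ a, β t (Sum.inl a) = β₀ t θ₀ a)
    (hB : 0 ≤ B) (hL : 0 ≤ L) (hτ : 0 ≤ τ) (hτ1 : τ ≤ 1) (hθ : ‖θ - θ₀‖ ≤ τ)
    (hℓ : ∀ i ∈ Finset.Icc 1 n,
      |resid n S (fun j => block2 x j ⬝ᵥ fun a => β (design n j) (Sum.inr a)) i| ≤
        B * √(x i ⬝ᵥ x i))
    (hD : ∀ i ∈ Finset.Icc 1 n, ‖D i‖ ≤ L)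
    (hT : ∀ i ∈ Finset.Icc 1 n,
      ‖β₀ (design n i) θ - β₀ (design n i) θ₀ - D i (θ - θ₀)‖ ≤ L * τ ^ 2) :
    |∑ i ∈ Finset.Icc 1 n, resid n S (adjusted β₀ θ n x y) i ^ 2 -
      ∑ i ∈ Finset.Icc 1 n, resid n S (adjusted β₀ θ₀ n x y) i ^ 2| ≤
      2 * (B * ((1 + A ^ 2) * (L * (q + 1) * τ)) * (A * n)) +
      2 * ((1 + A ^ 2) ^ 2 * (L * τ ^ 2) * ∑ i ∈ Finset.Icc 1 n, √(x i ⬝ᵥ x i) * |ε i|) +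
      2 * (τ * ∑ l, |∑ i ∈ Finset.Icc 1 n,
        ε i * residAdjoint n S (resid n S (parametricScore D x l)) i|) +
      ((1 + A ^ 2) * (L * (q + 1) * τ)) ^ 2 * (A * n) := by
  set ℓ : ℕ → ℝ := fun j => block2 x j ⬝ᵥ fun a => β (design n j) (Sum.inr a) with hℓdef
  set d' : ℕ → ℝ := fun j => ∑ a,
    (β₀ (design n j) θ - β₀ (design n j) θ₀ - D j (θ - θ₀)) a * block1 x j a with hd'
  set h : Fin q → ℝ := fun l => (θ - θ₀) l with hh
  have h0 : ∀ j ∈ Finset.Icc 1 n, adjusted β₀ θ₀ n x y j = (ℓ + ε) j := fun j hj =>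
    adjusted_eq hy hnull hj
  have hlin : ∀ j, ∑ l, h l * parametricScore D x l j = ∑ a, D j (θ - θ₀) a * block1 x j a := by
    intro j
    have h1 : D j (θ - θ₀) = ∑ l, h l • D j (EuclideanSpace.single l 1) := by
      have : θ - θ₀ = ∑ l, h l • EuclideanSpace.single l (1 : ℝ) := by
        ext k
        simp [hh, Pi.single_apply]
      conv_lhs => rw [this]
      simp only [map_sum, map_smul]
    simp only [parametricScore, Finset.mul_sum]
    rw [Finset.sum_comm, h1]
    refine Finset.sum_congr rfl fun a _ => ?_
    simp [Finset.sum_mul, mul_assoc]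
  have h1 : ∀ j ∈ Finset.Icc 1 n, adjusted β₀ θ n x y j =
      (ℓ + ε - ((fun j => ∑ l, h l * parametricScore D x l j) + d')) j := by
    intro j hj
    have h2 : adjusted β₀ θ n x y j = adjusted β₀ θ₀ n x y j -
        ∑ a, (β₀ (design n j) θ - β₀ (design n j) θ₀) a * block1 x j a := by
      simp only [adjusted, PiLp.sub_apply, sub_mul, Finset.sum_sub_distrib]
      ring
    rw [h2, h0 j hj]
    simp only [Pi.sub_apply, Pi.add_apply, hlin, hd', PiLp.sub_apply, sub_mul,
      Finset.sum_sub_distrib]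
    ring
  have e1 : ∑ i ∈ Finset.Icc 1 n, resid n S (adjusted β₀ θ n x y) i ^ 2 =
      ∑ i ∈ Finset.Icc 1 n,
        resid n S (ℓ + ε - ((fun j => ∑ l, h l * parametricScore D x l j) + d')) i ^ 2 :=
    Finset.sum_congr rfl fun i hi => by rw [resid_congr h1 hi]
  have e0 : ∑ i ∈ Finset.Icc 1 n, resid n S (adjusted β₀ θ₀ n x y) i ^ 2 =
      ∑ i ∈ Finset.Icc 1 n, resid n S (ℓ + ε) i ^ 2 :=
    Finset.sum_congr rfl fun i hi => by rw [resid_congr h0 hi]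
  rw [e1, e0]
  refine hS.abs_sum_resid_sq_sub_le hB hL hτ hτ1 (fun l => ?_) hℓ (fun l i hi => ?_) fun i hi => ?_
  · exact (PiLp.norm_apply_le (θ - θ₀) l).trans hθ
  · exact abs_parametricScore_le (hD i hi) x l
  · refine (abs_sum_mul_block1_le x _ i).trans ?_
    gcongr
    exact hT i hi

theorem sum_sq_le_sum_resid_adjusted_sq {q : ℕ} {S : ℕ → ℕ → ℝ} {A : ℝ} {x : ℕ → ι₁ ⊕ ι₂ → ℝ}
    (hS : SmootherBounds n b (fun j => √(x j ⬝ᵥ x j)) S A)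
    {y ε : ℕ → ℝ} {β : ℝ → ι₁ ⊕ ι₂ → ℝ}
    {β₀ : ℝ → EuclideanSpace ℝ (Fin q) → EuclideanSpace ℝ ι₁} {θ₀ : EuclideanSpace ℝ (Fin q)}
    {B : ℝ} (hy : ∀ j, y j = x j ⬝ᵥ β (design n j) + ε j)
    (hnull : ∀ t ∈ Icc (0 : ℝ) 1, ∀ a, β t (Sum.inl a) = β₀ t θ₀ a)
    (hℓ : ∀ i ∈ Finset.Icc 1 n,
      |resid n S (fun j => block2 x j ⬝ᵥ fun a => β (design n j) (Sum.inr a)) i| ≤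
        B * √(x i ⬝ᵥ x i)) :
    ∑ i ∈ Finset.Icc 1 n, ε i ^ 2 ≤
      3 * ∑ i ∈ Finset.Icc 1 n, resid n S (adjusted β₀ θ₀ n x y) i ^ 2 +
      3 * ∑ i ∈ Finset.Icc 1 n, (∑ j ∈ Finset.Icc 1 n, S i j * ε j) ^ 2 +
      3 * (B ^ 2 * (A * n)) := by
  have e0 : ∑ i ∈ Finset.Icc 1 n, resid n S (adjusted β₀ θ₀ n x y) i ^ 2 =
      ∑ i ∈ Finset.Icc 1 n, resid n S ((fun j => block2 x j ⬝ᵥ fun a =>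
        β (design n j) (Sum.inr a)) + ε) i ^ 2 :=
    Finset.sum_congr rfl fun i hi => by
      rw [resid_congr (fun j hj => adjusted_eq hy hnull hj) hi]
  rw [e0]
  exact hS.sum_sq_le_sum_resid_sq hℓ

end Adjusted

/-! ### Regular paths give a well-behaved smoother -/

section RegularSmoother

variable {Ω E F ι₁ ι₂ : Type*} [Fintype ι₁] [Fintype ι₂] [DecidableEq ι₂] [MeasurableSpace Ω]
  [MeasurableSpace E] [MeasurableSpace F] {μ : Measure Ω} [IsProbabilityMeasure μ]
  {eps : ℤ → Ω → E} {xi : ℤ → Ω → F} {G : ℝ → (ℕ → E) → EuclideanSpace ℝ (ι₁ ⊕ ι₂)}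
  {V : ℝ → (ℕ → E) → ℝ} {H : ℝ → (ℕ → F) → ℝ} {β : ℝ → ι₁ ⊕ ι₂ → ℝ} {K : ℝ → ℝ} {b : ℕ → ℝ}

/-- The smoother uses `x^{(2)}` only, but its bounds are stated with the norm of the full regressor,
since the scores it is applied to involve `x^{(1)}`. -/
theorem exists_paths_smootherBounds (hS : StandingAssumptions μ eps xi G V H)
    (hA : ConditionA μ eps xi G V H β) (hK : IsKernel K) (hb : BandwidthCondition b) :
    ∃ (A : ℝ) (P : ℕ → Set (ℤ → E)), 0 ≤ A ∧ (∀ n, MeasurableSet (P n)) ∧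
      Tendsto (fun n => μ {ω | (fun i => eps i ω) ∉ P n}) atTop (𝓝 0) ∧
      ∀ᶠ n in atTop, ∀ e ∈ P n, SmootherBounds n (b n) (pathNorm G n e)
        (smoother K (b n) n (block2 (regressor (fun i (e : ℤ → E) => e i) G n e))) A ∧
        ∃ κ, 0 < κ ∧ ∀ i ∈ Finset.Icc 1 n,
          GramCoercive K (b n) n (block2 (regressor (fun i (e : ℤ → E) => e i) G n e)) i κ := by
  obtain ⟨c, hc, hlow⟩ := hA.A1_eig
  obtain ⟨C, hC0, hup⟩ := exists_trace_Mmat_le hA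
  obtain ⟨ρ, A, hρ, hA0, h⟩ := exists_smootherBounds_of_blocks (ι := ι₂) hK (half_pos hc)
    (show 0 < C + c / 2 by positivity)
  -- The deviation allowed per entry, so that `δ` times the dimension is at most `c / 2`.
  set δ := c / (2 * (Fintype.card (ι₁ ⊕ ι₂) + 1)) with hδ
  have hδ0 : 0 < δ := by positivity
  have hδc : δ * Fintype.card (ι₁ ⊕ ι₂) ≤ c / 2 := by
    rw [hδ, div_mul_eq_mul_div, div_le_div_iff₀ (by positivity) (by positivity)]
    nlinarith
  refine ⟨A, fun n => regularPaths G (Mmat μ eps G) n ⌊ρ * (n * b n)⌋₊ δ, hA0,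
    fun n => measurableSet_regularPaths hS _ _ _ _, tendsto_measure_not_regularPaths hS hA hb hρ hδ0,
    ?_⟩
  filter_upwards [(hb.tendsto_mul.const_mul_atTop hρ).eventually_ge_atTop 1,
    hb.tendsto_zero.eventually_le_const (show (0 : ℝ) < 1 / 2 by norm_num)] with n hn hbn e he
  set x := regressor (fun i (e : ℤ → E) => e i) G n e with hx
  have hm : 0 < ⌊ρ * (n * b n)⌋₊ := Nat.floor_pos.2 hn
  have hblock := fun l => block_bounds_of_deviation (l := l) (x := x) hm hC0 hδc
    (fun j hj => hlow _ (design_mem_Icc hj)) (fun j hj => hup _ (design_mem_Icc hj))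
    (fun a c => he a c l)
  have hr2 : ∀ j, pathNorm G n e j ^ 2 = x j ⬝ᵥ x j := fun j =>
    Real.sq_sqrt (dotProduct_self_nonneg_real _)
  refine h n (b n) (block2 x) (pathNorm G n e) (hb.pos n) hbn hn (fun i => Real.sqrt_nonneg _)
    (fun j => ?_) (fun l => ?_) fun l hl v => ?_
  · rw [hr2]
    exact block2_dotProduct_self_le x j
  · simp only [hr2]
    exact (hblock l).1
  -- Vectors supported on the second block inherit the eigenvalue bound of the full matrix.
  · have := (hblock l).2 hl (Sum.elim 0 v)
    simpa [dotProduct, Fintype.sum_sum_type, block2] using this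

end RegularSmoother

/-! ### Stochastic bounds for the two residual sums of squares -/

theorem isBigOP_norm_estimator {Ω : Type*} [MeasurableSpace Ω] {μ : Measure Ω}
    [IsProbabilityMeasure μ] {p₁ q : ℕ}
    {β₀ : ℝ → EuclideanSpace ℝ (Fin q) → EuclideanSpace ℝ (Fin p₁)}
    {θ₀ : EuclideanSpace ℝ (Fin q)} {θhat : ℕ → Ω → EuclideanSpace ℝ (Fin q)}
    (hB : ConditionB μ β₀ θ₀ θhat) :
    IsBigOP μ (fun n ω => ‖θhat n ω - θ₀‖) (fun n => 1 / √(n : ℝ)) := by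
  obtain ⟨C, hC⟩ := hB.B2
  have hm : ∀ n, Measurable fun ω => θhat n ω - θ₀ := fun n => (hB.B2_meas n).sub_const _
  refine isBigOP_of_lintegral_le (abs_nonneg C) (fun n => (hm n).norm.aemeasurable) ?_ ?_
  · filter_upwards [eventually_gt_atTop 0] with n hn
    have : (0 : ℝ) < n := by exact_mod_cast hn
    positivity
  · filter_upwards [hC] with n hn
    calc _ = eLpNorm (fun ω => θhat n ω - θ₀) 1 μ := by
          rw [eLpNorm_one_eq_lintegral_enorm]
          exact lintegral_congr fun ω => by rw [abs_norm, ofReal_norm]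
      _ ≤ eLpNorm (fun ω => θhat n ω - θ₀) 4 μ :=
          eLpNorm_le_eLpNorm_of_exponent_le (by norm_num) (hm n).aestronglyMeasurable
      _ ≤ _ := hn
      _ ≤ _ := ENNReal.ofReal_le_ofReal (by
          rw [mul_one_div]; gcongr; exact le_abs_self C)

section Core

variable {Ω E F : Type*} [MeasurableSpace Ω] [MeasurableSpace E] [MeasurableSpace F]
  {μ : Measure Ω} [IsProbabilityMeasure μ] {ι₁ ι₂ : Type*} [Fintype ι₁] [Fintype ι₂]
  [DecidableEq ι₂] {q : ℕ}
  {eps : ℤ → Ω → E} {xi : ℤ → Ω → F} {G : ℝ → (ℕ → E) → EuclideanSpace ℝ (ι₁ ⊕ ι₂)}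
  {V : ℝ → (ℕ → E) → ℝ} {H : ℝ → (ℕ → F) → ℝ} {β : ℝ → ι₁ ⊕ ι₂ → ℝ} {K : ℝ → ℝ} {b : ℕ → ℝ}

theorem measurable_modelError (hS : StandingAssumptions μ eps xi G V H) {n i : ℕ}
    (hi : i ∈ Finset.Icc 1 n) : Measurable fun ω => modelError eps xi V H n ω i :=
  ((hS.meas_H _ (design_mem_Icc hi)).comp (measurable_past hS.xi_iid i)).mul
    ((hS.meas_V _ (design_mem_Icc hi)).comp (measurable_past hS.eps_iid i))

/-- Stochastic order of the interaction between the errors and the parametric scores, and of the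
smoothed errors. -/
theorem isBigOP_smoothed_errors (hS : StandingAssumptions μ eps xi G V H)
    (hA : ConditionA μ eps xi G V H β) (hb : BandwidthCondition b) {A L : ℝ}
    {P : ℕ → Set (ℤ → E)} (hA0 : 0 ≤ A) (hL : 0 ≤ L) (hP : ∀ n, MeasurableSet (P n))
    (hSP : ∀ᶠ n in atTop, ∀ e ∈ P n, SmootherBounds n (b n) (pathNorm G n e)
      (smoother K (b n) n (block2 (regressor (fun i (e : ℤ → E) => e i) G n e))) A)
    {D : ℕ → ℕ → EuclideanSpace ℝ (Fin q) →L[ℝ] EuclideanSpace ℝ ι₁}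
    (hD : ∀ n, ∀ i ∈ Finset.Icc 1 n, ‖D n i‖ ≤ L) :
    (∀ l, IsBigOP μ (fun n ω => (P n).indicator 1 (fun j => eps j ω) * ∑ i ∈ Finset.Icc 1 n,
      modelError eps xi V H n ω i *
        residAdjoint n (smoother K (b n) n (block2 (regressor eps G n ω)))
          (resid n (smoother K (b n) n (block2 (regressor eps G n ω)))
            (parametricScore (D n) (regressor eps G n ω) l)) i) (fun n => √(n : ℝ))) ∧
    IsBigOP μ (fun n ω => (P n).indicator 1 (fun j => eps j ω) * ∑ i ∈ Finset.Icc 1 n,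
      (∑ j ∈ Finset.Icc 1 n, smoother K (b n) n (block2 (regressor eps G n ω)) i j *
        modelError eps xi V H n ω j) ^ 2) (fun n => (b n)⁻¹) := by
  obtain ⟨C, hC0, hC⟩ := exists_lintegral_smoothed_errors_le hS hA
  -- Regressors, smoother and scores are presented as functions of the path of `eps` alone, the form
  -- in which they can be frozen.
  obtain ⟨X, hreg, hX, hXm, hXn⟩ : ∃ X : ℕ → (ℤ → E) → ℕ → ι₁ ⊕ ι₂ → ℝ,
      (∀ n ω, regressor eps G n ω = X n fun j => eps j ω) ∧
      (∀ n e, regressor (fun i (e : ℤ → E) => e i) G n e = X n e) ∧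
      (∀ n, ∀ i ∈ Finset.Icc 1 n, ∀ a, Measurable fun e => X n e i a) ∧
      ∀ n e j, √(X n e j ⬝ᵥ X n e j) = pathNorm G n e j :=
    ⟨fun n e => regressor (fun i (e : ℤ → E) => e i) G n e, fun _ _ => rfl, fun _ _ => rfl,
      fun n i hi a => measurable_regressor_path hS hi a, fun _ _ _ => rfl⟩
  simp only [hX] at hSP
  simp only [hreg]
  obtain ⟨S, hS', hSm⟩ : ∃ S : ℕ → (ℤ → E) → ℕ → ℕ → ℝ,
      (∀ n e, smoother K (b n) n (block2 (X n e)) = S n e) ∧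
      ∀ n, ∀ i ∈ Finset.Icc 1 n, ∀ j ∈ Finset.Icc 1 n, Measurable fun e => S n e i j :=
    ⟨fun n e => smoother K (b n) n (block2 (X n e)), fun _ _ => rfl, fun n i hi j hj =>
      measurable_smoother K (b n) (fun j hj a => hXm n j hj (Sum.inr a)) hi hj⟩
  simp only [hS'] at hSP ⊢
  obtain ⟨z, hz, hzm, hzL⟩ : ∃ z : ℕ → Fin q → (ℤ → E) → ℕ → ℝ,
      (∀ n l e, parametricScore (D n) (X n e) l = z n l e) ∧
      (∀ n l, ∀ i ∈ Finset.Icc 1 n, Measurable fun e => z n l e i) ∧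
      ∀ n l e, ∀ i ∈ Finset.Icc 1 n, |z n l e i| ≤ L * pathNorm G n e i :=
    ⟨fun n l e => parametricScore (D n) (X n e) l, fun _ _ _ => rfl, fun n l i hi =>
      Finset.measurable_sum _ fun a _ => (hXm n i hi (Sum.inl a)).const_mul _,
      fun n l e i hi => (abs_parametricScore_le (hD n i hi) (X n e) l).trans_eq (by rw [hXn])⟩
  simp only [hz]
  have hpath : Measurable fun ω k => eps k ω := measurable_pi_lambda _ hS.eps_iid.1
  have hind : ∀ n, Measurable fun ω => (P n).indicator (1 : (ℤ → E) → ℝ) (fun j => eps j ω) :=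
    fun n => (measurable_one.indicator (hP n)).comp hpath
  constructor
  · intro l
    refine IsBigOP.of_sq (Eventually.of_forall fun n => Real.sqrt_nonneg _) ?_
    refine isBigOP_of_lintegral_le (C := C * ((1 + A ^ 2) ^ 2 * L) ^ 2) (by positivity)
      (fun n => ?_) ?_ ?_
    · refine (Measurable.pow_const ((hind n).mul (Finset.measurable_sum _ fun i hi => ?_))
        2).aemeasurable
      refine (measurable_modelError hS hi).mul ?_
      exact (measurable_residAdjoint (hSm n) (fun i hi => measurable_resid (hSm n) (hzm n l) hi)
        hi).comp hpath
    · filter_upwards [eventually_gt_atTop 0] with n hn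
      have : (0 : ℝ) < n := by exact_mod_cast hn
      positivity
    · filter_upwards [hSP] with n hn
      have := (hC n (b n) A (P n) (S n) (hP n) (hb.pos n) (hSm n) hn hA0).1 L
        (z n l) hL (hzm n l) fun e _ i hi => hzL n l e i hi
      simp only [abs_sq]
      refine this.trans (ENNReal.ofReal_le_ofReal ?_)
      rw [Real.sq_sqrt (Nat.cast_nonneg n)]
      exact (by ring : C * (n * ((1 + A ^ 2) ^ 2 * L) ^ 2) = _).le
  · refine isBigOP_of_lintegral_le (C := C * A ^ 3) (by positivity) (fun n => ?_)
      (Eventually.of_forall fun n => inv_pos.2 (hb.pos n)) ?_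
    · refine ((hind n).mul (Finset.measurable_sum _ fun i hi =>
        (Finset.measurable_sum _ fun j hj => ?_).pow_const 2)).aemeasurable
      exact ((hSm n i hi j hj).comp hpath).mul (measurable_modelError hS hj)
    · filter_upwards [hSP, eventually_gt_atTop 0] with n hn hn0
      have hn' : (0 : ℝ) < n := by exact_mod_cast hn0
      have hbn := hb.pos n
      have := (hC n (b n) A (P n) (S n) (hP n) (hb.pos n) (hSm n) hn hA0).2
      refine le_of_eq_of_le (lintegral_congr fun ω => ?_)
        (this.trans (ENNReal.ofReal_le_ofReal ?_))
      · rw [abs_of_nonneg (mul_nonneg (indicator_nonneg (fun _ _ => zero_le_one) _)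
          (Finset.sum_nonneg fun _ _ => sq_nonneg _))]
      · exact (by field_simp : C * (n * (A ^ 3 / (n * b n))) = _).le

end Core

/-- With `τ = T / √n`, the first term is a multiple of `s = √n b²` and the others are bounded; `s ≥
1` absorbs them. -/
theorem perturbation_bound_le {n b A B C L T s R Z q : ℝ} (hn : 0 < n) (hA : 0 ≤ A)
    (hL : 0 ≤ L) (hT : 0 ≤ T) (hq : 0 ≤ q) (hs : s = √n * b ^ 2) (hs1 : 1 ≤ s)
    (hB : B = A ^ 2 * (C * b ^ 2)) (hR : R ≤ T * n) (hZ : Z ≤ q * (T * √n)) :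
    2 * (B * ((1 + A ^ 2) * (L * (q + 1) * (T / √n))) * (A * n)) +
      2 * ((1 + A ^ 2) ^ 2 * (L * (T / √n) ^ 2) * R) + 2 * (T / √n * Z) +
      ((1 + A ^ 2) * (L * (q + 1) * (T / √n))) ^ 2 * (A * n) ≤
    (2 * (A ^ 3 * C * (1 + A ^ 2) * L * (q + 1) * T) + 2 * ((1 + A ^ 2) ^ 2 * L * T ^ 3) +
      2 * (q * T ^ 2) + ((1 + A ^ 2) * L * (q + 1) * T) ^ 2 * A) * s := by
  have hn2 : √n * √n = n := Real.mul_self_sqrt hn.le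
  have hsn : 0 < √n := Real.sqrt_pos.2 hn
  have t1 : 2 * (B * ((1 + A ^ 2) * (L * (q + 1) * (T / √n))) * (A * n)) =
      2 * (A ^ 3 * C * (1 + A ^ 2) * L * (q + 1) * T) * s := by
    rw [hB, hs]
    nth_rewrite 2 [← hn2]
    field_simp
  have t2 : 2 * ((1 + A ^ 2) ^ 2 * (L * (T / √n) ^ 2) * R) ≤
      2 * ((1 + A ^ 2) ^ 2 * L * T ^ 3) := by
    calc _ ≤ 2 * ((1 + A ^ 2) ^ 2 * (L * (T / √n) ^ 2) * (T * n)) := by gcongr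
      _ = _ := by
          nth_rewrite 2 [← hn2]
          field_simp
  have t3 : 2 * (T / √n * Z) ≤ 2 * (q * T ^ 2) := by
    calc _ ≤ 2 * (T / √n * (q * (T * √n))) := by gcongr
      _ = _ := by field_simp
  have t4 : ((1 + A ^ 2) * (L * (q + 1) * (T / √n))) ^ 2 * (A * n) =
      ((1 + A ^ 2) * L * (q + 1) * T) ^ 2 * A := by
    nth_rewrite 2 [← hn2]
    field_simp
  have h2 : 2 * ((1 + A ^ 2) ^ 2 * L * T ^ 3) ≤ 2 * ((1 + A ^ 2) ^ 2 * L * T ^ 3) * s :=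
    le_mul_of_one_le_right (by positivity) hs1
  have h3 : 2 * (q * T ^ 2) ≤ 2 * (q * T ^ 2) * s := le_mul_of_one_le_right (by positivity) hs1
  have h4 : ((1 + A ^ 2) * L * (q + 1) * T) ^ 2 * A ≤
      ((1 + A ^ 2) * L * (q + 1) * T) ^ 2 * A * s := le_mul_of_one_le_right (by positivity) hs1
  rw [t1, t4]
  linarith

theorem measure_union_iUnion_union_le {Ω : Type*} [MeasurableSpace Ω] {μ : Measure Ω} {q : ℕ}
    {S₁ S₂ S₄ S₅ S₆ : Set Ω} {S₃ : Fin q → Set Ω} {e : ℝ≥0∞} (h₁ : μ S₁ ≤ e) (h₂ : μ S₂ ≤ e)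
    (h₃ : ∀ l, μ (S₃ l) ≤ e) (h₄ : μ S₄ ≤ e) (h₅ : μ S₅ ≤ e) (h₆ : μ S₆ ≤ e) :
    μ (S₁ ∪ S₂ ∪ (⋃ l, S₃ l) ∪ S₄ ∪ S₅ ∪ S₆) ≤ (q + 5) * e := by
  have h3 : μ (⋃ l, S₃ l) ≤ q * e :=
    (measure_iUnion_fintype_le _ _).trans ((Finset.sum_le_sum fun l _ => h₃ l).trans_eq (by simp))
  calc _ ≤ e + e + q * e + e + e + e := by
        refine (measure_union_le _ _).trans (add_le_add ?_ h₆)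
        refine (measure_union_le _ _).trans (add_le_add ?_ h₅)
        refine (measure_union_le _ _).trans (add_le_add ?_ h₄)
        refine (measure_union_le _ _).trans (add_le_add ?_ h3)
        exact (measure_union_le _ _).trans (add_le_add h₁ h₂)
    _ = _ := by ring

/-! ### Both residual bounds on a single event -/

section Core

variable {Ω E F : Type*} [MeasurableSpace Ω] [MeasurableSpace E] [MeasurableSpace F]
  {μ : Measure Ω} [IsProbabilityMeasure μ] {p₁ p₂ q : ℕ}
  {eps : ℤ → Ω → E} {xi : ℤ → Ω → F} {G : ℝ → (ℕ → E) → EuclideanSpace ℝ (Fin p₁ ⊕ Fin p₂)}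
  {V : ℝ → (ℕ → E) → ℝ} {H : ℝ → (ℕ → F) → ℝ} {β : ℝ → Fin p₁ ⊕ Fin p₂ → ℝ} {K : ℝ → ℝ}
  {b : ℕ → ℝ} {β₀ : ℝ → EuclideanSpace ℝ (Fin q) → EuclideanSpace ℝ (Fin p₁)}
  {θ₀ : EuclideanSpace ℝ (Fin q)} {θhat : ℕ → Ω → EuclideanSpace ℝ (Fin q)}

/-- With probability arbitrarily close to one, plugging in the estimator changes the residual sum
of squares by at most `O(√n b²)`, while the residual sum of squares is at least of order `n`. -/
theorem exists_event_rss_bounds (hp₁ : 0 < p₁) (hS : StandingAssumptions μ eps xi G V H)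
    (hA : ConditionA μ eps xi G V H β) (hK : IsKernel K) (hb : BandwidthCondition b)
    (hnull : ∀ t ∈ Icc (0 : ℝ) 1, ∀ j, β t (Sum.inl j) = β₀ t θ₀ j)
    (hB : ConditionB μ β₀ θ₀ θhat)
    {βnull βplug : ℕ → Ω → ℕ → Fin p₂ → ℝ}
    (hβnull : ∀ n ω, ∀ i ∈ Finset.Icc 1 n,
      IsLocalLinearEstimate K (b n) n (block2 (regressor eps G n ω))
        (adjusted β₀ θ₀ n (regressor eps G n ω) (response eps xi G V H β n ω))
        (design n i) (βnull n ω i))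
    (hβplug : ∀ n ω, ∀ i ∈ Finset.Icc 1 n,
      IsLocalLinearEstimate K (b n) n (block2 (regressor eps G n ω))
        (adjusted β₀ (θhat n ω) n (regressor eps G n ω) (response eps xi G V H β n ω))
        (design n i) (βplug n ω i))
    {RSS₁ RSSplug : ℕ → Ω → ℝ}
    (hRSS₁ : ∀ n ω, RSS₁ n ω = RSS n (block2 (regressor eps G n ω))
      (adjusted β₀ θ₀ n (regressor eps G n ω) (response eps xi G V H β n ω)) (βnull n ω))
    (hRSSplug : ∀ n ω, RSSplug n ω = RSS n (block2 (regressor eps G n ω))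
      (adjusted β₀ (θhat n ω) n (regressor eps G n ω) (response eps xi G V H β n ω))
      (βplug n ω)) :
    ∃ c : ℝ, 0 < c ∧ ∀ η : ℝ, 0 < η → ∃ T : ℝ, 0 < T ∧ ∀ᶠ n in atTop, ∃ N : Set Ω,
      μ N ≤ ENNReal.ofReal η ∧ ∀ ω ∉ N,
        |RSSplug n ω - RSS₁ n ω| ≤ T * (√(n : ℝ) * b n ^ 2) ∧ c * n ≤ RSS₁ n ω := by
  have : Nonempty (Fin p₁ ⊕ Fin p₂) := ⟨Sum.inl ⟨0, hp₁⟩⟩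
  obtain ⟨A, P, hA0, hP, hPlim, hSP⟩ := exists_paths_smootherBounds hS hA hK hb
  obtain ⟨Θ, hΘ, hθ₀, hsm, C₀, hC₀⟩ := hB.B1
  obtain ⟨r₀, hr₀, hball⟩ := Metric.isOpen_iff.1 hΘ θ₀ hθ₀
  obtain ⟨Cβ, hCβ0, hCβ⟩ := exists_bias_bound (K := K) fun a => hA.A8 (Sum.inr a)
  set L := |C₀| with hLdef
  have hL : 0 ≤ L := abs_nonneg _
  set D : ℕ → ℕ → EuclideanSpace ℝ (Fin q) →L[ℝ] EuclideanSpace ℝ (Fin p₁) :=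
    fun n i => fderiv ℝ (β₀ (design n i)) θ₀ with hDdef
  have hD : ∀ n, ∀ i ∈ Finset.Icc 1 n, ‖D n i‖ ≤ L := fun n i hi => by
    have := hC₀ _ (design_mem_Icc hi) θ₀ hθ₀
    rw [norm_iteratedFDeriv_one] at this
    exact ((le_add_of_nonneg_right (norm_nonneg _)).trans this).trans (le_abs_self _)
  have hT : ∀ n, ∀ i ∈ Finset.Icc 1 n, ∀ θ ∈ Metric.ball θ₀ r₀,
      ‖β₀ (design n i) θ - β₀ (design n i) θ₀ - D n i (θ - θ₀)‖ ≤ L * ‖θ - θ₀‖ ^ 2 :=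
    fun n i hi θ hθ => (norm_sub_sub_fderiv_le hΘ hball (hsm _ (design_mem_Icc hi))
      (hC₀ _ (design_mem_Icc hi)) hθ).trans (by gcongr; exact le_abs_self _)
  obtain ⟨hZ, hQ⟩ := isBigOP_smoothed_errors hS hA hb hA0 hL hP
    (hSP.mono fun n hn e he => (hn e he).1) hD
  have hR := isBigOP_sum_score hS hA
  obtain ⟨c₀, hc₀, hU⟩ := exists_tendsto_sum_score_lt hS hA
  have hθ := isBigOP_norm_estimator hB
  -- Cauchy–Schwarz with `∑ |x_i|² ≤ A n` turns `∑ |x_i| |ε_i| ≥ c₀ n` into `∑ ε_i² ≥ c₁ n`; the `+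
  -- 1` avoids division by zero.
  set c₁ := c₀ ^ 2 / (A + 1) with hc₁
  have hc₁0 : 0 < c₁ := by positivity
  -- Smoothed errors and bias each take at most `c₁ n / 4` from `c₁ n`; the remaining half is
  -- divided by the factor `3` of `sum_sq_le_sum_resid_adjusted_sq`.
  refine ⟨c₁ / 6, by positivity, fun η hη => ?_⟩
  -- There are `q + 5` exceptional events: irregular path, small score sum, `q` linear forms, large
  -- smoothed errors, large score sum, and inaccurate estimator.
  set η' := η / (q + 5) with hη'
  have hη'0 : 0 < η' := by positivity
  choose TZ hTZ0 hTZ using fun l => hZ l η' hη'0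
  obtain ⟨TQ, hTQ0, hTQ⟩ := hQ η' hη'0
  obtain ⟨TR, hTR0, hTR⟩ := hR η' hη'0
  obtain ⟨Tθ, hTθ0, hTθ⟩ := hθ η' hη'0
  set T := ∑ l, TZ l + TQ + TR + Tθ with hTdef
  have hsumTZ : 0 ≤ ∑ l, TZ l := Finset.sum_nonneg fun l _ => (hTZ0 l).le
  have hT0 : 0 < T := by positivity
  have hTZle : ∀ l, TZ l ≤ T := fun l => by
    have := Finset.single_le_sum (fun l _ => (hTZ0 l).le) (Finset.mem_univ l)
    linarith
  have hTQle : TQ ≤ T := by linarith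
  have hTRle : TR ≤ T := by linarith
  have hTθle : Tθ ≤ T := by linarith
  have hsqrt : Tendsto (fun n : ℕ => T / √(n : ℝ)) atTop (𝓝 0) :=
    tendsto_const_nhds.div_atTop (Real.tendsto_sqrt_atTop.comp tendsto_natCast_atTop_atTop)
  have hη'e : (0 : ℝ≥0∞) < ENNReal.ofReal η' := ENNReal.ofReal_pos.2 hη'0
  have hbias : Tendsto (fun n => 3 * (A ^ 2 * (Cβ * b n ^ 2)) ^ 2 * A) atTop (𝓝 0) := by
    have := (((((hb.tendsto_zero.pow 2).const_mul Cβ).const_mul (A ^ 2)).pow 2).const_mul 3).mul_const A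
    simpa using this
  refine ⟨2 * (A ^ 3 * Cβ * (1 + A ^ 2) * L * (q + 1) * T) + 2 * ((1 + A ^ 2) ^ 2 * L * T ^ 3) +
      2 * (q * T ^ 2) + ((1 + A ^ 2) * L * (q + 1) * T) ^ 2 * A + 1, by positivity, ?_⟩
  -- For large `n` the radius `T / √n` is at most one and keeps the estimator in the ball of the
  -- Taylor expansion, while `n b ≥ 12 T / c₁` brings the smoothed errors, of order `1 / b`, below
  -- `c₁ n / 4`.
  filter_upwards [hSP, hPlim.eventually_le_const hη'e, hU.eventually_le_const hη'e,
    eventually_all.2 hTZ, hTQ, hTR, hTθ, hsqrt.eventually_le_const one_pos,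
    hsqrt.eventually_lt_const hr₀, eventually_gt_atTop 0,
    hb.tendsto_sqrt_mul_sq.eventually_ge_atTop 1,
    hb.tendsto_mul.eventually_ge_atTop (12 * T / c₁),
    hbias.eventually_le_const (show 0 < c₁ / 4 by positivity)]
    with n hSPn hPn hUn hZn hQn hRn hθn hτ1 hτr hn0 hs1 hnb hbn
  have hn : (0 : ℝ) < n := by exact_mod_cast hn0
  have hsn : 0 < √(n : ℝ) := Real.sqrt_pos.2 hn
  have hbpos := hb.pos n
  refine ⟨_, (measure_union_iUnion_union_le hPn hUn hZn hQn hRn hθn).trans_eq ?_, fun ω hω => ?_⟩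
  · rw [← ENNReal.ofReal_natCast, ← ENNReal.ofReal_ofNat, ← ENNReal.ofReal_add (by positivity)
      (by norm_num), ← ENNReal.ofReal_mul (by positivity)]
    congr 1
    rw [hη']
    field_simp
  simp only [mem_union, mem_iUnion, mem_ofPred_eq, not_or, not_exists, not_lt, not_not] at hω
  obtain ⟨⟨⟨⟨⟨hω1, hω2⟩, hω3⟩, hω4⟩, hω5⟩, hω6⟩ := hω
  obtain ⟨hSb, κ, hκ, hGram⟩ := hSPn _ hω1
  simp only [indicator_of_mem hω1, Pi.one_apply, one_mul, norm_Uproc_eq] at hω2 hω3 hω4 hω5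
  set x := regressor eps G n ω with hx
  set ε := modelError eps xi V H n ω with hε
  set S := smoother K (b n) n (block2 x) with hSdef
  replace hSb : SmootherBounds n (b n) (fun j => √(x j ⬝ᵥ x j)) S A := hSb
  replace hGram : ∀ i ∈ Finset.Icc 1 n, GramCoercive K (b n) n (block2 x) i κ := hGram
  have hy : ∀ j, response eps xi G V H β n ω j = x j ⬝ᵥ β (design n j) + ε j := fun _ => rfl
  have hℓ : ∀ i ∈ Finset.Icc 1 n,
      |resid n S (fun j => block2 x j ⬝ᵥ fun a => β (design n j) (Sum.inr a)) i| ≤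
        A ^ 2 * (Cβ * b n ^ 2) * √(x i ⬝ᵥ x i) := fun i hi =>
    hCβ n (b n) A (block2 x) (fun j => √(x j ⬝ᵥ x j)) hSb
      (fun j => Real.sqrt_le_sqrt (block2_dotProduct_self_le x j)) i hi κ hκ (hGram i hi)
  have hr1 : RSS₁ n ω = ∑ i ∈ Finset.Icc 1 n,
      resid n S (adjusted β₀ θ₀ n x (response eps xi G V H β n ω)) i ^ 2 :=
    (hRSS₁ n ω).trans (rss_eq_sum_resid_sq hκ hbpos.ne' hGram (hβnull n ω))
  have hr2 : RSSplug n ω = ∑ i ∈ Finset.Icc 1 n,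
      resid n S (adjusted β₀ (θhat n ω) n x (response eps xi G V H β n ω)) i ^ 2 :=
    (hRSSplug n ω).trans (rss_eq_sum_resid_sq hκ hbpos.ne' hGram (hβplug n ω))
  have hRn0 : 0 ≤ ∑ i ∈ Finset.Icc 1 n, √(x i ⬝ᵥ x i) * |ε i| :=
    Finset.sum_nonneg fun _ _ => by positivity
  have hθle : ‖θhat n ω - θ₀‖ ≤ T / √(n : ℝ) := by
    rw [abs_norm, mul_one_div] at hω6
    exact hω6.trans (by gcongr)
  constructor
  · rw [hr1, hr2]
    have hmem : θhat n ω ∈ Metric.ball θ₀ r₀ := by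
      rw [Metric.mem_ball, dist_eq_norm]
      exact hθle.trans_lt hτr
    refine (abs_sum_resid_adjusted_sub_le (D := D n) (τ := T / √(n : ℝ)) hSb hy hnull
      (by positivity) hL (by positivity) hτ1 hθle hℓ (hD n)
      fun i hi => (hT n i hi _ hmem).trans (by gcongr)).trans ?_
    refine (perturbation_bound_le hn hA0 hL hT0.le (Nat.cast_nonneg q) rfl hs1 rfl
      ?_ ?_).trans ?_
    · exact (le_abs_self _).trans (hω5.trans (by gcongr))
    · have := Finset.sum_le_card_nsmul Finset.univ (fun l => |∑ i ∈ Finset.Icc 1 n,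
        ε i * residAdjoint n S (resid n S (parametricScore (D n) x l)) i|) (T * √(n : ℝ))
        fun l _ => (hω3 l).trans (by gcongr; exact hTZle l)
      simpa using this
    · have : 0 ≤ √(n : ℝ) * b n ^ 2 := by positivity
      exact mul_le_mul_of_nonneg_right (le_add_of_nonneg_right zero_le_one) this
  · have h1 := sum_sq_le_sum_resid_adjusted_sq hSb hy hnull hℓ
    rw [← hr1] at h1
    have h2 : (c₀ * n) ^ 2 ≤ A * n * ∑ i ∈ Finset.Icc 1 n, ε i ^ 2 := by
      calc _ ≤ (∑ i ∈ Finset.Icc 1 n, √(x i ⬝ᵥ x i) * |ε i|) ^ 2 := by gcongr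
        _ ≤ (∑ i ∈ Finset.Icc 1 n, √(x i ⬝ᵥ x i) ^ 2) * ∑ i ∈ Finset.Icc 1 n, |ε i| ^ 2 :=
            Finset.sum_mul_sq_le_sq_mul_sq _ _ _
        _ ≤ _ := by
            simp only [sq_abs]
            gcongr
            exact hSb.total
    have hε0 : 0 ≤ ∑ i ∈ Finset.Icc 1 n, ε i ^ 2 := Finset.sum_nonneg fun _ _ => sq_nonneg _
    have h3 : c₁ * n ≤ ∑ i ∈ Finset.Icc 1 n, ε i ^ 2 := by
      rw [hc₁, div_mul_eq_mul_div, div_le_iff₀ (by positivity)]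
      refine le_of_mul_le_mul_right ?_ hn
      calc c₀ ^ 2 * n * n = (c₀ * n) ^ 2 := by ring
        _ ≤ _ := h2
        _ ≤ (A + 1) * n * ∑ i ∈ Finset.Icc 1 n, ε i ^ 2 := by
            gcongr
            exact le_add_of_nonneg_right zero_le_one
        _ = _ := by ring
    have h4 : 3 * ∑ i ∈ Finset.Icc 1 n, (∑ j ∈ Finset.Icc 1 n, S i j * ε j) ^ 2 ≤
        c₁ / 4 * n := by
      have h5 := (le_abs_self _).trans hω4
      have h6 : TQ * (b n)⁻¹ ≤ T * (b n)⁻¹ := by gcongr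
      have h7 : T * (b n)⁻¹ ≤ c₁ / 12 * n := by
        rw [← div_eq_mul_inv, div_le_iff₀ hbpos]
        rw [div_le_iff₀ hc₁0] at hnb
        linarith
      linarith
    have h5 : 3 * ((A ^ 2 * (Cβ * b n ^ 2)) ^ 2 * (A * n)) ≤ c₁ / 4 * n := by
      calc _ = 3 * (A ^ 2 * (Cβ * b n ^ 2)) ^ 2 * A * n := by ring
        _ ≤ _ := by gcongr
    linarith

end Core

/-! ### Slutsky's theorem for distribution functions -/

/-- The mass of a point is the jump of the distribution function there. -/
theorem continuousAt_cdf_iff {ν : Measure ℝ} [IsProbabilityMeasure ν] {x : ℝ} :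
    ContinuousAt (cdf ν) x ↔ ν {x} = 0 := by
  have h1 : ν {x} = ENNReal.ofReal (cdf ν x - Function.leftLim (cdf ν) x) := by
    conv_lhs => rw [← measure_cdf ν]
    exact (cdf ν).measure_singleton x
  rw [(cdf ν).mono.continuousAt_iff_leftLim_eq_rightLim, (cdf ν).rightLim_eq, h1,
    ENNReal.ofReal_eq_zero, sub_nonpos]
  exact ⟨fun h => h.ge, fun h => le_antisymm ((cdf ν).mono.leftLim_le le_rfl) h⟩

theorem dense_setOf_measure_singleton_eq_zero (ν : Measure ℝ) [IsProbabilityMeasure ν] :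
    Dense {x | ν {x} = 0} := by
  have := (cdf ν).mono.countable_not_continuousAt.dense_compl ℝ
  refine this.mono fun x hx => ?_
  simpa [continuousAt_cdf_iff] using hx

/-- The event `X ≤ y` is contained in `Y ≤ x` up to `|X - Y| ≥ x - y` for `y < x`, and symmetrically
from above. Points without mass are dense, so `y` can be one of them, close enough to `x` for
continuity. -/
theorem ConvergesInLaw.of_sub_tendsto_zero {Ω : Type*} [MeasurableSpace Ω] {μ : Measure Ω}
    {X Y : ℕ → Ω → ℝ} {ν : Measure ℝ} [IsProbabilityMeasure ν]
    (hX : ConvergesInLaw μ X ν)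
    (hXY : ∀ δ, 0 < δ → Tendsto (fun n => μ {ω | δ ≤ |X n ω - Y n ω|}) atTop (𝓝 0)) :
    ConvergesInLaw μ Y ν := by
  intro x hx
  have hcont : ContinuousAt (fun y => ν (Iic y)) x := by
    have h1 : (fun y => ν (Iic y)) = fun y => ENNReal.ofReal (cdf ν y) := by
      ext y; rw [ofReal_cdf]
    rw [h1]
    exact ENNReal.continuous_ofReal.continuousAt.comp (continuousAt_cdf_iff.2 hx)
  have hdense := dense_setOf_measure_singleton_eq_zero ν
  rw [tendsto_order]
  constructor
  · intro a ha
    obtain ⟨r, hr, hball⟩ := Metric.eventually_nhds_iff.1 (hcont.eventually_const_lt ha)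
    obtain ⟨y, hy0, hy⟩ := hdense.exists_between (show x - r < x by linarith)
    have hya : a < ν (Iic y) := hball (by
      rw [Real.dist_eq, abs_lt]; constructor <;> linarith [hy.1, hy.2])
    have hlim := ENNReal.Tendsto.sub (hX y hy0) (hXY (x - y) (by linarith [hy.2]))
      (Or.inr ENNReal.zero_ne_top)
    rw [tsub_zero] at hlim
    filter_upwards [hlim.eventually_const_lt hya] with n hn
    refine hn.trans_le (tsub_le_iff_right.2 ?_)
    refine (measure_mono fun ω (hω : X n ω ≤ y) => ?_).trans (measure_union_le _ _)
    by_cases h : Y n ω ≤ x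
    · exact Or.inl h
    · right
      rw [mem_ofPred_eq, abs_sub_comm]
      exact le_trans (by linarith) (le_abs_self _)
  · intro a ha
    obtain ⟨r, hr, hball⟩ := Metric.eventually_nhds_iff.1 (hcont.eventually_lt_const ha)
    obtain ⟨y, hy0, hy⟩ := hdense.exists_between (show x < x + r by linarith)
    have hya : ν (Iic y) < a := hball (by
      rw [Real.dist_eq, abs_lt]; constructor <;> linarith [hy.1, hy.2])
    have hlim := (hX y hy0).add (hXY (y - x) (by linarith [hy.1]))
    rw [add_zero] at hlim
    filter_upwards [hlim.eventually_lt_const hya] with n hn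
    refine lt_of_le_of_lt ?_ hn
    refine (measure_mono fun ω (hω : Y n ω ≤ x) => ?_).trans (measure_union_le _ _)
    by_cases h : X n ω ≤ y
    · exact Or.inl h
    · right
      rw [mem_ofPred_eq]
      exact le_trans (by linarith) (le_abs_self _)

/-! ### Comparison of the likelihood ratio statistics -/

/-- The common denominator cancels, and `log u ≤ u - 1` is applied to `p / r` and to `r / p`; the
factor `2` pays for `p ≥ r / 2`. -/
theorem abs_log_div_sub_log_div_le {p r a d : ℝ} (hr : 0 < r) (hd : |p - r| ≤ d)
    (hdr : d ≤ r / 2) : |Real.log (p / a) - Real.log (r / a)| ≤ 2 * d / r := by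
  have hp : r / 2 ≤ p := by linarith [neg_abs_le (p - r)]
  have hp0 : 0 < p := by linarith
  have hd0 : 0 ≤ d := (abs_nonneg _).trans hd
  -- For `a = 0` both quotients are zero by convention, so the alternative residual sum of squares
  -- may vanish.
  rcases eq_or_ne a 0 with rfl | ha
  · simp only [div_zero, sub_self, abs_zero]
    positivity
  rw [Real.log_div hp0.ne' ha, Real.log_div hr.ne' ha, sub_sub_sub_cancel_right]
  have h1 : Real.log p - Real.log r ≤ d / r := by
    rw [← Real.log_div hp0.ne' hr.ne']
    refine (Real.log_le_sub_one_of_pos (by positivity)).trans ?_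
    rw [div_sub_one hr.ne']
    gcongr
    exact (le_abs_self _).trans hd
  have h2 : Real.log r - Real.log p ≤ d / (r / 2) := by
    rw [← Real.log_div hr.ne' hp0.ne']
    refine (Real.log_le_sub_one_of_pos (by positivity)).trans ?_
    rw [div_sub_one hp0.ne']
    refine (div_le_div_of_nonneg_right ((neg_le_abs (p - r)).trans hd |>.trans' (by linarith))
      hp0.le).trans ?_
    gcongr
  have h3 : d / (r / 2) = 2 * d / r := by field_simp
  have h4 : d / r ≤ 2 * d / r := by gcongr; linarith
  rw [abs_le]
  constructor <;> linarith

/-- On the good event the difference is at most `√b · n · 2 T √n b² / (c n) = (2 T / c) √(n b⁵)`,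
which tends to zero. The residual sums need not be measurable, as the bad set is covered by `N`. -/
theorem tendsto_sqrt_mul_glrt_sub {Ω : Type*} [MeasurableSpace Ω] {μ : Measure Ω} {b : ℕ → ℝ}
    (hb : BandwidthCondition b) {R₁ R₂ Ra : ℕ → Ω → ℝ} {c : ℝ} (hc : 0 < c)
    (h : ∀ η : ℝ, 0 < η → ∃ T : ℝ, 0 < T ∧ ∀ᶠ n : ℕ in atTop, ∃ N : Set Ω,
      μ N ≤ ENNReal.ofReal η ∧ ∀ ω ∉ N,
        |R₂ n ω - R₁ n ω| ≤ T * (√(n : ℝ) * b n ^ 2) ∧ c * n ≤ R₁ n ω)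
    {δ : ℝ} (hδ : 0 < δ) :
    Tendsto (fun n => μ {ω | δ ≤ |√(b n) * (2 * glrt n (R₂ n ω) (Ra n ω)) -
      √(b n) * (2 * glrt n (R₁ n ω) (Ra n ω))|}) atTop (𝓝 0) := by
  rw [ENNReal.tendsto_nhds_zero]
  intro e he
  obtain ⟨η, hη, hηe⟩ : ∃ η : ℝ, 0 < η ∧ ENNReal.ofReal η ≤ e := by
    obtain ⟨η, hη, hle⟩ := ENNReal.lt_iff_exists_nnreal_btwn.1 he
    exact ⟨η, by exact_mod_cast hη, by rw [ENNReal.ofReal_coe_nnreal]; exact hle.le⟩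
  obtain ⟨T, hT, hev⟩ := h η hη
  have h1 : Tendsto (fun n : ℕ => 2 * T / c * √((n : ℝ) * b n ^ 5)) atTop (𝓝 0) := by
    simpa using hb.tendsto_mul_pow_five.sqrt.const_mul (2 * T / c)
  have h2 : Tendsto (fun n : ℕ => T * b n ^ 2 / √(n : ℝ)) atTop (𝓝 0) := by
    have := (hb.tendsto_zero.pow 2).const_mul T
    have h3 : Tendsto (fun n : ℕ => (√(n : ℝ))⁻¹) atTop (𝓝 0) :=
      tendsto_inv_atTop_zero.comp (Real.tendsto_sqrt_atTop.comp tendsto_natCast_atTop_atTop)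
    simpa [div_eq_mul_inv] using this.mul h3
  filter_upwards [hev, h1.eventually_lt_const hδ,
    h2.eventually_le_const (show 0 < c / 2 by positivity), eventually_gt_atTop 0]
    with n ⟨N, hN, hgood⟩ hn1 hn2 hn0
  have hn : (0 : ℝ) < n := by exact_mod_cast hn0
  have hsn : 0 < √(n : ℝ) := Real.sqrt_pos.2 hn
  have hnn : √(n : ℝ) * √(n : ℝ) = n := Real.mul_self_sqrt hn.le
  have hbn := hb.pos n
  refine (measure_mono fun ω hω => ?_).trans (hN.trans hηe)
  by_contra hωN
  obtain ⟨hd, hlow⟩ := hgood ω hωN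
  refine absurd (hω : δ ≤ _) (not_le.2 (lt_of_le_of_lt ?_ hn1))
  have hd2 : T * (√(n : ℝ) * b n ^ 2) ≤ R₁ n ω / 2 := by
    rw [div_le_iff₀ hsn] at hn2
    have : T * b n ^ 2 * √(n : ℝ) ≤ c / 2 * √(n : ℝ) * √(n : ℝ) := by gcongr
    rw [mul_assoc (c / 2), hnn] at this
    linarith
  have hr : 0 < R₁ n ω := lt_of_lt_of_le (by positivity) hlow
  have hlog := abs_log_div_sub_log_div_le (a := Ra n ω) hr hd hd2
  have hfac : √(b n) * (2 * glrt n (R₂ n ω) (Ra n ω)) -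
      √(b n) * (2 * glrt n (R₁ n ω) (Ra n ω)) =
      √(b n) * n * (Real.log (R₂ n ω / Ra n ω) - Real.log (R₁ n ω / Ra n ω)) := by
    simp only [glrt]
    ring
  have hsq : √((n : ℝ) * b n ^ 5) = √(n : ℝ) * b n ^ 2 * √(b n) := by
    rw [Real.sqrt_mul hn.le, show b n ^ 5 = (b n ^ 2) ^ 2 * b n by ring,
      Real.sqrt_mul (by positivity), Real.sqrt_sq (by positivity), mul_assoc]
  rw [hfac, abs_mul, abs_of_nonneg (show 0 ≤ √(b n) * n by positivity), hsq]
  calc _ ≤ √(b n) * n * (2 * (T * (√(n : ℝ) * b n ^ 2)) / R₁ n ω) := by gcongr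
    _ ≤ √(b n) * n * (2 * (T * (√(n : ℝ) * b n ^ 2)) / (c * n)) := by gcongr
    _ = _ := by field_simp

theorem mainTheorem8
    {Ω E F : Type*} [MeasurableSpace Ω] [MeasurableSpace E] [MeasurableSpace F]
    (μ : Measure Ω) [IsProbabilityMeasure μ]
    -- `p₁ + p₂` regressors; `p₂ = 0` is the fully parametric null hypothesis
    {p₁ p₂ q : ℕ} (hp₁ : 0 < p₁)
    (eps : ℤ → Ω → E) (xi : ℤ → Ω → F)
    (G : ℝ → (ℕ → E) → EuclideanSpace ℝ (Fin p₁ ⊕ Fin p₂))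
    (V : ℝ → (ℕ → E) → ℝ) (H : ℝ → (ℕ → F) → ℝ)
    (β : ℝ → Fin p₁ ⊕ Fin p₂ → ℝ)
    (hS : StandingAssumptions μ eps xi G V H)
    (hA : ConditionA μ eps xi G V H β)
    (K : ℝ → ℝ) (hK : IsKernel K)
    (b : ℕ → ℝ) (hb : BandwidthCondition b)
    (β₀ : ℝ → EuclideanSpace ℝ (Fin q) → EuclideanSpace ℝ (Fin p₁))
    (θ₀ : EuclideanSpace ℝ (Fin q)) (θhat : ℕ → Ω → EuclideanSpace ℝ (Fin q))
    -- the composite null hypothesis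
    (hnull : ∀ t ∈ Icc (0 : ℝ) 1, ∀ j, β t (Sum.inl j) = β₀ t θ₀ j)
    (hB : ConditionB μ β₀ θ₀ θhat)
    -- the regressors and responses, in the `n`-th experiment
    (x : ℕ → Ω → ℕ → Fin p₁ ⊕ Fin p₂ → ℝ) (hx : x = regressor eps G)
    (y : ℕ → Ω → ℕ → ℝ) (hy : y = response eps xi G V H β)
    -- the local linear estimates at `t_i`: under the null hypothesis with `θ₀`,
    -- under the null hypothesis with `θhat`, and under the alternative
    (βnull βplug : ℕ → Ω → ℕ → Fin p₂ → ℝ) (βalt : ℕ → Ω → ℕ → Fin p₁ ⊕ Fin p₂ → ℝ)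
    (hβnull : ∀ n ω, ∀ i ∈ Finset.Icc 1 n,
      IsLocalLinearEstimate K (b n) n (block2 (x n ω))
        (adjusted β₀ θ₀ n (x n ω) (y n ω)) (design n i) (βnull n ω i))
    (hβplug : ∀ n ω, ∀ i ∈ Finset.Icc 1 n,
      IsLocalLinearEstimate K (b n) n (block2 (x n ω))
        (adjusted β₀ (θhat n ω) n (x n ω) (y n ω)) (design n i) (βplug n ω i))
    (hβalt : ∀ n ω, ∀ i ∈ Finset.Icc 1 n,
      IsLocalLinearEstimate K (b n) n (x n ω) (y n ω) (design n i) (βalt n ω i))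
    (RSS₁ RSSplug RSSa : ℕ → Ω → ℝ)
    (hRSS₁ : ∀ n ω, RSS₁ n ω =
      RSS n (block2 (x n ω)) (adjusted β₀ θ₀ n (x n ω) (y n ω)) (βnull n ω))
    (hRSSplug : ∀ n ω, RSSplug n ω =
      RSS n (block2 (x n ω)) (adjusted β₀ (θhat n ω) n (x n ω) (y n ω)) (βplug n ω))
    (hRSSa : ∀ n ω, RSSa n ω = RSS n (x n ω) (y n ω) (βalt n ω)) :
    -- `RSSplug - RSS₁ = O_P(√n b_n²) + O_P(1)`
    (∃ B W : ℕ → Ω → ℝ,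
      IsBigOP μ B (fun n => √(n : ℝ) * b n ^ 2) ∧ IsBigOP μ W (fun _ => 1) ∧
      ∀ n ω, RSSplug n ω - RSS₁ n ω = B n ω + W n ω) ∧
    -- the normalised statistics with and without estimation of `θ₀` are asymptotically equivalent
    TendstoInMeasure μ
      (fun n ω => √(b n) * (2 * glrt n (RSSplug n ω) (RSSa n ω))
        - √(b n) * (2 * glrt n (RSS₁ n ω) (RSSa n ω))) atTop (fun _ => 0) ∧
    -- hence any limit theorem for one of them is a limit theorem for the other
    (∀ (c : ℕ → ℝ) (ν : Measure ℝ), IsProbabilityMeasure ν →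
      (ConvergesInLaw μ (fun n ω => √(b n) * (2 * glrt n (RSSplug n ω) (RSSa n ω) + c n)) ν ↔
       ConvergesInLaw μ (fun n ω => √(b n) * (2 * glrt n (RSS₁ n ω) (RSSa n ω) + c n)) ν)) := by
  subst hx hy
  obtain ⟨c, hc, hcore⟩ := exists_event_rss_bounds hp₁ hS hA hK hb hnull hB hβnull hβplug
    hRSS₁ hRSSplug
  have hdiff := fun δ (hδ : (0 : ℝ) < δ) => tendsto_sqrt_mul_glrt_sub (Ra := RSSa) hb hc hcore hδ
  -- The bounded part is taken to be zero, because `√n b² → ∞` already dominates it.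
  refine ⟨⟨fun n ω => RSSplug n ω - RSS₁ n ω, fun _ _ => 0, ?_, ?_, ?_⟩, ?_, ?_⟩
  · intro η hη
    obtain ⟨T, hT, hev⟩ := hcore η hη
    refine ⟨T, hT, ?_⟩
    filter_upwards [hev] with n ⟨N, hN, hgood⟩
    refine (measure_mono fun ω hω => ?_).trans hN
    by_contra hωN
    exact absurd (hgood ω hωN).1 (not_le.2 hω)
  · exact fun η _ => ⟨1, one_pos, Eventually.of_forall fun n => by
      have : {ω : Ω | (1 : ℝ) * 1 < |(0 : ℝ)|} = ∅ := by
        ext ω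
        simp
      exact (congrArg μ this).trans_le (by simp)⟩
  · exact fun n ω => (add_zero _).symm
  · rw [tendstoInMeasure_iff_norm]
    intro δ hδ
    simpa [Real.norm_eq_abs] using hdiff δ hδ
  · intro d ν hν
    -- The centring constants cancel in the difference, and closeness in probability is symmetric.
    constructor <;> intro h <;> refine h.of_sub_tendsto_zero fun δ hδ => ?_
    · refine (hdiff δ hδ).congr fun n => ?_
      congr 1
      ext ω
      simp only [mem_ofPred_eq, mul_add, add_sub_add_right_eq_sub]
    · refine (hdiff δ hδ).congr fun n => ?_
      congr 1
      ext ω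
      rw [mem_ofPred_eq, mem_ofPred_eq, abs_sub_comm]
      simp only [mul_add, add_sub_add_right_eq_sub]
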